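/- Let $(M^m,g_M)$ and $(N^n,g_N)$ be smooth Riemannian manifolds (without boundary, Hausdorff, second countable), with $N$ non-empty and $n\ge 1$, and let $\lambda\colon M\to\mathbb{R}$ be smooth. Consider the Riemannian submersion $$\phi\colon (M\times N,\; g_M+e^{2\lambda}g_N)\longrightarrow (M,g_M),\qquad \phi(x,y)=x,$$ given by the projection of the warped product onto its first factor. A smooth map $\psi\colon(P,g)\to(Q,h)$ of Riemannian manifolds is called biharmonic if, for every compact $\Omega\subset P$, it is a critical point, with respect to all smooth variations supported in $\Omega$, of the bienergy $$E_2(\psi,\Omega)=\frac12\int_\Omega|\tau(\psi)|^2\,dv_g,$$ where $\tau(\psi)=\mathrm{Trace}_g\nabla d\psi$ is the tension field of $\psi$. Then $\phi$ is biharmonic if and only if $$\mathrm{grad}\,\Delta\lambda+2\,\mathrm{Ric}^M(\mathrm{grad}\,\lambda)+\frac n2\,\mathrm{grad}\,|\mathrm{grad}\,\lambda|^2=0\quad\text{on }M,$$ where $\mathrm{grad}$, $\Delta=\mathrm{Trace}_{g_M}\nabla d$ and $\mathrm{Ric}^M$ (the Ricci operator, $\mathrm{Ric}^M(X)=\sum_i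 R^M(X,e_i)e_i$ for an orthonormal frame $(e_i)$, with $R^M(X,Y)Z=[\nabla_X,\nabla_Y]Z-\nabla_{[X,Y]}Z$) are those of $(M,g_M)$. -/

import Mathlib

open Bundle Manifold MeasureTheory Set
open scoped ContDiff Topology

noncomputable section

namespace RiemannianGeometry

/-- The pull-back `(v, w) ↦ B (A v) (A w)` of a bilinear form `B` along a linear map `A`. -/
def pullbackForm {V W : Type*} [AddCommGroup V] [Module ℝ V] [TopologicalSpace V]
    [AddCommGroup W] [Module ℝ W] [TopologicalSpace W]
    (B : V →L[ℝ] V →L[ℝ] ℝ) (A : W →L[ℝ] V) : W →L[ℝ] W →L[ℝ] ℝ :=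
  (ContinuousLinearMap.precomp ℝ A) ∘L B ∘L A

/-! ### Riemannian geometry in coordinates

`E` is the coordinate space, `G y` the matrix (bilinear form) of the metric at the coordinate
point `y`, and `(G y).inverse : (E →L[ℝ] ℝ) →L[ℝ] E` raises indices. -/

section Coordinates

variable {E : Type*} [NormedAddCommGroup E] [NormedSpace ℝ E] [FiniteDimensional ℝ E]
  {F : Type*} [NormedAddCommGroup F] [NormedSpace ℝ F]

/-- The trace `g^{ij} B_{ij}` of a (vector-valued) bilinear map `B` with respect to a metric `G`. -/
def metricTrace (G : E →L[ℝ] E →L[ℝ] ℝ) (B : E → E → F) : F :=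
  ∑ i, B (Module.finBasis ℝ E i)
    (G.inverse (LinearMap.toContinuousLinearMap ((Module.finBasis ℝ E).coord i)))

/-- The Christoffel symbols
`Γ(v, w)^k = ½ g^{kl} (∂_i g_{jl} + ∂_j g_{il} - ∂_l g_{ij}) v^i w^j` of the Levi-Civita
connection. -/
def christoffel (G : E → E →L[ℝ] E →L[ℝ] ℝ) (y v w : E) : E :=
  (G y).inverse ((1 / 2 : ℝ) • (fderiv ℝ G y v w + fderiv ℝ G y w v -
    ((fderiv ℝ G y).flip v).flip w))

/-- The Hessian `∇df` of a function in coordinates. -/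
def coordHessian (G : E → E →L[ℝ] E →L[ℝ] ℝ) (f : E → ℝ) (y v w : E) : ℝ :=
  fderiv ℝ (fderiv ℝ f) y v w - fderiv ℝ f y (christoffel G y v w)

/-- The second fundamental form `∇du` of a map `u` in coordinates:
`∂_i ∂_j u^γ - Γ^k_{ij} ∂_k u^γ + Γ'^γ_{αβ}(u) ∂_i u^α ∂_j u^β`. -/
def coordSecondFundamentalForm [FiniteDimensional ℝ F] (G : E → E →L[ℝ] E →L[ℝ] ℝ)
    (G' : F → F →L[ℝ] F →L[ℝ] ℝ) (u : E → F) (y v w : E) : F :=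
  fderiv ℝ (fderiv ℝ u) y v w - fderiv ℝ u y (christoffel G y v w) +
    christoffel G' (u y) (fderiv ℝ u y v) (fderiv ℝ u y w)

/-- The curvature `R(u, v)w = ∇_u ∇_v w - ∇_v ∇_u w - ∇_{[u, v]} w` in coordinates. -/
def coordCurvature (G : E → E →L[ℝ] E →L[ℝ] ℝ) (y u v w : E) : E :=
  fderiv ℝ (fun z ↦ christoffel G z v w) y u - fderiv ℝ (fun z ↦ christoffel G z u w) y v +
    christoffel G y u (christoffel G y v w) - christoffel G y v (christoffel G y u w)

/-- The Riemannian volume density `√(det g)`, relative to the coordinates of `finBasis`. -/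
def volumeDensity (G : E →L[ℝ] E →L[ℝ] ℝ) : ℝ :=
  √(Matrix.det (Matrix.of fun i j ↦ G (Module.finBasis ℝ E i) (Module.finBasis ℝ E j)))

end Coordinates

section Manifold

variable {E : Type*} [NormedAddCommGroup E] [NormedSpace ℝ E] [FiniteDimensional ℝ E]
  {H : Type*} [TopologicalSpace H] {I : ModelWithCorners ℝ E H}
  {M : Type*} [TopologicalSpace M] [ChartedSpace H M] [IsManifold I ∞ M]
  {E' : Type*} [NormedAddCommGroup E'] [NormedSpace ℝ E'] [FiniteDimensional ℝ E']
  {H' : Type*} [TopologicalSpace H'] {I' : ModelWithCorners ℝ E' H'}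
  {M' : Type*} [TopologicalSpace M'] [ChartedSpace H' M'] [IsManifold I' ∞ M']

variable (I M) in
/-- A smooth Riemannian metric on the manifold `M`. -/
abbrev SmoothMetric : Type _ :=
  ContMDiffRiemannianMetric I ∞ E (fun x : M ↦ TangentSpace I x)

/-- The metric in the preferred chart at `x`, as a function on the coordinate space. -/
def metricInChart (g : SmoothMetric I M) (x : M) (y : E) : E →L[ℝ] E →L[ℝ] ℝ :=
  pullbackForm (g.inner ((extChartAt I x).symm y)) (mfderiv 𝓘(ℝ, E) I (extChartAt I x).symm y)

/-- The gradient: `g (grad f, ·) = df`. -/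
def grad (g : SmoothMetric I M) (f : M → ℝ) (x : M) : TangentSpace I x :=
  (g.inner x).inverse (mvfderiv I f x)

/-- The squared length `|v|²` of a tangent vector. -/
def normSq (g : SmoothMetric I M) {x : M} (v : TangentSpace I x) : ℝ := g.inner x v v

/-- The Laplace operator `Δ f = Trace_g ∇df = div grad f`. -/
def laplacian (g : SmoothMetric I M) (f : M → ℝ) (x : M) : ℝ :=
  metricTrace (metricInChart g x (extChartAt I x x))
    (coordHessian (metricInChart g x) (f ∘ (extChartAt I x).symm) (extChartAt I x x))

/-- The Ricci operator `Ric(v) = ∑ R(v, e_i) e_i`. The tangent space at `x` is identified with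
the model space by the preferred chart at `x`. -/
def ricci (g : SmoothMetric I M) {x : M} (v : TangentSpace I x) : TangentSpace I x :=
  metricTrace (F := E) (metricInChart g x (extChartAt I x x))
    (coordCurvature (metricInChart g x) (extChartAt I x x) v)

/-- The tension field `τ(φ) = Trace_g ∇dφ` of a map, a section of the pull-back bundle. It is
computed in the preferred charts at `p` and `φ p`, which are also the ones that identify the tangent
spaces with the model spaces. -/
def tension (g : SmoothMetric I M) (h : SmoothMetric I' M') (φ : M → M') (p : M) : TangentSpace I' (φ p) :=
  metricTrace (F := E') (metricInChart g p (extChartAt I p p))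
    (coordSecondFundamentalForm (metricInChart g p) (metricInChart h (φ p))
      (writtenInExtChartAt I I' p φ) (extChartAt I p p))

section Volume

variable [MeasurableSpace E] [BorelSpace E] [MeasurableSpace M]

/-- The measure `√(det g) dx` on the domain of the preferred chart at `x`, extended by zero. -/
def chartVolume (g : SmoothMetric I M) (x : M) : Measure M :=
  (((Module.finBasis ℝ E).addHaar.restrict (extChartAt I x).target).withDensity
    (fun y ↦ ENNReal.ofReal (volumeDensity (metricInChart g x y)))).map (extChartAt I x).symm

/-- The Riemannian volume measure `dv_g`. The measures `chartVolume g x` agree on the intersections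
of chart domains, so their supremum is the unique measure that restricts to `√(det g) dx` on each
chart domain. -/
def riemannianVolume (g : SmoothMetric I M) : Measure M := ⨆ x : M, chartVolume g x

/-- The bienergy `E₂(φ, Ω) = ½ ∫_Ω |τ(φ)|² dv_g`. -/
def bienergy (g : SmoothMetric I M) (h : SmoothMetric I' M') (φ : M → M') (Ω : Set M) : ℝ :=
  1 / 2 * ∫ p in Ω, normSq h (tension g h φ p) ∂(riemannianVolume g)

variable (I I') in
/-- `Φ` is a smooth variation, with parameter in `(-ε, ε)`, of the map `φ`, supported in `Ω`. -/
structure IsVariation (φ : M → M') (Ω : Set M) (ε : ℝ) (Φ : ℝ → M → M') : Prop where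
  contMDiffOn : ContMDiffOn (𝓘(ℝ, ℝ).prod I) I' ∞ (fun q : ℝ × M ↦ Φ q.1 q.2)
    (Ioo (-ε) ε ×ˢ univ)
  zero : Φ 0 = φ
  eq_of_notMem : ∀ t ∈ Ioo (-ε) ε, ∀ p ∉ Ω, Φ t p = φ p

/-- A smooth map is biharmonic if, for every compact `Ω`, it is a critical point of the bienergy
`E₂(·, Ω)` with respect to all smooth variations supported in `Ω`. -/
def IsBiharmonic (g : SmoothMetric I M) (h : SmoothMetric I' M') (φ : M → M') : Prop :=
  ContMDiff I I' ∞ φ ∧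
    ∀ Ω : Set M, IsCompact Ω → ∀ ε : ℝ, 0 < ε → ∀ Φ : ℝ → M → M', IsVariation I I' φ Ω ε Φ →
      HasDerivAt (fun t ↦ bienergy g h (Φ t) Ω) 0 0

end Volume

end Manifold

section WarpedProduct

variable {E : Type*} [NormedAddCommGroup E] [NormedSpace ℝ E]
  {H : Type*} [TopologicalSpace H] {I : ModelWithCorners ℝ E H}
  {M : Type*} [TopologicalSpace M] [ChartedSpace H M] [IsManifold I ∞ M]
  {F : Type*} [NormedAddCommGroup F] [NormedSpace ℝ F]
  {K : Type*} [TopologicalSpace K] {J : ModelWithCorners ℝ F K}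
  {N : Type*} [TopologicalSpace N] [ChartedSpace K N] [IsManifold J ∞ N]

theorem comp_add_smul_comp {V W V' W' : Type*} [AddCommGroup V] [Module ℝ V] [TopologicalSpace V]
    [AddCommGroup W] [Module ℝ W] [TopologicalSpace W] [AddCommGroup V'] [Module ℝ V']
    [TopologicalSpace V'] [IsTopologicalAddGroup V'] [ContinuousSMul ℝ V']
    [AddCommGroup W'] [Module ℝ W'] [TopologicalSpace W'] [IsTopologicalAddGroup W']
    [ContinuousSMul ℝ W'] (P : V' →L[ℝ] W') (Q : W →L[ℝ] V) (A B : V →L[ℝ] V') (c : ℝ) :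
    P ∘L ((A + c • B) ∘L Q) = P ∘L (A ∘L Q) + c • (P ∘L (B ∘L Q)) := by
  ext
  simp

theorem bilin_smul_smul {V : Type*} [AddCommGroup V] [Module ℝ V] [TopologicalSpace V]
    (B : V →L[ℝ] V →L[ℝ] ℝ) (c : ℝ) (v : V) : B (c • v) (c • v) = c * (c * B v v) := by
  simp

theorem inCoordinates_pullbackForm {f : M → N} {x₀ x : M}
    (hx : x ∈ (chartAt H x₀).source) (hfx : f x ∈ (chartAt K (f x₀)).source)
    (B : TangentSpace J (f x) →L[ℝ] TangentSpace J (f x) →L[ℝ] ℝ)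
    (A : TangentSpace I x →L[ℝ] TangentSpace J (f x)) :
    ContinuousLinearMap.inCoordinates E (TangentSpace I) (E →L[ℝ] ℝ)
        (fun x : M ↦ TangentSpace I x →L[ℝ] ℝ) x₀ x x₀ x (pullbackForm B A) =
      pullbackForm (ContinuousLinearMap.inCoordinates F (TangentSpace J) (F →L[ℝ] ℝ)
        (fun y : N ↦ TangentSpace J y →L[ℝ] ℝ) (f x₀) (f x) (f x₀) (f x) B)
        (ContinuousLinearMap.inCoordinates E (TangentSpace I) F (TangentSpace J) x₀ x (f x₀) (f x)
          A) := by
  have h1 : x ∈ (trivializationAt E (TangentSpace I) x₀).baseSet := by simpa using hx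
  have h2 : f x ∈ (trivializationAt F (TangentSpace J) (f x₀)).baseSet := by simpa using hfx
  ext v w
  simp only [pullbackForm, ContinuousLinearMap.comp_apply, ContinuousLinearMap.precomp_apply]
  rw [inCoordinates_apply_eq₂ h1 h1 (by simp), inCoordinates_apply_eq₂ h2 h2 (by simp)]
  simp [ContinuousLinearMap.inCoordinates_eq h1 h2]
  rw [Trivialization.symm_apply_apply_mk _ h2, Trivialization.symm_apply_apply_mk _ h2]

/-- Smoothness of the pull-back of a smooth field of bilinear forms along a smooth map, in the
coordinates around a point. -/
theorem contMDiffAt_pullbackForm {f : M → N} (hf : ContMDiff I J ∞ f)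
    (B : ∀ y : N, TangentSpace J y →L[ℝ] TangentSpace J y →L[ℝ] ℝ)
    (hB : ContMDiff J (J.prod 𝓘(ℝ, F →L[ℝ] F →L[ℝ] ℝ)) ∞
      (fun y ↦ TotalSpace.mk' (F →L[ℝ] F →L[ℝ] ℝ)
        (E := fun y : N ↦ TangentSpace J y →L[ℝ] TangentSpace J y →L[ℝ] ℝ) y (B y))) (x₀ : M) :
    ContMDiffAt I 𝓘(ℝ, E →L[ℝ] E →L[ℝ] ℝ) ∞
      (fun x ↦ ContinuousLinearMap.inCoordinates E (TangentSpace I) (E →L[ℝ] ℝ)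
        (fun x : M ↦ TangentSpace I x →L[ℝ] ℝ) x₀ x x₀ x
        (pullbackForm (B (f x)) (mfderiv I J f x))) x₀ := by
  have h1 := ((contMDiffAt_hom_bundle _).1 (hB (f x₀))).2.comp x₀ (hf x₀)
  have h2 := (hf x₀).mfderiv_const (m := ∞) (by simp)
  have h3 := h2.clm_precomp (F₃ := ℝ) |>.clm_comp (h1.clm_comp h2)
  refine h3.congr_of_eventuallyEq ?_
  filter_upwards [(chartAt H x₀).open_source.mem_nhds (mem_chart_source H x₀),
    hf.continuous.continuousAt.preimage_mem_nhds
      ((chartAt K (f x₀)).open_source.mem_nhds (mem_chart_source K (f x₀)))] with x hx hfx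
  exact inCoordinates_pullbackForm hx hfx (B (f x)) (mfderiv I J f x)

/-- The warped product metric `g_M + e^{2λ} g_N` on `M × N`, that is
`π_M^* g_M + (e^{2λ} ∘ π_M) π_N^* g_N`. -/
def warpedProduct (gM : SmoothMetric I M) (gN : SmoothMetric J N) (lam : M → ℝ)
    (hlam : ContMDiff I 𝓘(ℝ, ℝ) ∞ lam) : SmoothMetric (I.prod J) (M × N) where
  inner p :=
    pullbackForm (gM.inner p.1) (mfderiv (I.prod J) I Prod.fst p) +
      Real.exp (2 * lam p.1) • pullbackForm (gN.inner p.2) (mfderiv (I.prod J) J Prod.snd p)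
  symm p v w := by
    exact congr_arg₂ (fun a b : ℝ ↦ a + Real.exp (2 * lam p.1) * b)
      (gM.symm p.1 _ _) (gN.symm p.2 _ _)
  pos p v hv := by
    have h1 : ∀ u, 0 ≤ gM.inner p.1 u u := fun u ↦ by
      by_cases h : u = 0
      · simp [h]
      · exact (gM.pos p.1 u h).le
    have h2 : ∀ u, 0 ≤ gN.inner p.2 u u := fun u ↦ by
      by_cases h : u = 0
      · simp [h]
      · exact (gN.pos p.2 u h).le
    change 0 < gM.inner p.1 (mfderiv (I.prod J) I Prod.fst p v)
        (mfderiv (I.prod J) I Prod.fst p v) + Real.exp (2 * lam p.1) *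
      gN.inner p.2 (mfderiv (I.prod J) J Prod.snd p v) (mfderiv (I.prod J) J Prod.snd p v)
    have he := Real.exp_pos (2 * lam p.1)
    by_cases h : mfderiv (I.prod J) I Prod.fst p v = 0
    · have h' : mfderiv (I.prod J) J Prod.snd p v ≠ 0 := by
        intro h'
        rw [mfderiv_fst] at h
        rw [mfderiv_snd] at h'
        exact hv (Prod.ext h h')
      exact add_pos_of_nonneg_of_pos (h1 _) (mul_pos he (gN.pos p.2 _ h'))
    · exact add_pos_of_pos_of_nonneg (gM.pos p.1 _ h) (mul_nonneg he.le (h2 _))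
  isVonNBounded p := by
    have h1 : ∀ u, 0 ≤ gM.inner p.1 u u := fun u ↦ by
      by_cases h : u = 0
      · simp [h]
      · exact (gM.pos p.1 u h).le
    have h2 : ∀ u, 0 ≤ gN.inner p.2 u u := fun u ↦ by
      by_cases h : u = 0
      · simp [h]
      · exact (gN.pos p.2 u h).le
    have he := Real.exp_pos (2 * lam p.1)
    obtain ⟨r, hr⟩ := ((NormedSpace.isVonNBounded_iff ℝ (E := E)).1
      (gM.isVonNBounded p.1)).subset_closedBall 0
    obtain ⟨s, hs⟩ := ((NormedSpace.isVonNBounded_iff ℝ (E := F)).1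
      (gN.isVonNBounded p.2)).subset_closedBall 0
    refine (NormedSpace.isVonNBounded_iff ℝ (E := E × F)).2
      (((Metric.isBounded_closedBall (x := (0 : E)) (r := r)).prod
        (Metric.isBounded_closedBall (x := (0 : F)) (r := Real.exp (-lam p.1) * s))).subset ?_)
    intro v hv
    replace hv : gM.inner p.1 (mfderiv (I.prod J) I Prod.fst p v)
        (mfderiv (I.prod J) I Prod.fst p v) + Real.exp (2 * lam p.1) *
      gN.inner p.2 (mfderiv (I.prod J) J Prod.snd p v) (mfderiv (I.prod J) J Prod.snd p v) < 1 := hv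
    rw [mfderiv_fst, mfderiv_snd] at hv
    refine ⟨hr (?_ : gM.inner p.1 v.1 v.1 < 1), ?_⟩
    · exact lt_of_le_of_lt (le_add_of_nonneg_right (mul_nonneg he.le (h2 v.2))) hv
    · have h3 : Real.exp (lam p.1) • v.2 ∈ Metric.closedBall (0 : F) s := by
        refine hs ?_
        have h4 : gN.inner p.2 (Real.exp (lam p.1) • v.2) (Real.exp (lam p.1) • v.2) =
            Real.exp (2 * lam p.1) * gN.inner p.2 v.2 v.2 := by
          rw [two_mul, Real.exp_add, mul_assoc]
          exact bilin_smul_smul (gN.inner p.2) _ v.2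
        exact h4.trans_lt (lt_of_le_of_lt (le_add_of_nonneg_left (h1 v.1)) hv)
      rw [mem_closedBall_zero_iff] at h3 ⊢
      rw [norm_smul, Real.norm_eq_abs, Real.abs_exp] at h3
      rw [Real.exp_neg, ← div_eq_inv_mul, le_div_iff₀' (Real.exp_pos _)]
      exact h3
  contMDiff := by
    intro p
    rw [contMDiffAt_hom_bundle]
    refine ⟨contMDiffAt_id, ?_⟩
    have h1 := contMDiffAt_pullbackForm (I := I.prod J) (contMDiff_fst (M := M) (N := N)) _
      gM.contMDiff p
    have h2 := contMDiffAt_pullbackForm (I := I.prod J) (contMDiff_snd (M := M) (N := N)) _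
      gN.contMDiff p
    have h3 : ContMDiff (I.prod J) 𝓘(ℝ, ℝ) ∞ (fun q : M × N ↦ Real.exp (2 * lam q.1)) := by
      have h4 : ContDiff ℝ ∞ (fun t : ℝ ↦ Real.exp (2 * t)) := by fun_prop
      exact h4.contMDiff.comp (hlam.comp contMDiff_fst)
    refine (h1.add ((h3 p).smul h2)).congr_of_eventuallyEq (Filter.Eventually.of_forall ?_)
    intro q
    exact comp_add_smul_comp _ _ _ _ _

end WarpedProduct

end RiemannianGeometry

end

noncomputable section

set_option maxSynthPendingDepth 3
set_option linter.unusedSectionVars false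

namespace RiemannianGeometry

/-! ### Smooth functions on open sets -/

section Calculus

variable {E : Type*} [NormedAddCommGroup E] [NormedSpace ℝ E]
  {F : Type*} [NormedAddCommGroup F] [NormedSpace ℝ F] {f : E → F} {U : Set E} {y : E}

/-! Write `n = dim N`, let `u_t` be a variation of `φ` with variation field `V`, and let `Δ̃` and
`tr̃` belong to the warped metric. The horizontal part of its Christoffel symbols is `Γ^M - e^{2λ}
g_N ⊗ grad λ`, and tracing gives `τ(φ) = n (grad λ) ∘ φ` (`coordTension_fst`). So `τ(φ)` is the
restriction of a vector field `ξ = n grad λ` on the target, and the first variation can be found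
without covariant derivatives along maps. Completing the square, `½|τ(u_t)|² = ½|τ(u_t) - ξ∘u_t|² +
n dλ(τ(u_t)) - (n²/2)|grad λ|²∘u_t`. The first term has zero derivative at `t = 0`, as the vector
being squared vanishes there. The composition law turns the second into `dλ(τ(u)) = Δ̃(λ∘u) - tr̃
∇dλ(du, du)`, whose derivative is elementary. The outcome is `hasDerivAt_normSq_coordTension`.

By `sum_fderiv_bienergyFlux` the resulting density is a divergence plus `n` times the pairing of `V`
with the bitension `dΔλ + 2 Ric(grad λ) + (n/2) d|grad λ|²`. The inputs are the Bochner identity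
`div ∇dλ = dΔλ + Ric(grad λ)` and the term `-n grad λ` in the trace of the Christoffel symbols of
the warped product. The divergence integrates to zero when `V` has compact support in a chart, so
the first variation is `n ∫ bitension(V) dv`.

The operators on manifolds are defined pointwise, each in the chart preferred at its own point.
Transition maps are isometries of the coordinate metrics (`isIsometryOn_transition`), and the
Christoffel transformation law makes tension, Laplacian, curvature and bitension invariant under
these, so one fixed chart may be used throughout. The volume measure restricts to the coordinate
density on each chart domain (`riemannianVolume_restrict`).

If the bitension vanishes, a partition of unity splits any variation field into fields supported in
charts, and each contributes zero. Conversely, if the bitension is nonzero at `x`, a bump variation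
in a chart around some `(x, y)`, in a direction of positive bitension, has positive first variation;
this uses `n ≥ 1` and a point `y` of `N`. -/

theorem smoothOn_fderiv (hf : ContDiffOn ℝ ∞ f U) (hU : IsOpen U) :
    ContDiffOn ℝ ∞ (fderiv ℝ f) U :=
  hf.fderiv_of_isOpen hU (by simp)

theorem smoothOn_differentiableAt (hf : ContDiffOn ℝ ∞ f U) (hU : IsOpen U) (hy : y ∈ U) :
    DifferentiableAt ℝ f y :=
  (hf.contDiffAt (hU.mem_nhds hy)).differentiableAt (by simp)

theorem smoothOn_fderiv_fderiv_symm (hf : ContDiffOn ℝ ∞ f U) (hU : IsOpen U) (hy : y ∈ U)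
    (v w : E) : fderiv ℝ (fderiv ℝ f) y v w = fderiv ℝ (fderiv ℝ f) y w v :=
  ((hf.contDiffAt (hU.mem_nhds hy)).isSymmSndFDerivAt
    (by simpa using WithTop.coe_le_coe.2 (le_top : (2 : ℕ∞) ≤ ⊤))).eq v w

theorem fderiv_apply_const {A : E → E →L[ℝ] F} (hA : DifferentiableAt ℝ A y) (a v : E) :
    fderiv ℝ (fun z ↦ A z v) y a = fderiv ℝ A y a v := by
  rw [fderiv_clm_apply hA (differentiableAt_const v)]
  simp

end Calculus

/-! ### Metrics on coordinate spaces and traces -/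

section MetricAlgebra

variable {E : Type*} [NormedAddCommGroup E] [NormedSpace ℝ E] [FiniteDimensional ℝ E]
  {F : Type*} [NormedAddCommGroup F] [NormedSpace ℝ F]
  {F' : Type*} [NormedAddCommGroup F'] [NormedSpace ℝ F']

/-- A symmetric positive definite bilinear form. -/
structure IsMetricForm (G : E →L[ℝ] E →L[ℝ] ℝ) : Prop where
  symm : ∀ v w, G v w = G w v
  pos : ∀ v, v ≠ 0 → 0 < G v v

variable {G : E →L[ℝ] E →L[ℝ] ℝ}

theorem IsMetricForm.ext (hG : IsMetricForm G) {v w : E} (h : ∀ z, G v z = G w z) : v = w := by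
  by_contra hne
  have h1 := hG.pos (v - w) (sub_ne_zero.2 hne)
  rw [map_sub G v w] at h1
  simp [h] at h1

/-- Definiteness makes `G` injective into a dual space of the same dimension. Since
`ContinuousLinearMap.inverse` is zero on non-invertible maps, this is what makes every raising of
indices below meaningful. -/
theorem IsMetricForm.isInvertible (hG : IsMetricForm G) : G.IsInvertible := by
  have hinj : Function.Injective G.toLinearMap := fun v w h ↦
    hG.ext fun z ↦ DFunLike.congr_fun (h : G v = G w) z
  have hdim : Module.finrank ℝ E = Module.finrank ℝ (E →L[ℝ] ℝ) := by
    rw [← (LinearMap.toContinuousLinearMap (𝕜 := ℝ) (E := E) (F' := ℝ)).finrank_eq]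
    exact (Subspace.dual_finrank_eq (K := ℝ) (V := E)).symm
  refine ⟨(LinearEquiv.ofInjectiveOfFinrankEq G.toLinearMap hinj hdim).toContinuousLinearEquiv, ?_⟩
  ext v w
  rfl

theorem IsMetricForm.apply_inverse (hG : IsMetricForm G) (l : E →L[ℝ] ℝ) : G (G.inverse l) = l :=
  hG.isInvertible.self_apply_inverse l

/-- The vectors `g^{ij} e_j` dual to the coordinate basis `e_i` with respect to `G`. -/
def dualVec (G : E →L[ℝ] E →L[ℝ] ℝ) (i : Fin (Module.finrank ℝ E)) : E :=
  G.inverse (LinearMap.toContinuousLinearMap ((Module.finBasis ℝ E).coord i))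

theorem metricTrace_eq_sum (G : E →L[ℝ] E →L[ℝ] ℝ) (B : E → E → F) :
    metricTrace G B = ∑ i, B (Module.finBasis ℝ E i) (dualVec G i) := rfl

theorem IsMetricForm.apply_dualVec (hG : IsMetricForm G) (i) (w : E) :
    G (dualVec G i) w = (Module.finBasis ℝ E).coord i w := by
  rw [dualVec, hG.apply_inverse]
  rfl

theorem IsMetricForm.sum_dualVec_smul (hG : IsMetricForm G) (w : E) :
    ∑ i, G (dualVec G i) w • Module.finBasis ℝ E i = w := by
  simp_rw [hG.apply_dualVec]
  exact (Module.finBasis ℝ E).sum_repr w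

theorem IsMetricForm.sum_smul_dualVec (hG : IsMetricForm G) (w : E) :
    ∑ i, G (Module.finBasis ℝ E i) w • dualVec G i = w := by
  refine hG.ext fun z ↦ ?_
  conv_rhs => rw [← hG.sum_dualVec_smul z]
  simp only [map_sum, map_smul, sum_apply, smul_apply]
  refine Finset.sum_congr rfl fun i _ ↦ ?_
  rw [hG.symm w, smul_eq_mul, smul_eq_mul, mul_comm]

/-- The trace can be computed in any pair of dual families. -/
theorem IsMetricForm.metricTrace_eq_of_dual (hG : IsMetricForm G) (B : E →L[ℝ] E →L[ℝ] F)
    {κ : Type*} [Fintype κ] (c c' : κ → E) (h : ∀ w, ∑ k, G (c' k) w • c k = w) :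
    metricTrace G (fun v w ↦ B v w) = ∑ k, B (c k) (c' k) := by
  rw [metricTrace_eq_sum]
  -- Expand the coordinate basis in the family `c`; after exchanging the sums, the expansion of `c'
  -- k` in the dual vectors absorbs the sum over `i`.
  have h1 : ∀ i, B (Module.finBasis ℝ E i) (dualVec G i) =
      ∑ k, G (Module.finBasis ℝ E i) (c' k) • B (c k) (dualVec G i) := fun i ↦ by
    conv_lhs => rw [← h (Module.finBasis ℝ E i)]
    simp [map_sum, hG.symm (c' _)]
  simp_rw [h1]
  rw [Finset.sum_comm]
  refine Finset.sum_congr rfl fun k _ ↦ ?_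
  conv_rhs => rw [← hG.sum_smul_dualVec (c' k)]
  simp [map_sum]

/-- Duality of two families is a symmetric relation, so the basis and its dual vectors may exchange
roles. No symmetry of `B` is needed. -/
theorem IsMetricForm.metricTrace_flip (hG : IsMetricForm G) (B : E →L[ℝ] E →L[ℝ] F) :
    metricTrace G (fun v w ↦ B w v) = metricTrace G (fun v w ↦ B v w) :=
  (hG.metricTrace_eq_of_dual B _ _ hG.sum_smul_dualVec).symm

theorem map_metricTrace (L : F →L[ℝ] F') (G : E →L[ℝ] E →L[ℝ] ℝ) (B : E → E → F) :
    L (metricTrace G B) = metricTrace G (fun v w ↦ L (B v w)) := by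
  simp [metricTrace]

theorem metricTrace_add (G : E →L[ℝ] E →L[ℝ] ℝ) (B B' : E → E → F) :
    metricTrace G (fun v w ↦ B v w + B' v w) = metricTrace G B + metricTrace G B' := by
  simp [metricTrace, Finset.sum_add_distrib]

theorem metricTrace_sub (G : E →L[ℝ] E →L[ℝ] ℝ) (B B' : E → E → F) :
    metricTrace G (fun v w ↦ B v w - B' v w) = metricTrace G B - metricTrace G B' := by
  simp [metricTrace, Finset.sum_sub_distrib]

theorem IsMetricForm.metricTrace_self (hG : IsMetricForm G) :
    metricTrace G (fun v w ↦ G v w) = Module.finrank ℝ E := by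
  rw [← hG.metricTrace_flip, metricTrace_eq_sum]
  simp [hG.apply_dualVec]

variable {E₂ : Type*} [NormedAddCommGroup E₂] [NormedSpace ℝ E₂] [FiniteDimensional ℝ E₂]

theorem pullbackForm_apply (B : E →L[ℝ] E →L[ℝ] ℝ) (A : F →L[ℝ] E) (v w : F) :
    pullbackForm B A v w = B (A v) (A w) := rfl

theorem IsMetricForm.pullback (hG : IsMetricForm G) {X : E₂ →L[ℝ] E}
    (hX : Function.Injective X) : IsMetricForm (pullbackForm G X) where
  symm _ _ := hG.symm _ _
  pos _ hv := hG.pos _ fun h ↦ hv (hX (h.trans (map_zero X).symm))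

/-- Invariance of the trace under linear isometries. -/
theorem IsMetricForm.metricTrace_pullback (hG : IsMetricForm G) {X : E₂ →L[ℝ] E}
    (hX : Function.Bijective X) (B : E →L[ℝ] E →L[ℝ] F) :
    metricTrace (pullbackForm G X) (fun v w ↦ B (X v) (X w)) = metricTrace G (fun v w ↦ B v w) := by
  rw [metricTrace_eq_sum]
  refine (hG.metricTrace_eq_of_dual B _ _ fun w ↦ ?_).symm
  obtain ⟨v, rfl⟩ := hX.2 w
  conv_rhs => rw [← (hG.pullback hX.1).sum_dualVec_smul v]
  simp [map_sum, pullbackForm_apply]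

/-- The inner product `a H + c K` on a product space. -/
theorem isMetricForm_prod {H : E →L[ℝ] E →L[ℝ] ℝ} (hH : IsMetricForm H)
    {K : E₂ →L[ℝ] E₂ →L[ℝ] ℝ} (hK : IsMetricForm K) {c : ℝ} (hc : 0 < c) :
    IsMetricForm (pullbackForm H (ContinuousLinearMap.fst ℝ E E₂) +
      c • pullbackForm K (ContinuousLinearMap.snd ℝ E E₂)) where
  symm v w := by
    simp [pullbackForm_apply, hH.symm v.1, hK.symm v.2]
  pos v hv := by
    have h1 : 0 ≤ H v.1 v.1 := by
      by_cases h : v.1 = 0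
      · simp [h]
      · exact (hH.pos _ h).le
    have h2 : 0 ≤ K v.2 v.2 := by
      by_cases h : v.2 = 0
      · simp [h]
      · exact (hK.pos _ h).le
    change 0 < H v.1 v.1 + c * K v.2 v.2
    by_cases h : v.1 = 0
    · have h' : v.2 ≠ 0 := fun h' ↦ hv (Prod.ext h h')
      exact add_pos_of_nonneg_of_pos h1 (mul_pos hc (hK.pos _ h'))
    · exact add_pos_of_pos_of_nonneg (hH.pos _ h) (mul_nonneg hc.le h2)

/-- The union of the two coordinate bases is dual to the union of their dual families, the second
one rescaled by `c⁻¹`. -/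
theorem metricTrace_prod {H : E →L[ℝ] E →L[ℝ] ℝ} (hH : IsMetricForm H)
    {K : E₂ →L[ℝ] E₂ →L[ℝ] ℝ} (hK : IsMetricForm K) {c : ℝ} (hc : 0 < c)
    (B : E × E₂ →L[ℝ] E × E₂ →L[ℝ] F) :
    metricTrace (pullbackForm H (ContinuousLinearMap.fst ℝ E E₂) +
      c • pullbackForm K (ContinuousLinearMap.snd ℝ E E₂)) (fun v w ↦ B v w) =
    metricTrace H (fun v w ↦ B (v, 0) (w, 0)) +
      c⁻¹ • metricTrace K (fun v w ↦ B (0, v) (0, w)) := by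
  rw [(isMetricForm_prod hH hK hc).metricTrace_eq_of_dual B
    (Sum.elim (fun i ↦ (Module.finBasis ℝ E i, 0)) (fun j ↦ (0, Module.finBasis ℝ E₂ j)))
    (Sum.elim (fun i ↦ (dualVec H i, 0)) (fun j ↦ (0, c⁻¹ • dualVec K j))) ?_]
  · rw [Fintype.sum_sum_type, metricTrace_eq_sum, metricTrace_eq_sum, Finset.smul_sum]
    congr 1
    refine Finset.sum_congr rfl fun j _ ↦ ?_
    have : ((0 : E), c⁻¹ • dualVec K j) = c⁻¹ • ((0 : E), dualVec K j) := by simp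
    simp only [Sum.elim_inr]
    rw [this, map_smul]
  · rintro ⟨a, b⟩
    rw [Fintype.sum_sum_type]
    conv_rhs => rw [← hH.sum_dualVec_smul a, ← hK.sum_dualVec_smul b]
    have hc' : c * c⁻¹ = 1 := mul_inv_cancel₀ hc.ne'
    ext
    · simp [pullbackForm_apply, Prod.fst_sum]
    · simp [pullbackForm_apply, Prod.snd_sum, ← mul_assoc, hc']

end MetricAlgebra

/-! ### The Levi-Civita connection in coordinates -/

section Connection

variable {E : Type*} [NormedAddCommGroup E] [NormedSpace ℝ E] [FiniteDimensional ℝ E]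
  {F : Type*} [NormedAddCommGroup F] [NormedSpace ℝ F] [FiniteDimensional ℝ F]
  {F' : Type*} [NormedAddCommGroup F'] [NormedSpace ℝ F'] [FiniteDimensional ℝ F']

/-- `G` is a smooth Riemannian metric on the open subset `U` of a coordinate space. -/
structure IsMetricOn (G : E → E →L[ℝ] E →L[ℝ] ℝ) (U : Set E) : Prop where
  isOpen : IsOpen U
  smooth : ContDiffOn ℝ ∞ G U
  form : ∀ y ∈ U, IsMetricForm (G y)

variable {G : E → E →L[ℝ] E →L[ℝ] ℝ} {U : Set E} {y : E}

theorem IsMetricOn.differentiableAt (hG : IsMetricOn G U) (hy : y ∈ U) : DifferentiableAt ℝ G y :=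
  smoothOn_differentiableAt hG.smooth hG.isOpen hy

theorem IsMetricOn.smooth_inverse (hG : IsMetricOn G U) :
    ContDiffOn ℝ ∞ (fun y ↦ (G y).inverse) U := fun y hy ↦
  ((hG.form y hy).isInvertible.contDiffAt_map_inverse.comp_contDiffWithinAt y (hG.smooth y hy))

theorem IsMetricOn.smooth_dualVec (hG : IsMetricOn G U) (i) :
    ContDiffOn ℝ ∞ (fun y ↦ dualVec (G y) i) U :=
  hG.smooth_inverse.clm_apply contDiffOn_const

theorem fderiv_bilin_apply (hG : DifferentiableAt ℝ G y) (a v w : E) :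
    fderiv ℝ (fun z ↦ G z v w) y a = fderiv ℝ G y a v w := by
  rw [fderiv_apply_const (A := fun z ↦ G z v) (hG.clm_apply (differentiableAt_const v)),
    fderiv_apply_const hG]

theorem IsMetricOn.fderiv_symm (hG : IsMetricOn G U) (hy : y ∈ U) (a v w : E) :
    fderiv ℝ G y a v w = fderiv ℝ G y a w v := by
  rw [← fderiv_bilin_apply (hG.differentiableAt hy), ← fderiv_bilin_apply (hG.differentiableAt hy)]
  congr 1
  refine Filter.EventuallyEq.fderiv_eq ?_
  filter_upwards [hG.isOpen.mem_nhds hy] with z hz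
  exact (hG.form z hz).symm v w

/-- The Christoffel symbols as a continuous bilinear map. -/
def christoffelMap (G : E → E →L[ℝ] E →L[ℝ] ℝ) (y : E) : E →L[ℝ] E →L[ℝ] E :=
  (ContinuousLinearMap.compL ℝ E (E →L[ℝ] ℝ) E (G y).inverse) ∘L
    ((1 / 2 : ℝ) • (fderiv ℝ G y + (fderiv ℝ G y).flip -
      (ContinuousLinearMap.flipₗᵢ ℝ E E ℝ).toContinuousLinearEquiv.toContinuousLinearMap ∘L
        (fderiv ℝ G y).flip))

theorem christoffelMap_apply (G : E → E →L[ℝ] E →L[ℝ] ℝ) (y v w : E) :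
    christoffelMap G y v w = christoffel G y v w := rfl

theorem IsMetricOn.smooth_christoffelMap (hG : IsMetricOn G U) :
    ContDiffOn ℝ ∞ (christoffelMap G) U := by
  have h1 := smoothOn_fderiv hG.smooth hG.isOpen
  have h2 : ContDiffOn ℝ ∞ (fun y ↦ (fderiv ℝ G y).flip) U :=
    (ContinuousLinearMap.flipₗᵢ ℝ E E (E →L[ℝ] ℝ)).toContinuousLinearEquiv.contDiff.comp_contDiffOn
      h1
  refine ContDiffOn.clm_comp ?_ ?_
  · exact (ContinuousLinearMap.compL ℝ E (E →L[ℝ] ℝ) E).contDiff.comp_contDiffOn hG.smooth_inverse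
  · exact ((h1.add h2).sub (contDiffOn_const.clm_comp h2)).const_smul (1 / 2 : ℝ)

theorem IsMetricOn.smooth_christoffel (hG : IsMetricOn G U) (v w : E) :
    ContDiffOn ℝ ∞ (fun y ↦ christoffel G y v w) U :=
  (hG.smooth_christoffelMap.clm_apply contDiffOn_const).clm_apply contDiffOn_const

theorem IsMetricOn.apply_christoffel (hG : IsMetricOn G U) (hy : y ∈ U) (v w z : E) :
    G y (christoffel G y v w) z =
      1 / 2 * (fderiv ℝ G y v w z + fderiv ℝ G y w v z - fderiv ℝ G y z v w) := by
  rw [christoffel, (hG.form y hy).apply_inverse]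
  rfl

theorem IsMetricOn.christoffel_symm (hG : IsMetricOn G U) (hy : y ∈ U) (v w : E) :
    christoffel G y v w = christoffel G y w v := by
  refine (hG.form y hy).ext fun z ↦ ?_
  rw [hG.apply_christoffel hy, hG.apply_christoffel hy, hG.fderiv_symm hy z v w]
  ring

/-- The Levi-Civita connection is compatible with the metric. -/
theorem IsMetricOn.fderiv_eq (hG : IsMetricOn G U) (hy : y ∈ U) (a v w : E) :
    fderiv ℝ G y a v w = G y (christoffel G y a v) w + G y v (christoffel G y a w) := by
  rw [(hG.form y hy).symm v, hG.apply_christoffel hy, hG.apply_christoffel hy,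
    hG.fderiv_symm hy v a w, hG.fderiv_symm hy w a v, hG.fderiv_symm hy a w v]
  ring

theorem fderiv_fderiv_comp {f : F → F'} {u : E → F} (hf : ContDiffAt ℝ 2 f (u y))
    (hu : ContDiffAt ℝ 2 u y) (v w : E) :
    fderiv ℝ (fderiv ℝ (f ∘ u)) y v w =
      fderiv ℝ (fderiv ℝ f) (u y) (fderiv ℝ u y v) (fderiv ℝ u y w) +
        fderiv ℝ f (u y) (fderiv ℝ (fderiv ℝ u) y v w) := by
  have h1 : fderiv ℝ (f ∘ u) =ᶠ[𝓝 y] fun z ↦ (fderiv ℝ f (u z)) ∘L (fderiv ℝ u z) := by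
    filter_upwards [hu.eventually (by simp), hu.continuousAt.eventually (hf.eventually (by simp))]
      with z hz hz'
    exact fderiv_comp z (hz'.differentiableAt (by simp)) (hz.differentiableAt (by simp))
  have h2 : DifferentiableAt ℝ (fderiv ℝ f) (u y) :=
    (hf.fderiv_right (m := 1) (by norm_num)).differentiableAt (by simp)
  have h3 : DifferentiableAt ℝ (fderiv ℝ u) y :=
    (hu.fderiv_right (m := 1) (by norm_num)).differentiableAt (by simp)
  have h4 := hu.differentiableAt (by simp)
  have h6 : DifferentiableAt ℝ (fun z ↦ fderiv ℝ f (u z)) y := h2.comp y h4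
  rw [h1.fderiv_eq, fderiv_clm_comp h6 h3]
  have h5 : fderiv ℝ (fun z ↦ fderiv ℝ f (u z)) y = (fderiv ℝ (fderiv ℝ f) (u y)) ∘L fderiv ℝ u y :=
    fderiv_comp y h2 h4
  simp [h5, add_comm]

/-- The composition law for second fundamental forms. -/
theorem coordSecondFundamentalForm_comp (G : E → E →L[ℝ] E →L[ℝ] ℝ)
    (G' : F → F →L[ℝ] F →L[ℝ] ℝ) (G'' : F' → F' →L[ℝ] F' →L[ℝ] ℝ) {f : F → F'} {u : E → F}
    (hf : ContDiffAt ℝ 2 f (u y)) (hu : ContDiffAt ℝ 2 u y) (v w : E) :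
    coordSecondFundamentalForm G G'' (f ∘ u) y v w =
      fderiv ℝ f (u y) (coordSecondFundamentalForm G G' u y v w) +
        coordSecondFundamentalForm G' G'' f (u y) (fderiv ℝ u y v) (fderiv ℝ u y w) := by
  have h1 : fderiv ℝ (f ∘ u) y = fderiv ℝ f (u y) ∘L fderiv ℝ u y :=
    fderiv_comp y (hf.differentiableAt (by simp)) (hu.differentiableAt (by simp))
  simp only [coordSecondFundamentalForm, fderiv_fderiv_comp hf hu, h1, map_add, map_sub,
    ContinuousLinearMap.comp_apply, Function.comp_apply]
  abel

/-- A constant target metric has zero Christoffel symbols. The form `G₀` need not even be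
nondegenerate, and is taken to be `0` in applications. -/
theorem coordHessian_eq_secondFundamentalForm (G : E → E →L[ℝ] E →L[ℝ] ℝ) (f : E → ℝ) (y v w : E)
    (G₀ : ℝ →L[ℝ] ℝ →L[ℝ] ℝ) :
    coordHessian G f y v w = coordSecondFundamentalForm G (fun _ ↦ G₀) f y v w := by
  simp [coordHessian, coordSecondFundamentalForm, christoffel]

/-- After tracing, this expresses `df(τ(u))` as `Δ(f ∘ u) - tr ∇df(du, du)`, the form in which the
tension field is differentiated later. -/
theorem coordHessian_comp (G : E → E →L[ℝ] E →L[ℝ] ℝ)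
    (G' : F → F →L[ℝ] F →L[ℝ] ℝ) {f : F → ℝ} {u : E → F}
    (hf : ContDiffAt ℝ 2 f (u y)) (hu : ContDiffAt ℝ 2 u y) (v w : E) :
    coordHessian G (f ∘ u) y v w =
      fderiv ℝ f (u y) (coordSecondFundamentalForm G G' u y v w) +
        coordHessian G' f (u y) (fderiv ℝ u y v) (fderiv ℝ u y w) := by
  simp only [coordHessian_eq_secondFundamentalForm _ _ _ _ _ 0]
  exact coordSecondFundamentalForm_comp G G' _ hf hu v w

/-- The second fundamental form as a continuous bilinear map. -/
def secondFundamentalMap (G : E → E →L[ℝ] E →L[ℝ] ℝ)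
    (G' : F → F →L[ℝ] F →L[ℝ] ℝ) (u : E → F) (y : E) : E →L[ℝ] E →L[ℝ] F :=
  fderiv ℝ (fderiv ℝ u) y - (ContinuousLinearMap.compL ℝ E E F (fderiv ℝ u y)) ∘L
    christoffelMap G y + (ContinuousLinearMap.precomp F (fderiv ℝ u y)) ∘L
      christoffelMap G' (u y) ∘L fderiv ℝ u y

theorem secondFundamentalMap_apply (G : E → E →L[ℝ] E →L[ℝ] ℝ)
    (G' : F → F →L[ℝ] F →L[ℝ] ℝ) (u : E → F) (y v w : E) :
    secondFundamentalMap G G' u y v w = coordSecondFundamentalForm G G' u y v w := rfl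

/-- The Hessian as a continuous bilinear map. -/
def hessianMap (G : E → E →L[ℝ] E →L[ℝ] ℝ) (f : E → ℝ) (y : E) : E →L[ℝ] E →L[ℝ] ℝ :=
  fderiv ℝ (fderiv ℝ f) y - (ContinuousLinearMap.compL ℝ E E ℝ (fderiv ℝ f y)) ∘L
    christoffelMap G y

theorem hessianMap_apply (G : E → E →L[ℝ] E →L[ℝ] ℝ) (f : E → ℝ) (y v w : E) :
    hessianMap G f y v w = coordHessian G f y v w := rfl

theorem IsMetricOn.smooth_hessianMap (hG : IsMetricOn G U) {f : E → ℝ} (hf : ContDiffOn ℝ ∞ f U) :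
    ContDiffOn ℝ ∞ (hessianMap G f) U := by
  have h1 := smoothOn_fderiv hf hG.isOpen
  exact (smoothOn_fderiv h1 hG.isOpen).sub
    (((ContinuousLinearMap.compL ℝ E E ℝ).contDiff.comp_contDiffOn h1).clm_comp
      hG.smooth_christoffelMap)

end Connection

/-! ### Isometries -/

section Isometry

variable {E : Type*} [NormedAddCommGroup E] [NormedSpace ℝ E] [FiniteDimensional ℝ E]
  {E₂ : Type*} [NormedAddCommGroup E₂] [NormedSpace ℝ E₂] [FiniteDimensional ℝ E₂]
  {F : Type*} [NormedAddCommGroup F] [NormedSpace ℝ F] [FiniteDimensional ℝ F]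
  {F₂ : Type*} [NormedAddCommGroup F₂] [NormedSpace ℝ F₂] [FiniteDimensional ℝ F₂]

/-- `s` is a smooth local isometry from the metric `G` on `U` to the metric `G₂` on `U₂`. -/
structure IsIsometryOn (G : E → E →L[ℝ] E →L[ℝ] ℝ) (U : Set E) (G₂ : E₂ → E₂ →L[ℝ] E₂ →L[ℝ] ℝ)
    (U₂ : Set E₂) (s : E → E₂) : Prop where
  metric : IsMetricOn G U
  metric₂ : IsMetricOn G₂ U₂
  mapsTo : MapsTo s U U₂
  smooth : ContDiffOn ℝ ∞ s U
  bijective : ∀ y ∈ U, Function.Bijective (fderiv ℝ s y)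
  eq_pullback : ∀ y ∈ U, G y = pullbackForm (G₂ (s y)) (fderiv ℝ s y)

variable {G : E → E →L[ℝ] E →L[ℝ] ℝ} {U : Set E} {G₂ : E₂ → E₂ →L[ℝ] E₂ →L[ℝ] ℝ}
  {U₂ : Set E₂} {s : E → E₂} {y : E}

theorem IsIsometryOn.fderiv_metric (h : IsIsometryOn G U G₂ U₂ s) (hy : y ∈ U) (a v w : E) :
    fderiv ℝ G y a v w =
      fderiv ℝ G₂ (s y) (fderiv ℝ s y a) (fderiv ℝ s y v) (fderiv ℝ s y w) +
      G₂ (s y) (fderiv ℝ (fderiv ℝ s) y a v) (fderiv ℝ s y w) +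
      G₂ (s y) (fderiv ℝ s y v) (fderiv ℝ (fderiv ℝ s) y a w) := by
  rw [← fderiv_bilin_apply (h.metric.differentiableAt hy)]
  have h1 : (fun z ↦ G z v w) =ᶠ[𝓝 y]
      fun z ↦ G₂ (s z) (fderiv ℝ s z v) (fderiv ℝ s z w) := by
    filter_upwards [h.metric.isOpen.mem_nhds hy] with z hz
    rw [h.eq_pullback z hz]
    rfl
  have hs := smoothOn_differentiableAt h.smooth h.metric.isOpen hy
  have hs' := smoothOn_differentiableAt (smoothOn_fderiv h.smooth h.metric.isOpen)
    h.metric.isOpen hy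
  have hG₂ := h.metric₂.differentiableAt (h.mapsTo hy)
  have hc : DifferentiableAt ℝ (fun z ↦ G₂ (s z)) y := hG₂.comp y hs
  have hv (v) : DifferentiableAt ℝ (fun z ↦ fderiv ℝ s z v) y :=
    hs'.clm_apply (differentiableAt_const v)
  have hc' : fderiv ℝ (fun z ↦ G₂ (s z)) y = fderiv ℝ G₂ (s y) ∘L fderiv ℝ s y :=
    fderiv_comp y hG₂ hs
  rw [h1.fderiv_eq, fderiv_clm_apply (hc.clm_apply (hv v)) (hv w), fderiv_clm_apply hc (hv v)]
  simp [fderiv_apply_const hs', hc']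
  ring

/-- The transformation law of the Christoffel symbols. As `ds` is onto, it suffices to pair with
vectors `ds(z)`; inserting the derivative of `G = s^*G₂` into the Koszul formula, all terms with
second derivatives of `s` cancel by symmetry except the one displayed. -/
theorem IsIsometryOn.fderiv_christoffel (h : IsIsometryOn G U G₂ U₂ s) (hy : y ∈ U) (v w : E) :
    fderiv ℝ s y (christoffel G y v w) = fderiv ℝ (fderiv ℝ s) y v w +
      christoffel G₂ (s y) (fderiv ℝ s y v) (fderiv ℝ s y w) := by
  refine (h.metric₂.form _ (h.mapsTo hy)).ext fun z₂ ↦ ?_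
  obtain ⟨z, rfl⟩ := (h.bijective y hy).2 z₂
  have hD := smoothOn_fderiv_fderiv_symm h.smooth h.metric.isOpen hy
  have hsy := (h.metric₂.form _ (h.mapsTo hy)).symm
  have h1 : G₂ (s y) (fderiv ℝ s y (christoffel G y v w)) (fderiv ℝ s y z) =
      G y (christoffel G y v w) z := by
    rw [h.eq_pullback y hy]
    rfl
  rw [h1, h.metric.apply_christoffel hy, map_add, add_apply,
    h.metric₂.apply_christoffel (h.mapsTo hy), h.fderiv_metric hy, h.fderiv_metric hy,
    h.fderiv_metric hy, hD w v, hD z v, hD z w,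
    hsy (fderiv ℝ s y v) (fderiv ℝ (fderiv ℝ s) y w z),
    hsy (fderiv ℝ s y w) (fderiv ℝ (fderiv ℝ s) y v z)]
  ring

/-- The second fundamental form of an isometry vanishes. -/
theorem IsIsometryOn.secondFundamentalForm_eq_zero (h : IsIsometryOn G U G₂ U₂ s) (hy : y ∈ U)
    (v w : E) : coordSecondFundamentalForm G G₂ s y v w = 0 := by
  rw [coordSecondFundamentalForm, h.fderiv_christoffel hy]
  abel

theorem contDiffAt_two_of_smoothOn {f : E → F} (hf : ContDiffOn ℝ ∞ f U) (hU : IsOpen U)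
    (hy : y ∈ U) : ContDiffAt ℝ 2 f y :=
  (hf.contDiffAt (hU.mem_nhds hy)).of_le (by simpa using WithTop.coe_le_coe.2 (le_top : (2 : ℕ∞) ≤ ⊤))

/-- Invariance of the tension field under isometries of the domain. -/
theorem IsIsometryOn.metricTrace_comp (h : IsIsometryOn G U G₂ U₂ s) (hy : y ∈ U)
    {G' : F → F →L[ℝ] F →L[ℝ] ℝ} {u : E₂ → F} (hu : ContDiffAt ℝ 2 u (s y)) :
    metricTrace (G y) (coordSecondFundamentalForm G G' (u ∘ s) y) =
      metricTrace (G₂ (s y)) (coordSecondFundamentalForm G₂ G' u (s y)) := by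
  have hs := contDiffAt_two_of_smoothOn h.smooth h.metric.isOpen hy
  have h1 : coordSecondFundamentalForm G G' (u ∘ s) y = fun v w ↦
      secondFundamentalMap G₂ G' u (s y) (fderiv ℝ s y v) (fderiv ℝ s y w) := by
    ext v w
    rw [coordSecondFundamentalForm_comp G G₂ G' hu hs, h.secondFundamentalForm_eq_zero hy]
    simp [secondFundamentalMap_apply]
  rw [h1, h.eq_pullback y hy,
    (h.metric₂.form _ (h.mapsTo hy)).metricTrace_pullback (h.bijective y hy)]
  rfl

/-- Equivariance of the tension field under isometries of the target. -/
theorem IsIsometryOn.metricTrace_comp_left (h : IsIsometryOn G U G₂ U₂ s)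
    {Gd : F → F →L[ℝ] F →L[ℝ] ℝ} {u : F → E} {x : F} (hx : u x ∈ U) (hu : ContDiffAt ℝ 2 u x) :
    metricTrace (Gd x) (coordSecondFundamentalForm Gd G₂ (s ∘ u) x) =
      fderiv ℝ s (u x) (metricTrace (Gd x) (coordSecondFundamentalForm Gd G u x)) := by
  have hs := contDiffAt_two_of_smoothOn h.smooth h.metric.isOpen hx
  rw [map_metricTrace]
  congr 1
  ext v w
  rw [coordSecondFundamentalForm_comp Gd G G₂ hs hu, h.secondFundamentalForm_eq_zero hx, add_zero]

/-- Invariance of the curvature under isometries. -/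
theorem IsIsometryOn.fderiv_curvature (h : IsIsometryOn G U G₂ U₂ s) (hy : y ∈ U) (u v w : E) :
    fderiv ℝ s y (coordCurvature G y u v w) =
      coordCurvature G₂ (s y) (fderiv ℝ s y u) (fderiv ℝ s y v) (fderiv ℝ s y w) := by
  have hs := smoothOn_differentiableAt h.smooth h.metric.isOpen hy
  have hs1 := smoothOn_fderiv h.smooth h.metric.isOpen
  have hs2 := smoothOn_fderiv hs1 h.metric.isOpen
  have hs1' := smoothOn_differentiableAt hs1 h.metric.isOpen hy
  have hs2' := smoothOn_differentiableAt hs2 h.metric.isOpen hy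
  have hΓ (v w) := smoothOn_differentiableAt (h.metric.smooth_christoffel v w) h.metric.isOpen hy
  have hΓ₂ := smoothOn_differentiableAt h.metric₂.smooth_christoffelMap h.metric₂.isOpen
    (h.mapsTo hy)
  have hc : DifferentiableAt ℝ (fun z ↦ christoffelMap G₂ (s z)) y := hΓ₂.comp y hs
  have hc' : fderiv ℝ (fun z ↦ christoffelMap G₂ (s z)) y =
      fderiv ℝ (christoffelMap G₂) (s y) ∘L fderiv ℝ s y := fderiv_comp y hΓ₂ hs
  have hv (v) : DifferentiableAt ℝ (fun z ↦ fderiv ℝ s z v) y :=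
    hs1'.clm_apply (differentiableAt_const v)
  have hv' (v w) : DifferentiableAt ℝ (fun z ↦ fderiv ℝ (fderiv ℝ s) z v w) y :=
    (hs2'.clm_apply (differentiableAt_const v)).clm_apply (differentiableAt_const w)
  -- The derivative of the Christoffel transformation law. Antisymmetrizing it in `u` and `v`
  -- removes the third derivatives of `s` and leaves the curvature.
  have key (u v w : E) : fderiv ℝ (fderiv ℝ s) y u (christoffel G y v w) +
      fderiv ℝ s y (fderiv ℝ (fun z ↦ christoffel G z v w) y u) =
      fderiv ℝ (fderiv ℝ (fderiv ℝ s)) y u v w +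
      fderiv ℝ (christoffelMap G₂) (s y) (fderiv ℝ s y u) (fderiv ℝ s y v) (fderiv ℝ s y w) +
      christoffel G₂ (s y) (fderiv ℝ (fderiv ℝ s) y u v) (fderiv ℝ s y w) +
      christoffel G₂ (s y) (fderiv ℝ s y v) (fderiv ℝ (fderiv ℝ s) y u w) := by
    have h1 : (fun z ↦ fderiv ℝ s z (christoffel G z v w)) =ᶠ[𝓝 y]
        fun z ↦ fderiv ℝ (fderiv ℝ s) z v w +
          christoffelMap G₂ (s z) (fderiv ℝ s z v) (fderiv ℝ s z w) := by
      filter_upwards [h.metric.isOpen.mem_nhds hy] with z hz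
      exact h.fderiv_christoffel hz v w
    have h2 : fderiv ℝ _ y u = fderiv ℝ _ y u := congrArg (fun L : E →L[ℝ] E₂ ↦ L u) h1.fderiv_eq
    rw [fderiv_clm_apply hs1' (hΓ v w), fderiv_fun_add (hv' v w)
      ((hc.clm_apply (hv v)).clm_apply (hv w)),
      fderiv_clm_apply (hc.clm_apply (hv v)) (hv w), fderiv_clm_apply hc (hv v),
      fderiv_clm_apply (hs2'.clm_apply (differentiableAt_const v)) (differentiableAt_const w),
      fderiv_clm_apply hs2' (differentiableAt_const v)] at h2
    simp [fderiv_apply_const hs1', hc', christoffelMap_apply] at h2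
    rw [add_comm, h2]
    abel
  have hder (u v w : E₂) : fderiv ℝ (fun z ↦ christoffel G₂ z v w) (s y) u =
      fderiv ℝ (christoffelMap G₂) (s y) u v w := by
    have h1 := fderiv_apply_const (A := fun z ↦ christoffelMap G₂ z v)
      (hΓ₂.clm_apply (differentiableAt_const v)) u w
    rwa [fderiv_apply_const hΓ₂] at h1
  have hsym (a b : E) : fderiv ℝ (fderiv ℝ s) y a b = fderiv ℝ (fderiv ℝ s) y b a :=
    smoothOn_fderiv_fderiv_symm h.smooth h.metric.isOpen hy a b
  have hsym3 : fderiv ℝ (fderiv ℝ (fderiv ℝ s)) y u v w =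
      fderiv ℝ (fderiv ℝ (fderiv ℝ s)) y v u w := by
    rw [smoothOn_fderiv_fderiv_symm hs1 h.metric.isOpen hy]
  have hΓ' (v w) := h.fderiv_christoffel hy v w
  have hadd (a b c : E₂) : christoffel G₂ (s y) a (b + c) =
      christoffel G₂ (s y) a b + christoffel G₂ (s y) a c :=
    map_add (christoffelMap G₂ (s y) a) b c
  have k1 := eq_sub_of_add_eq' (key u v w)
  have k2 := eq_sub_of_add_eq' (key v u w)
  simp only [coordCurvature, map_add, map_sub, k1, k2, hΓ', hadd, hder, hsym3, hsym v u]
  abel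

end Isometry

/-! ### Curvature, the Bochner identity and traces in coordinates -/

section Curvature

variable {E : Type*} [NormedAddCommGroup E] [NormedSpace ℝ E] [FiniteDimensional ℝ E]
  {F : Type*} [NormedAddCommGroup F] [NormedSpace ℝ F]
  {G : E → E →L[ℝ] E →L[ℝ] ℝ} {U : Set E} {y : E}

theorem IsMetricOn.differentiableAt_christoffelMap (hG : IsMetricOn G U) (hy : y ∈ U) :
    DifferentiableAt ℝ (christoffelMap G) y :=
  smoothOn_differentiableAt hG.smooth_christoffelMap hG.isOpen hy

theorem IsMetricOn.fderiv_christoffel_apply (hG : IsMetricOn G U) (hy : y ∈ U) (u v w : E) :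
    fderiv ℝ (fun z ↦ christoffel G z v w) y u = fderiv ℝ (christoffelMap G) y u v w := by
  have h := hG.differentiableAt_christoffelMap hy
  have h1 := fderiv_apply_const (A := fun z ↦ christoffelMap G z v)
    (h.clm_apply (differentiableAt_const v)) u w
  rwa [fderiv_apply_const h] at h1

/-- The curvature `(v, w) ↦ R(u, v)w` as a continuous bilinear map. -/
def curvatureMap (G : E → E →L[ℝ] E →L[ℝ] ℝ) (y u : E) : E →L[ℝ] E →L[ℝ] E :=
  fderiv ℝ (christoffelMap G) y u - (fderiv ℝ (christoffelMap G) y).flip u +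
    ContinuousLinearMap.compL ℝ E E E (christoffelMap G y u) ∘L christoffelMap G y -
    ContinuousLinearMap.precomp E (christoffelMap G y u) ∘L christoffelMap G y

theorem IsMetricOn.curvatureMap_apply (hG : IsMetricOn G U) (hy : y ∈ U) (u v w : E) :
    curvatureMap G y u v w = coordCurvature G y u v w := by
  rw [coordCurvature, hG.fderiv_christoffel_apply hy, hG.fderiv_christoffel_apply hy]
  rfl

theorem coordCurvature_antisymm (G : E → E →L[ℝ] E →L[ℝ] ℝ) (y u v w : E) :
    coordCurvature G y u v w = -coordCurvature G y v u w := by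
  rw [coordCurvature, coordCurvature]
  abel

theorem IsMetricOn.coordCurvature_bianchi (hG : IsMetricOn G U) (hy : y ∈ U) (u v w : E) :
    coordCurvature G y u v w + coordCurvature G y v w u + coordCurvature G y w u v = 0 := by
  have h1 (v w : E) : (fun z ↦ christoffel G z v w) =ᶠ[𝓝 y] fun z ↦ christoffel G z w v := by
    filter_upwards [hG.isOpen.mem_nhds hy] with z hz
    exact hG.christoffel_symm hz v w
  simp only [coordCurvature]
  rw [(h1 u w).fderiv_eq, (h1 v u).fderiv_eq, (h1 w v).fderiv_eq, hG.christoffel_symm hy u w,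
    hG.christoffel_symm hy v u, hG.christoffel_symm hy w v]
  abel

/-- Second partial derivatives of the metric commute. Differentiating metric compatibility computes
them, and their antisymmetric part is `⟨R w, z⟩ + ⟨w, R z⟩`. -/
theorem IsMetricOn.apply_coordCurvature_antisymm (hG : IsMetricOn G U) (hy : y ∈ U)
    (u v w z : E) :
    G y (coordCurvature G y u v w) z = -G y w (coordCurvature G y u v z) := by
  have hd := hG.differentiableAt hy
  have hd' := smoothOn_differentiableAt (smoothOn_fderiv hG.smooth hG.isOpen) hG.isOpen hy
  have hΓ (v w) := smoothOn_differentiableAt (hG.smooth_christoffel v w) hG.isOpen hy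
  have key (c a : E) : fderiv ℝ (fderiv ℝ G) y c a w z =
      fderiv ℝ G y c (christoffel G y a w) z +
        G y (fderiv ℝ (fun x ↦ christoffel G x a w) y c) z +
      (fderiv ℝ G y c w (christoffel G y a z) +
        G y w (fderiv ℝ (fun x ↦ christoffel G x a z) y c)) := by
    have h1 : (fun x ↦ fderiv ℝ G x a w z) =ᶠ[𝓝 y] fun x ↦
        G x (christoffel G x a w) z + G x w (christoffel G x a z) := by
      filter_upwards [hG.isOpen.mem_nhds hy] with x hx
      exact hG.fderiv_eq hx a w z
    have h2 : fderiv ℝ _ y c = fderiv ℝ _ y c := congrArg (fun L : E →L[ℝ] ℝ ↦ L c) h1.fderiv_eq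
    have hc := differentiableAt_const (𝕜 := ℝ) (E := E) (x := y) (F := E)
    rw [fderiv_clm_apply ((hd'.clm_apply (hc a)).clm_apply (hc w)) (hc z),
      fderiv_clm_apply (hd'.clm_apply (hc a)) (hc w), fderiv_clm_apply hd' (hc a),
      fderiv_fun_add ((hd.clm_apply (hΓ a w)).clm_apply (hc z))
        ((hd.clm_apply (hc w)).clm_apply (hΓ a z)),
      fderiv_clm_apply (hd.clm_apply (hΓ a w)) (hc z), fderiv_clm_apply hd (hΓ a w),
      fderiv_clm_apply (hd.clm_apply (hc w)) (hΓ a z), fderiv_clm_apply hd (hc w)] at h2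
    simp at h2
    rw [h2]
    ring
  have hsymm : fderiv ℝ (fderiv ℝ G) y u v w z = fderiv ℝ (fderiv ℝ G) y v u w z := by
    rw [smoothOn_fderiv_fderiv_symm hG.smooth hG.isOpen hy]
  rw [key, key, hG.fderiv_eq hy, hG.fderiv_eq hy, hG.fderiv_eq hy, hG.fderiv_eq hy] at hsymm
  simp only [coordCurvature, map_add, map_sub, add_apply, sub_apply]
  linarith

/-- A linear consequence of the four Bianchi identities obtained by cyclically permuting `u, v, w,
z`, together with the antisymmetry in the first and in the last pair. -/
theorem IsMetricOn.apply_coordCurvature_pair_symm (hG : IsMetricOn G U) (hy : y ∈ U)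
    (u v w z : E) :
    G y (coordCurvature G y u v w) z = G y (coordCurvature G y w z u) v := by
  have hs := (hG.form y hy).symm
  have h1 (a b c d : E) : G y (coordCurvature G y a b c) d = -G y (coordCurvature G y b a c) d := by
    rw [coordCurvature_antisymm, map_neg, neg_apply]
  have h2 (a b c d : E) : G y (coordCurvature G y a b c) d = -G y (coordCurvature G y a b d) c := by
    rw [hG.apply_coordCurvature_antisymm hy, hs]
  have h3 (a b c d : E) : G y (coordCurvature G y a b c) d + G y (coordCurvature G y b c a) d +
      G y (coordCurvature G y c a b) d = 0 := by
    have := congrArg (fun x ↦ G y x d) (hG.coordCurvature_bianchi hy a b c)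
    simpa using this
  linarith [h3 u v w z, h3 v w z u, h3 w z u v, h3 z u v w, h1 u v w z, h1 v w u z, h1 w u v z,
    h2 u v w z, h2 v w u z, h2 w u v z, h1 v w z u, h1 w z v u, h1 z v w u, h2 v w z u, h2 w z v u,
    h2 z v w u, h1 w z u v, h1 z u w v, h1 u w z v, h2 w z u v, h2 z u w v, h2 u w z v,
    h1 z u v w, h1 u v z w, h1 v z u w, h2 z u v w, h2 u v z w, h2 v z u w]

/-- The Ricci operator in coordinates. -/
def coordRicci (G : E → E →L[ℝ] E →L[ℝ] ℝ) (y v : E) : E :=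
  metricTrace (G y) (coordCurvature G y v)

theorem IsMetricOn.coordRicci_eq (hG : IsMetricOn G U) (hy : y ∈ U) (v : E) :
    coordRicci G y v = metricTrace (G y) (fun a b ↦ curvatureMap G y v a b) := by
  simp only [hG.curvatureMap_apply hy]
  rfl

/-- The Ricci operator is self-adjoint. -/
theorem IsMetricOn.apply_coordRicci_symm (hG : IsMetricOn G U) (hy : y ∈ U) (v w : E) :
    G y (coordRicci G y v) w = G y (coordRicci G y w) v := by
  have h1 (v w : E) : G y (coordRicci G y v) w =
      metricTrace (G y) (fun a b ↦ G y (coordCurvature G y v a b) w) := by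
    rw [coordRicci]
    exact map_metricTrace ((G y).flip w) _ _
  rw [h1, hG.coordRicci_eq hy w, ← (hG.form y hy).metricTrace_flip]
  simp only [hG.curvatureMap_apply hy]
  rw [show G y (metricTrace (G y) fun a b ↦ coordCurvature G y w b a) v =
      metricTrace (G y) (fun a b ↦ G y (coordCurvature G y w b a) v) from
      map_metricTrace ((G y).flip v) _ _]
  congr 1
  ext a b
  rw [hG.apply_coordCurvature_pair_symm hy, coordCurvature_antisymm, map_neg, neg_apply,
    hG.apply_coordCurvature_antisymm hy, neg_neg, (hG.form y hy).symm]

/-- The covariant derivative of a field of bilinear forms. -/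
def covariantDeriv (G : E → E →L[ℝ] E →L[ℝ] ℝ) (B : E → E →L[ℝ] E →L[ℝ] F) (y u v w : E) : F :=
  fderiv ℝ B y u v w - B y (christoffel G y u v) w - B y v (christoffel G y u w)

/-- The pairing of `dualVec` with a fixed `w` is a constant coordinate of `w`; metric compatibility
turns its vanishing derivative into the formula. The sum over `j` appears because the coordinate
basis is constant rather than parallel. -/
theorem IsMetricOn.fderiv_dualVec (hG : IsMetricOn G U) (hy : y ∈ U) (a : E) (i) :
    fderiv ℝ (fun z ↦ dualVec (G z) i) y a = -christoffel G y a (dualVec (G y) i) -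
      ∑ j, G y (dualVec (G y) i) (christoffel G y a (Module.finBasis ℝ E j)) • dualVec (G y) j := by
  refine (hG.form y hy).ext fun w ↦ ?_
  have hd := hG.differentiableAt hy
  have hv := smoothOn_differentiableAt (hG.smooth_dualVec i) hG.isOpen hy
  have h1 : (fun z ↦ G z (dualVec (G z) i) w) =ᶠ[𝓝 y]
      fun z ↦ (Module.finBasis ℝ E).coord i w := by
    filter_upwards [hG.isOpen.mem_nhds hy] with z hz
    exact (hG.form z hz).apply_dualVec i w
  have h2 : fderiv ℝ _ y a = fderiv ℝ _ y a := congrArg (fun L : E →L[ℝ] ℝ ↦ L a) h1.fderiv_eq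
  rw [fderiv_clm_apply (hd.clm_apply hv) (differentiableAt_const w), fderiv_clm_apply hd hv] at h2
  simp at h2
  have h3 : G y (dualVec (G y) i) (christoffel G y a w) =
      ∑ j, G y (dualVec (G y) j) w *
        G y (dualVec (G y) i) (christoffel G y a (Module.finBasis ℝ E j)) := by
    conv_lhs => rw [← (hG.form y hy).sum_dualVec_smul w, ← christoffelMap_apply]
    simp [map_sum, christoffelMap_apply]
  rw [hG.fderiv_eq hy, h3] at h2
  simp [map_sum]
  rw [eq_sub_iff_add_eq, ← sub_eq_zero, ← h2]
  simp only [mul_comm]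
  ring

/-- The trace commutes with covariant derivatives. -/
theorem IsMetricOn.fderiv_metricTrace (hG : IsMetricOn G U) (hy : y ∈ U)
    {B : E → E →L[ℝ] E →L[ℝ] F} (hB : DifferentiableAt ℝ B y) (a : E) :
    fderiv ℝ (fun z ↦ metricTrace (G z) (fun v w ↦ B z v w)) y a =
      metricTrace (G y) (covariantDeriv G B y a) := by
  have hv (i) := smoothOn_differentiableAt (hG.smooth_dualVec i) hG.isOpen hy
  have hBi (i) : DifferentiableAt ℝ (fun z ↦ B z (Module.finBasis ℝ E i)) y :=
    hB.clm_apply (differentiableAt_const _)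
  simp only [metricTrace_eq_sum]
  rw [fderiv_fun_sum fun i _ ↦ (hBi i).clm_apply (hv i), sum_apply]
  simp only [fderiv_clm_apply (hBi _) (hv _), add_apply, ContinuousLinearMap.comp_apply,
    ContinuousLinearMap.flip_apply, fderiv_apply_const hB, hG.fderiv_dualVec hy, map_sub, map_neg,
    map_sum, map_smul, covariantDeriv, Finset.sum_add_distrib, Finset.sum_sub_distrib,
    Finset.sum_neg_distrib]
  -- The correction from the derivative of the dual vectors becomes the Christoffel term in the
  -- first argument of `B`.
  have h1 : ∑ i, ∑ j, G y (dualVec (G y) i) (christoffel G y a (Module.finBasis ℝ E j)) •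
      B y (Module.finBasis ℝ E i) (dualVec (G y) j) =
      ∑ j, B y (christoffel G y a (Module.finBasis ℝ E j)) (dualVec (G y) j) := by
    rw [Finset.sum_comm]
    refine Finset.sum_congr rfl fun j _ ↦ ?_
    conv_rhs => rw [← (hG.form y hy).sum_dualVec_smul (christoffel G y a _)]
    simp [map_sum]
  rw [h1]
  abel

variable {f : E → ℝ}

theorem IsMetricOn.coordHessian_symm (hG : IsMetricOn G U) (hf : ContDiffOn ℝ ∞ f U) (hy : y ∈ U)
    (v w : E) : coordHessian G f y v w = coordHessian G f y w v := by
  rw [coordHessian, coordHessian, smoothOn_fderiv_fderiv_symm hf hG.isOpen hy,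
    hG.christoffel_symm hy]

/-- The Ricci identity for the third covariant derivatives of a function. -/
theorem IsMetricOn.covariantDeriv_hessian_antisymm (hG : IsMetricOn G U) (hf : ContDiffOn ℝ ∞ f U)
    (hy : y ∈ U) (u v w : E) :
    covariantDeriv G (hessianMap G f) y u v w - covariantDeriv G (hessianMap G f) y v u w =
      -fderiv ℝ f y (coordCurvature G y u v w) := by
  have hf1 := smoothOn_fderiv hf hG.isOpen
  have hf2 := smoothOn_fderiv hf1 hG.isOpen
  have hd1 := smoothOn_differentiableAt hf1 hG.isOpen hy
  have hd2 := smoothOn_differentiableAt hf2 hG.isOpen hy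
  have hB := smoothOn_differentiableAt (hG.smooth_hessianMap hf) hG.isOpen hy
  have hΓ (v w) := smoothOn_differentiableAt (hG.smooth_christoffel v w) hG.isOpen hy
  have hc := differentiableAt_const (𝕜 := ℝ) (E := E) (x := y) (F := E)
  -- After antisymmetrization in `u` and `v` the third partial derivatives cancel, and the
  -- derivatives of the Christoffel symbols supply the derivative part of the curvature.
  have key (u v w : E) : fderiv ℝ (hessianMap G f) y u v w =
      fderiv ℝ (fderiv ℝ (fderiv ℝ f)) y u v w -
      (fderiv ℝ (fderiv ℝ f) y u (christoffel G y v w) +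
        fderiv ℝ f y (fderiv ℝ (fun z ↦ christoffel G z v w) y u)) := by
    have h1 := fderiv_apply_const (A := fun z ↦ hessianMap G f z v) (hB.clm_apply (hc v)) u w
    rw [fderiv_apply_const hB] at h1
    rw [← h1]
    change fderiv ℝ (fun z ↦ fderiv ℝ (fderiv ℝ f) z v w - fderiv ℝ f z (christoffel G z v w)) y u =
      _
    rw [fderiv_fun_sub ((hd2.clm_apply (hc v)).clm_apply (hc w)) (hd1.clm_apply (hΓ v w)),
      fderiv_clm_apply (hd2.clm_apply (hc v)) (hc w), fderiv_clm_apply hd2 (hc v),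
      fderiv_clm_apply hd1 (hΓ v w)]
    simp
    ring
  have h3 : fderiv ℝ (fderiv ℝ (fderiv ℝ f)) y u v w = fderiv ℝ (fderiv ℝ (fderiv ℝ f)) y v u w := by
    rw [smoothOn_fderiv_fderiv_symm hf1 hG.isOpen hy]
  have h4 := smoothOn_fderiv_fderiv_symm hf hG.isOpen hy
  simp only [covariantDeriv, key, hessianMap_apply, coordHessian, coordCurvature, map_add, map_sub,
    hG.christoffel_symm hy v u]
  rw [h3]
  ring

/-- The Laplace operator in coordinates. -/
def coordLaplacian (G : E → E →L[ℝ] E →L[ℝ] ℝ) (f : E → ℝ) (y : E) : ℝ :=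
  metricTrace (G y) (coordHessian G f y)

/-- The gradient in coordinates. -/
def coordGrad (G : E → E →L[ℝ] E →L[ℝ] ℝ) (f : E → ℝ) (y : E) : E :=
  (G y).inverse (fderiv ℝ f y)

/-- The squared length of the gradient in coordinates. -/
def coordGradSq (G : E → E →L[ℝ] E →L[ℝ] ℝ) (f : E → ℝ) (y : E) : ℝ :=
  fderiv ℝ f y (coordGrad G f y)

theorem IsMetricOn.apply_coordGrad (hG : IsMetricOn G U) (hy : y ∈ U) (w : E) :
    G y (coordGrad G f y) w = fderiv ℝ f y w := by
  rw [coordGrad, (hG.form y hy).apply_inverse]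

theorem IsMetricOn.smooth_coordGrad (hG : IsMetricOn G U) (hf : ContDiffOn ℝ ∞ f U) :
    ContDiffOn ℝ ∞ (coordGrad G f) U :=
  hG.smooth_inverse.clm_apply (smoothOn_fderiv hf hG.isOpen)

theorem IsMetricOn.smooth_coordGradSq (hG : IsMetricOn G U) (hf : ContDiffOn ℝ ∞ f U) :
    ContDiffOn ℝ ∞ (coordGradSq G f) U :=
  (smoothOn_fderiv hf hG.isOpen).clm_apply (hG.smooth_coordGrad hf)

theorem IsMetricOn.smooth_metricTrace (hG : IsMetricOn G U) {B : E → E →L[ℝ] E →L[ℝ] F}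
    (hB : ContDiffOn ℝ ∞ B U) :
    ContDiffOn ℝ ∞ (fun z ↦ metricTrace (G z) (fun v w ↦ B z v w)) U := by
  simp only [metricTrace_eq_sum]
  exact ContDiffOn.sum fun i _ ↦ (hB.clm_apply contDiffOn_const).clm_apply (hG.smooth_dualVec i)

theorem IsMetricOn.smooth_coordLaplacian (hG : IsMetricOn G U) (hf : ContDiffOn ℝ ∞ f U) :
    ContDiffOn ℝ ∞ (coordLaplacian G f) U :=
  hG.smooth_metricTrace (hG.smooth_hessianMap hf)

/-- The unknown derivative of `grad f` is eliminated by differentiating `G(grad f, w) = df(w)`, and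
metric compatibility expresses the derivative of `G` by Christoffel symbols. -/
theorem IsMetricOn.fderiv_coordGradSq (hG : IsMetricOn G U) (hf : ContDiffOn ℝ ∞ f U) (hy : y ∈ U)
    (v : E) : fderiv ℝ (coordGradSq G f) y v = 2 * coordHessian G f y v (coordGrad G f y) := by
  have hf1 := smoothOn_differentiableAt (smoothOn_fderiv hf hG.isOpen) hG.isOpen hy
  have hX := smoothOn_differentiableAt (hG.smooth_coordGrad hf) hG.isOpen hy
  have hd := hG.differentiableAt hy
  have hc := differentiableAt_const (𝕜 := ℝ) (E := E) (x := y) (F := E)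
  have h1 : fderiv ℝ (coordGradSq G f) y v = fderiv ℝ (fderiv ℝ f) y v (coordGrad G f y) +
      fderiv ℝ f y (fderiv ℝ (coordGrad G f) y v) := by
    change fderiv ℝ (fun z ↦ fderiv ℝ f z (coordGrad G f z)) y v = _
    rw [fderiv_clm_apply hf1 hX]
    simp [add_comm]
  have h2 (w : E) : fderiv ℝ (fderiv ℝ f) y v w = fderiv ℝ G y v (coordGrad G f y) w +
      G y (fderiv ℝ (coordGrad G f) y v) w := by
    have h3 : (fun z ↦ fderiv ℝ f z w) =ᶠ[𝓝 y] fun z ↦ G z (coordGrad G f z) w := by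
      filter_upwards [hG.isOpen.mem_nhds hy] with z hz
      exact (hG.apply_coordGrad hz w).symm
    have h4 : fderiv ℝ _ y v = fderiv ℝ _ y v := congrArg (fun L : E →L[ℝ] ℝ ↦ L v) h3.fderiv_eq
    rw [fderiv_clm_apply hf1 (hc w), fderiv_clm_apply (hd.clm_apply hX) (hc w),
      fderiv_clm_apply hd hX] at h4
    simp at h4
    rw [h4, add_comm]
  have h5 := hG.fderiv_eq hy v (coordGrad G f y) (coordGrad G f y)
  rw [(hG.form y hy).symm (christoffel _ _ _ _), hG.apply_coordGrad hy] at h5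
  have h6 := h2 (coordGrad G f y)
  rw [(hG.form y hy).symm (fderiv ℝ _ _ _), hG.apply_coordGrad hy] at h6
  rw [h1, coordHessian]
  linarith

/-- The Bochner identity, in a non-covariant form: the divergence of the Hessian is
`d Δf + Ric(grad f)`. -/
theorem IsMetricOn.bochner (hG : IsMetricOn G U) (hf : ContDiffOn ℝ ∞ f U) (hy : y ∈ U) (v : E) :
    2 * metricTrace (G y) (fun a b ↦ fderiv ℝ (hessianMap G f) y a b v) -
        metricTrace (G y) (fun a b ↦ fderiv ℝ (hessianMap G f) y v a b) -
        2 * coordHessian G f y (metricTrace (G y) (christoffel G y)) v =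
      fderiv ℝ (coordLaplacian G f) y v + 2 * G y (coordRicci G y (coordGrad G f y)) v := by
  have hB := smoothOn_differentiableAt (hG.smooth_hessianMap hf) hG.isOpen hy
  have hc := differentiableAt_const (𝕜 := ℝ) (E := E) (x := y) (F := E)
  have hF := hG.form y hy
  have hsymm (a v w : E) : fderiv ℝ (hessianMap G f) y a v w =
      fderiv ℝ (hessianMap G f) y a w v := by
    rw [← fderiv_bilin_apply hB, ← fderiv_bilin_apply hB]
    congr 1
    refine Filter.EventuallyEq.fderiv_eq ?_
    filter_upwards [hG.isOpen.mem_nhds hy] with z hz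
    exact hG.coordHessian_symm hf hz v w
  have h1 : fderiv ℝ (coordLaplacian G f) y v =
      metricTrace (G y) (covariantDeriv G (hessianMap G f) y v) := hG.fderiv_metricTrace hy hB v
  have h2 : metricTrace (G y) (covariantDeriv G (hessianMap G f) y v) =
      metricTrace (G y) (fun a b ↦ fderiv ℝ (hessianMap G f) y v a b) -
      metricTrace (G y) (fun a b ↦ hessianMap G f y (christoffel G y v a) b) -
      metricTrace (G y) (fun a b ↦ hessianMap G f y a (christoffel G y v b)) := by
    rw [← metricTrace_sub, ← metricTrace_sub]
    rfl
  have h3 : metricTrace (G y) (fun a b ↦ hessianMap G f y a (christoffel G y v b)) =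
      metricTrace (G y) (fun a b ↦ hessianMap G f y (christoffel G y v a) b) := by
    have := hF.metricTrace_flip ((hessianMap G f y) ∘L christoffelMap G y v)
    simp only [ContinuousLinearMap.comp_apply, christoffelMap_apply] at this
    rw [← this]
    congr 1
    ext a b
    exact hG.coordHessian_symm hf hy _ _
  -- The divergence of the Hessian. It contains the same trace of `Hess(Γ(v, a), b)` as `h2`, once
  -- instead of twice, so that trace cancels in `2 div Hess - dΔf`.
  have h4 : metricTrace (G y) (fun a b ↦ covariantDeriv G (hessianMap G f) y a v b) =
      metricTrace (G y) (fun a b ↦ fderiv ℝ (hessianMap G f) y a b v) -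
      metricTrace (G y) (fun a b ↦ hessianMap G f y (christoffel G y v a) b) -
      coordHessian G f y (metricTrace (G y) (christoffel G y)) v := by
    have h5 : coordHessian G f y (metricTrace (G y) (christoffel G y)) v =
        metricTrace (G y) (fun a b ↦ hessianMap G f y v (christoffel G y a b)) := by
      rw [hG.coordHessian_symm hf hy, ← hessianMap_apply, map_metricTrace]
    rw [h5, ← metricTrace_sub, ← metricTrace_sub]
    congr 1
    ext a b
    rw [covariantDeriv, hsymm a v b, hG.christoffel_symm hy a v]
  -- The Ricci identity, traced: exchanging the order of two covariant derivatives of `df` costs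
  -- `Ric(grad f)`.
  have h6 : metricTrace (G y) (fun a b ↦ covariantDeriv G (hessianMap G f) y a v b) -
      metricTrace (G y) (covariantDeriv G (hessianMap G f) y v) =
      G y (coordRicci G y (coordGrad G f y)) v := by
    rw [hG.apply_coordRicci_symm hy, hF.symm, hG.apply_coordGrad hy, coordRicci, map_metricTrace,
      ← metricTrace_sub]
    congr 1
    ext a b
    rw [hG.covariantDeriv_hessian_antisymm hf hy, coordCurvature_antisymm, map_neg, neg_neg]
  linarith

end Curvature

/-! ### The volume density and the divergence -/

section Volume

variable {E : Type*} [NormedAddCommGroup E] [NormedSpace ℝ E] [FiniteDimensional ℝ E]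
  {G : E → E →L[ℝ] E →L[ℝ] ℝ} {U : Set E} {y : E}

/-- The Gram matrix of a bilinear form in the coordinate basis. -/
def gramMatrix (B : E →L[ℝ] E →L[ℝ] ℝ) :
    Matrix (Fin (Module.finrank ℝ E)) (Fin (Module.finrank ℝ E)) ℝ :=
  Matrix.of fun i j ↦ B (Module.finBasis ℝ E i) (Module.finBasis ℝ E j)

theorem volumeDensity_eq (B : E →L[ℝ] E →L[ℝ] ℝ) : volumeDensity B = √(gramMatrix B).det := rfl

theorem IsMetricForm.det_gramMatrix_pos {B : E →L[ℝ] E →L[ℝ] ℝ} (hB : IsMetricForm B) :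
    0 < (gramMatrix B).det := by
  refine Matrix.PosDef.det_pos (Matrix.PosDef.of_dotProduct_mulVec_pos ?_ fun x hx ↦ ?_)
  · ext i j
    simp [gramMatrix, hB.symm]
  · have h1 : ∑ i, x i • Module.finBasis ℝ E i ≠ 0 := fun h ↦ hx <| by
      ext i
      exact Fintype.linearIndependent_iff.1 (Module.finBasis ℝ E).linearIndependent x h i
    have h2 := hB.pos _ h1
    simp only [map_sum, map_smul, sum_apply, smul_apply, smul_eq_mul] at h2
    simp only [dotProduct, Matrix.mulVec, gramMatrix, Matrix.of_apply, Pi.star_apply, star_trivial,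
      Finset.mul_sum] at h2 ⊢
    refine h2.trans_eq ?_
    rw [Finset.sum_comm]
    refine Finset.sum_congr rfl fun i _ ↦ Finset.sum_congr rfl fun j _ ↦ ?_
    ring

theorem IsMetricForm.volumeDensity_pos {B : E →L[ℝ] E →L[ℝ] ℝ} (hB : IsMetricForm B) :
    0 < volumeDensity B :=
  Real.sqrt_pos.2 hB.det_gramMatrix_pos

/-- Gram matrices change by the congruence `Tᵀ G T`. The factor `|det X|` is the Jacobian that makes
the volume measure independent of the chart. -/
theorem volumeDensity_pullback (B : E →L[ℝ] E →L[ℝ] ℝ) (X : E →L[ℝ] E) :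
    volumeDensity (pullbackForm B X) = |X.det| * volumeDensity B := by
  set T := LinearMap.toMatrix (Module.finBasis ℝ E) (Module.finBasis ℝ E) X.toLinearMap with hT
  have hX (j) : X (Module.finBasis ℝ E j) = ∑ i, T i j • Module.finBasis ℝ E i := by
    simp only [hT, LinearMap.toMatrix_apply]
    exact ((Module.finBasis ℝ E).sum_repr _).symm
  have h1 : gramMatrix (pullbackForm B X) = T.transpose * gramMatrix B * T := by
    ext i j
    simp only [gramMatrix, Matrix.of_apply, pullbackForm_apply, hX, map_sum, map_smul, sum_apply,
      smul_apply, smul_eq_mul, Matrix.mul_apply, Matrix.transpose_apply, Finset.sum_mul]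
    refine Finset.sum_congr rfl fun k _ ↦ ?_
    rw [Finset.mul_sum]
    refine Finset.sum_congr rfl fun l _ ↦ ?_
    ring
  have h2 : T.det = X.det := LinearMap.det_toMatrix _ _
  rw [volumeDensity_eq, volumeDensity_eq, h1, Matrix.det_mul, Matrix.det_mul,
    Matrix.det_transpose, h2, mul_comm X.det, mul_assoc, mul_comm, Real.sqrt_mul
    (mul_self_nonneg _), Real.sqrt_mul_self_eq_abs]

theorem IsMetricOn.smooth_det (hG : IsMetricOn G U) :
    ContDiffOn ℝ ∞ (fun z ↦ (gramMatrix (G z)).det) U := by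
  simp only [Matrix.det_apply]
  refine ContDiffOn.sum fun s _ ↦ ContDiffOn.const_smul _ (contDiffOn_prod fun i _ ↦ ?_)
  exact (hG.smooth.clm_apply contDiffOn_const).clm_apply contDiffOn_const

theorem IsMetricOn.smooth_volumeDensity (hG : IsMetricOn G U) :
    ContDiffOn ℝ ∞ (fun z ↦ volumeDensity (G z)) U :=
  hG.smooth_det.sqrt fun z hz ↦ (hG.form z hz).det_gramMatrix_pos.ne'

/-- `det(M + sA) = det M · det(1 + s N A)`, and the second factor is `1 + s tr(N A)` up to a
polynomial multiple of `s²`. -/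
theorem hasDerivAt_det_add_smul {ι : Type*} [Fintype ι] [DecidableEq ι] {M N : Matrix ι ι ℝ}
    (h : N * M = 1) (A : Matrix ι ι ℝ) :
    HasDerivAt (fun s : ℝ ↦ (M + s • A).det) (M.det * (N * A).trace) 0 := by
  have h1 (s : ℝ) : (M + s • A).det = M.det * (1 + (N * A).trace * s +
      (Matrix.det (1 + (Polynomial.X : Polynomial ℝ) •
        (N * A).map Polynomial.C)).divX.divX.eval s * s ^ 2) := by
    rw [← Matrix.det_one_add_smul, ← Matrix.det_mul, mul_add, mul_one, Matrix.mul_smul,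
      ← mul_assoc, _root_.mul_eq_one_comm.1 h, one_mul]
  simp only [h1]
  set P := (Matrix.det (1 + (Polynomial.X : Polynomial ℝ) •
        (N * A).map Polynomial.C)).divX.divX
  have h2 := ((((hasDerivAt_id (0 : ℝ)).const_mul (N * A).trace).const_add 1).add
    ((P.hasDerivAt 0).mul ((hasDerivAt_id (0 : ℝ)).pow 2))).const_mul M.det
  refine h2.congr_deriv ?_
  simp

theorem differentiable_det {ι : Type*} [Fintype ι] [DecidableEq ι] :
    Differentiable ℝ (fun M : ι → ι → ℝ ↦ (Matrix.of M).det) := by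
  simp only [Matrix.det_apply, Matrix.of_apply]
  fun_prop

theorem IsMetricOn.fderiv_det (hG : IsMetricOn G U) (hy : y ∈ U) (a : E) :
    fderiv ℝ (fun z ↦ (gramMatrix (G z)).det) y a =
      (gramMatrix (G y)).det * metricTrace (G y) (fun v w ↦ fderiv ℝ G y a v w) := by
  have hF := hG.form y hy
  have hd := hG.differentiableAt hy
  -- `N` is the inverse Gram matrix `g^{ij}`, with rows the coordinates of the dual vectors.
  set N : Matrix (Fin (Module.finrank ℝ E)) (Fin (Module.finrank ℝ E)) ℝ :=
    Matrix.of fun i j ↦ (Module.finBasis ℝ E).coord j (dualVec (G y) i) with hN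
  have hexp (i) : ∑ j, N i j • Module.finBasis ℝ E j = dualVec (G y) i :=
    (Module.finBasis ℝ E).sum_repr _
  have hNM : N * gramMatrix (G y) = 1 := by
    ext i k
    have h1 : (N * gramMatrix (G y)) i k = G y (dualVec (G y) i) (Module.finBasis ℝ E k) := by
      rw [← hexp i]
      simp [Matrix.mul_apply, gramMatrix, map_sum]
    rw [h1, hF.apply_dualVec]
    simp [Matrix.one_apply, Finsupp.single_apply, eq_comm]
  have hM : HasFDerivAt (fun z ↦ fun i j ↦ G z (Module.finBasis ℝ E i) (Module.finBasis ℝ E j))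
      (ContinuousLinearMap.pi fun i ↦ ContinuousLinearMap.pi fun j ↦
        fderiv ℝ (fun z ↦ G z (Module.finBasis ℝ E i) (Module.finBasis ℝ E j)) y) y := by
    refine hasFDerivAt_pi.2 fun i ↦ hasFDerivAt_pi.2 fun j ↦ DifferentiableAt.hasFDerivAt ?_
    exact (hd.clm_apply (differentiableAt_const _)).clm_apply (differentiableAt_const _)
  have hdet := (differentiable_det (ι := Fin (Module.finrank ℝ E))
    (fun i j ↦ G y (Module.finBasis ℝ E i) (Module.finBasis ℝ E j))).hasFDerivAt
  have h1 := (hdet.comp y hM).fderiv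
  have h2 : fderiv ℝ (fun z ↦ (gramMatrix (G z)).det) y a = _ :=
    congrArg (fun L : E →L[ℝ] ℝ ↦ L a) h1
  rw [h2]
  set A : Fin (Module.finrank ℝ E) → Fin (Module.finrank ℝ E) → ℝ :=
    fun i j ↦ fderiv ℝ G y a (Module.finBasis ℝ E i) (Module.finBasis ℝ E j) with hA
  have h3 : (ContinuousLinearMap.pi fun i ↦ ContinuousLinearMap.pi fun j ↦
        fderiv ℝ (fun z ↦ G z (Module.finBasis ℝ E i) (Module.finBasis ℝ E j)) y) a = A := by
    ext i j
    simp [hA, fderiv_bilin_apply hd]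
  rw [ContinuousLinearMap.comp_apply, h3]
  have h4 := (hdet.hasLineDerivAt A).unique (hasDerivAt_det_add_smul hNM (Matrix.of A))
  refine h4.trans ?_
  congr 1
  rw [← hF.metricTrace_flip, metricTrace_eq_sum, Matrix.trace]
  refine Finset.sum_congr rfl fun i _ ↦ ?_
  rw [← hexp i]
  simp [Matrix.mul_apply, hA, map_sum]

/-- The logarithmic derivative is half the trace of `∂_a G`, and metric compatibility splits that
trace into two equal halves. -/
theorem IsMetricOn.fderiv_volumeDensity (hG : IsMetricOn G U) (hy : y ∈ U) (a : E) :
    fderiv ℝ (fun z ↦ volumeDensity (G z)) y a =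
      volumeDensity (G y) * metricTrace (G y) (fun v w ↦ G y (christoffel G y a v) w) := by
  have hF := hG.form y hy
  have hpos := hF.det_gramMatrix_pos
  have hd := smoothOn_differentiableAt hG.smooth_det hG.isOpen hy
  have h1 : fderiv ℝ (fun z ↦ volumeDensity (G z)) y a = _ :=
    congrArg (fun L : E →L[ℝ] ℝ ↦ L a) (hd.hasFDerivAt.sqrt hpos.ne').fderiv
  have h2 : metricTrace (G y) (fun v w ↦ fderiv ℝ G y a v w) =
      2 * metricTrace (G y) (fun v w ↦ G y (christoffel G y a v) w) := by
    have h3 : metricTrace (G y) (fun v w ↦ G y v (christoffel G y a w)) =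
        metricTrace (G y) (fun v w ↦ G y (christoffel G y a v) w) := by
      have := hF.metricTrace_flip (G y ∘L christoffelMap G y a)
      simp only [ContinuousLinearMap.comp_apply, christoffelMap_apply] at this
      rw [← this]
      congr 1
      ext v w
      exact hF.symm _ _
    simp only [hG.fderiv_eq hy]
    rw [metricTrace_add, h3, two_mul]
  rw [h1, smul_apply, hG.fderiv_det hy, h2, volumeDensity_eq, smul_eq_mul]
  have h4 : √(gramMatrix (G y)).det ≠ 0 := (Real.sqrt_pos.2 hpos).ne'
  field_simp
  rw [Real.sq_sqrt hpos.le]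

/-- The divergence of the vectors `√(det g) g^{ij} e_j`. -/
theorem IsMetricOn.sum_fderiv_volumeDensity_dualVec (hG : IsMetricOn G U) (hy : y ∈ U) :
    ∑ i, fderiv ℝ (fun z ↦ volumeDensity (G z) • dualVec (G z) i) y (Module.finBasis ℝ E i) =
      -(volumeDensity (G y) • metricTrace (G y) (christoffel G y)) := by
  have hF := hG.form y hy
  have hρ := smoothOn_differentiableAt hG.smooth_volumeDensity hG.isOpen hy
  have hv (i) := smoothOn_differentiableAt (hG.smooth_dualVec i) hG.isOpen hy
  have h1 (i j) : christoffel G y (Module.finBasis ℝ E i) (Module.finBasis ℝ E j) =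
      christoffel G y (Module.finBasis ℝ E j) (Module.finBasis ℝ E i) := hG.christoffel_symm hy _ _
  -- This contribution from the derivatives of the dual vectors cancels against the derivative of
  -- the density, so only the traced Christoffel symbols survive.
  have h2 : ∑ i, ∑ j, G y (dualVec (G y) i)
      (christoffel G y (Module.finBasis ℝ E i) (Module.finBasis ℝ E j)) • dualVec (G y) j =
      ∑ j, metricTrace (G y) (fun v w ↦ G y (christoffel G y (Module.finBasis ℝ E j) v) w) •
        dualVec (G y) j := by
    rw [Finset.sum_comm]
    simp only [metricTrace_eq_sum, Finset.sum_smul, h1, hF.symm (dualVec _ _)]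
  simp only [fderiv_fun_smul hρ (hv _), add_apply, smul_apply, ContinuousLinearMap.smulRight_apply,
    hG.fderiv_dualVec hy, hG.fderiv_volumeDensity hy, Finset.sum_add_distrib, ← Finset.smul_sum,
    Finset.sum_sub_distrib, h2, Finset.sum_neg_distrib, mul_smul]
  rw [metricTrace_eq_sum (G y) (christoffel G y), smul_sub, smul_neg]
  abel

end Volume

/-! ### Smooth one-parameter families of maps -/

section Families

variable {X : Type*} [NormedAddCommGroup X] [NormedSpace ℝ X]
  {F : Type*} [NormedAddCommGroup F] [NormedSpace ℝ F]
  {u : ℝ → X → F} {O : Set (ℝ × X)}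

/-- The family `u` of maps, with its parameter, is smooth on `O`. -/
def SmoothFamilyOn (u : ℝ → X → F) (O : Set (ℝ × X)) : Prop :=
  ContDiffOn ℝ ∞ (fun q : ℝ × X ↦ u q.1 q.2) O

theorem SmoothFamilyOn.hasFDerivAt (hu : SmoothFamilyOn u O) (hO : IsOpen O) {t : ℝ} {z : X}
    (h : (t, z) ∈ O) : HasFDerivAt (u t)
      (fderiv ℝ (fun q : ℝ × X ↦ u q.1 q.2) (t, z) ∘L ContinuousLinearMap.inr ℝ ℝ X) z := by
  have h1 : HasFDerivAt (fun q : ℝ × X ↦ u q.1 q.2)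
    (fderiv ℝ (fun q : ℝ × X ↦ u q.1 q.2) (t, z)) ((fun z' : X ↦ (t, z')) z) :=
    (smoothOn_differentiableAt hu hO h).hasFDerivAt
  exact h1.comp z (hasFDerivAt_prodMk_right t z)

theorem SmoothFamilyOn.hasDerivAt (hu : SmoothFamilyOn u O) (hO : IsOpen O) {t : ℝ} {z : X}
    (h : (t, z) ∈ O) : HasDerivAt (fun s ↦ u s z)
      (fderiv ℝ (fun q : ℝ × X ↦ u q.1 q.2) (t, z) (1, 0)) t := by
  have h1 : HasFDerivAt (fun q : ℝ × X ↦ u q.1 q.2)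
    (fderiv ℝ (fun q : ℝ × X ↦ u q.1 q.2) (t, z)) ((fun s : ℝ ↦ (s, z)) t) :=
    (smoothOn_differentiableAt hu hO h).hasFDerivAt
  have h2 := (h1.comp t (hasFDerivAt_prodMk_left t z)).hasDerivAt
  simpa using! h2

theorem SmoothFamilyOn.differentiableAt (hu : SmoothFamilyOn u O) (hO : IsOpen O) {t : ℝ} {z : X}
    (h : (t, z) ∈ O) : DifferentiableAt ℝ (fun s ↦ u s z) t :=
  (hu.hasDerivAt hO h).differentiableAt

theorem SmoothFamilyOn.fderiv (hu : SmoothFamilyOn u O) (hO : IsOpen O) :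
    SmoothFamilyOn (fun t z ↦ fderiv ℝ (u t) z) O := by
  have h1 : ContDiffOn ℝ ∞ (fun q ↦ _root_.fderiv ℝ (fun q : ℝ × X ↦ u q.1 q.2) q ∘L
      ContinuousLinearMap.inr ℝ ℝ X) O := (smoothOn_fderiv hu hO).clm_comp contDiffOn_const
  exact h1.congr fun q hq ↦ (hu.hasFDerivAt hO (t := q.1) (z := q.2) hq).fderiv

theorem SmoothFamilyOn.deriv (hu : SmoothFamilyOn u O) (hO : IsOpen O) :
    SmoothFamilyOn (fun t z ↦ deriv (fun s ↦ u s z) t) O := by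
  have h1 : ContDiffOn ℝ ∞ (fun q ↦ _root_.fderiv ℝ (fun q : ℝ × X ↦ u q.1 q.2) q (1, 0)) O :=
    (smoothOn_fderiv hu hO).clm_apply contDiffOn_const
  exact h1.congr fun q hq ↦ (hu.hasDerivAt hO (t := q.1) (z := q.2) hq).deriv

theorem SmoothFamilyOn.smooth_slice (hu : SmoothFamilyOn u O) {t : ℝ} {W : Set X}
    (hW : ∀ z ∈ W, (t, z) ∈ O) : ContDiffOn ℝ ∞ (u t) W :=
  ContDiffOn.comp (g := fun q : ℝ × X ↦ u q.1 q.2) (f := fun z ↦ (t, z)) hu (by fun_prop) hW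

theorem SmoothFamilyOn.contDiffAt_slice (hu : SmoothFamilyOn u O) (hO : IsOpen O) {t : ℝ} {z : X}
    (h : (t, z) ∈ O) : ContDiffAt ℝ ∞ (u t) z :=
  ContDiffAt.comp (g := fun q : ℝ × X ↦ u q.1 q.2) (f := fun z ↦ (t, z)) z
    (hu.contDiffAt (hO.mem_nhds h)) (by fun_prop)

/-- The derivatives in the parameter and in the variable commute. -/
theorem SmoothFamilyOn.hasDerivAt_fderiv (hu : SmoothFamilyOn u O) (hO : IsOpen O) {t : ℝ} {z : X}
    (h : (t, z) ∈ O) : HasDerivAt (fun s ↦ _root_.fderiv ℝ (u s) z)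
      (_root_.fderiv ℝ (fun z' ↦ _root_.deriv (fun s ↦ u s z') t) z) t := by
  have h0 := smoothOn_differentiableAt (smoothOn_fderiv hu hO) hO h
  have h1 := ((hu.fderiv hO).hasDerivAt hO h).differentiableAt.hasDerivAt
  refine h1.congr_deriv ?_
  have h3 : (fun s ↦ _root_.fderiv ℝ (u s) z) =ᶠ[𝓝 t] fun s ↦
      _root_.fderiv ℝ (fun q : ℝ × X ↦ u q.1 q.2) (s, z) ∘L ContinuousLinearMap.inr ℝ ℝ X := by
    filter_upwards [(hO.preimage (by fun_prop : Continuous fun s : ℝ ↦ (s, z))).mem_nhds h]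
      with s hs
    exact (hu.hasFDerivAt hO hs).fderiv
  have h4 : (fun z' ↦ _root_.deriv (fun s ↦ u s z') t) =ᶠ[𝓝 z] fun z' ↦
      _root_.fderiv ℝ (fun q : ℝ × X ↦ u q.1 q.2) (t, z') (1, 0) := by
    filter_upwards [(hO.preimage (by fun_prop : Continuous fun z' : X ↦ (t, z'))).mem_nhds h]
      with z' hz'
    exact (hu.hasDerivAt hO hz').deriv
  have h5 : HasFDerivAt (_root_.fderiv ℝ (fun q : ℝ × X ↦ u q.1 q.2)) (_root_.fderiv ℝ (_root_.fderiv ℝ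
      (fun q : ℝ × X ↦ u q.1 q.2)) (t, z)) (t, z) := h0.hasFDerivAt
  have h6 : HasDerivAt (fun s ↦ _root_.fderiv ℝ (fun q : ℝ × X ↦ u q.1 q.2) (s, z))
      (_root_.fderiv ℝ (_root_.fderiv ℝ (fun q : ℝ × X ↦ u q.1 q.2)) (t, z) (1, 0)) t := by
    have h6' : HasFDerivAt (_root_.fderiv ℝ (fun q : ℝ × X ↦ u q.1 q.2)) (_root_.fderiv ℝ
      (_root_.fderiv ℝ (fun q : ℝ × X ↦ u q.1 q.2)) (t, z)) ((fun s : ℝ ↦ (s, z)) t) := h5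
    simpa using! (h6'.comp t (hasFDerivAt_prodMk_left t z)).hasDerivAt
  have h7 : HasFDerivAt (fun z' ↦ _root_.fderiv ℝ (fun q : ℝ × X ↦ u q.1 q.2) (t, z'))
      (_root_.fderiv ℝ (_root_.fderiv ℝ (fun q : ℝ × X ↦ u q.1 q.2)) (t, z) ∘L
        ContinuousLinearMap.inr ℝ ℝ X) z := by
    have h7' : HasFDerivAt (_root_.fderiv ℝ (fun q : ℝ × X ↦ u q.1 q.2)) (_root_.fderiv ℝ
      (_root_.fderiv ℝ (fun q : ℝ × X ↦ u q.1 q.2)) (t, z)) ((fun z' : X ↦ (t, z')) z) := h5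
    exact h7'.comp z (hasFDerivAt_prodMk_right t z)
  have h8 := ((h6.clm_comp (hasDerivAt_const t
    (ContinuousLinearMap.inr ℝ ℝ X))).congr_of_eventuallyEq h3).deriv
  ext v
  rw [h8, h4.fderiv_eq, fderiv_clm_apply h7.differentiableAt (differentiableAt_const _), h7.fderiv]
  simpa using smoothOn_fderiv_fderiv_symm hu hO h (1, 0) (0, v)

theorem SmoothFamilyOn.hasDerivAt_fderiv_fderiv (hu : SmoothFamilyOn u O) (hO : IsOpen O) {t : ℝ}
    {z : X} (h : (t, z) ∈ O) : HasDerivAt (fun s ↦ _root_.fderiv ℝ (_root_.fderiv ℝ (u s)) z)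
      (_root_.fderiv ℝ (_root_.fderiv ℝ (fun z' ↦ _root_.deriv (fun s ↦ u s z') t)) z) t := by
  have h1 := (hu.fderiv hO).hasDerivAt_fderiv hO h
  have h2 : (fun z' ↦ _root_.deriv (fun s ↦ _root_.fderiv ℝ (u s) z') t) =ᶠ[𝓝 z]
      _root_.fderiv ℝ (fun z' ↦ _root_.deriv (fun s ↦ u s z') t) := by
    filter_upwards [(hO.preimage (by fun_prop : Continuous fun z' : X ↦ (t, z'))).mem_nhds h]
      with z' hz'
    exact (hu.hasDerivAt_fderiv hO hz').deriv
  rw [h2.fderiv_eq] at h1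
  exact h1

theorem SmoothFamilyOn.comp (hu : SmoothFamilyOn u O) {F' : Type*} [NormedAddCommGroup F']
    [NormedSpace ℝ F'] {f : F → F'} {U : Set F} (hf : ContDiffOn ℝ ∞ f U)
    (hU : ∀ q ∈ O, u q.1 q.2 ∈ U) : SmoothFamilyOn (fun t ↦ f ∘ u t) O :=
  ContDiffOn.comp (f := fun q : ℝ × X ↦ u q.1 q.2) hf hu hU

end Families

/-! ### Smooth dependence of the tension field on a parameter -/

section TensionFamily

variable {X : Type*} [NormedAddCommGroup X] [NormedSpace ℝ X] [FiniteDimensional ℝ X]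
  {E : Type*} [NormedAddCommGroup E] [NormedSpace ℝ E] [FiniteDimensional ℝ E]
  {F : Type*} [NormedAddCommGroup F] [NormedSpace ℝ F]
  {u : ℝ → X → E} {O : Set (ℝ × X)} {Gd : X → X →L[ℝ] X →L[ℝ] ℝ} {Ud : Set X}
  {G : E → E →L[ℝ] E →L[ℝ] ℝ} {U : Set E}

/-- The tension field in coordinates. -/
def coordTension (Gd : X → X →L[ℝ] X →L[ℝ] ℝ) (G : E → E →L[ℝ] E →L[ℝ] ℝ) (u : X → E) (z : X) : E :=
  metricTrace (Gd z) (coordSecondFundamentalForm Gd G u z)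

theorem SmoothFamilyOn.smooth_metricTrace (hO : ∀ q ∈ O, q.2 ∈ Ud) (hGd : IsMetricOn Gd Ud)
    {B : ℝ → X → X →L[ℝ] X →L[ℝ] F} (hB : SmoothFamilyOn B O) :
    SmoothFamilyOn (fun t z ↦ metricTrace (Gd z) (fun v w ↦ B t z v w)) O := by
  simp only [metricTrace_eq_sum]
  refine ContDiffOn.sum fun i _ ↦ (hB.clm_apply contDiffOn_const).clm_apply ?_
  exact (hGd.smooth_dualVec i).comp contDiffOn_snd hO

theorem SmoothFamilyOn.secondFundamentalMap (hu : SmoothFamilyOn u O) (hO : IsOpen O)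
    (hGd : IsMetricOn Gd Ud) (hG : IsMetricOn G U) (h1 : ∀ q ∈ O, q.2 ∈ Ud)
    (h2 : ∀ q ∈ O, u q.1 q.2 ∈ U) :
    SmoothFamilyOn (fun t z ↦ secondFundamentalMap Gd G (u t) z) O := by
  have hu1 := hu.fderiv hO
  have hu2 := hu1.fderiv hO
  have hΓd : ContDiffOn ℝ ∞ (fun q : ℝ × X ↦ christoffelMap Gd q.2) O :=
    hGd.smooth_christoffelMap.comp contDiffOn_snd h1
  have hΓ : ContDiffOn ℝ ∞ (fun q : ℝ × X ↦ christoffelMap G (u q.1 q.2)) O :=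
    ContDiffOn.comp (f := fun q : ℝ × X ↦ u q.1 q.2) hG.smooth_christoffelMap hu h2
  refine (hu2.sub (ContDiffOn.clm_comp
    ((ContinuousLinearMap.compL ℝ X X E).contDiff.comp_contDiffOn hu1) hΓd)).add
    (ContDiffOn.clm_comp ?_ (hΓ.clm_comp hu1))
  exact ((ContinuousLinearMap.compL ℝ X E E).flip.contDiff).comp_contDiffOn hu1

theorem SmoothFamilyOn.coordTension (hu : SmoothFamilyOn u O) (hO : IsOpen O)
    (hGd : IsMetricOn Gd Ud) (hG : IsMetricOn G U) (h1 : ∀ q ∈ O, q.2 ∈ Ud)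
    (h2 : ∀ q ∈ O, u q.1 q.2 ∈ U) :
    SmoothFamilyOn (fun t z ↦ coordTension Gd G (u t) z) O :=
  SmoothFamilyOn.smooth_metricTrace h1 hGd (hu.secondFundamentalMap hO hGd hG h1 h2)

theorem SmoothFamilyOn.normSq_coordTension (hu : SmoothFamilyOn u O) (hO : IsOpen O)
    (hGd : IsMetricOn Gd Ud) (hG : IsMetricOn G U) (h1 : ∀ q ∈ O, q.2 ∈ Ud)
    (h2 : ∀ q ∈ O, u q.1 q.2 ∈ U) :
    SmoothFamilyOn (fun t z ↦ G (u t z) (RiemannianGeometry.coordTension Gd G (u t) z)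
      (RiemannianGeometry.coordTension Gd G (u t) z)) O := by
  have h3 := hu.coordTension hO hGd hG h1 h2
  have h4 : ContDiffOn ℝ ∞ (fun q : ℝ × X ↦ G (u q.1 q.2)) O :=
    ContDiffOn.comp (f := fun q : ℝ × X ↦ u q.1 q.2) hG.smooth hu h2
  exact (h4.clm_apply h3).clm_apply h3

end TensionFamily

/-! ### Warped products in coordinates -/

section WarpedCoordinates

variable {E : Type*} [NormedAddCommGroup E] [NormedSpace ℝ E] [FiniteDimensional ℝ E]
  {F : Type*} [NormedAddCommGroup F] [NormedSpace ℝ F] [FiniteDimensional ℝ F]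

/-- The metric `G + e^{2f} K` on a product of coordinate spaces. -/
def coordWarped (G : E → E →L[ℝ] E →L[ℝ] ℝ) (K : F → F →L[ℝ] F →L[ℝ] ℝ) (f : E → ℝ) (z : E × F) :
    E × F →L[ℝ] E × F →L[ℝ] ℝ :=
  pullbackForm (G z.1) (ContinuousLinearMap.fst ℝ E F) +
    Real.exp (2 * f z.1) • pullbackForm (K z.2) (ContinuousLinearMap.snd ℝ E F)

variable {G : E → E →L[ℝ] E →L[ℝ] ℝ} {U : Set E} {K : F → F →L[ℝ] F →L[ℝ] ℝ} {W : Set F}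
  {f : E → ℝ} {z : E × F}

theorem coordWarped_apply (G : E → E →L[ℝ] E →L[ℝ] ℝ) (K : F → F →L[ℝ] F →L[ℝ] ℝ) (f : E → ℝ)
    (z v w : E × F) :
    coordWarped G K f z v w = G z.1 v.1 w.1 + Real.exp (2 * f z.1) * K z.2 v.2 w.2 := rfl

theorem smooth_pullbackForm {X : Type*} [NormedAddCommGroup X] [NormedSpace ℝ X]
    {Y : Type*} [NormedAddCommGroup Y] [NormedSpace ℝ Y] {B : X → E →L[ℝ] E →L[ℝ] ℝ}
    {S : Set X} (hB : ContDiffOn ℝ ∞ B S) {A : X → Y →L[ℝ] E} (hA : ContDiffOn ℝ ∞ A S) :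
    ContDiffOn ℝ ∞ (fun x ↦ pullbackForm (B x) (A x)) S :=
  ContDiffOn.clm_comp (((ContinuousLinearMap.compL ℝ Y E ℝ).flip.contDiff).comp_contDiffOn hA)
    (hB.clm_comp hA)

theorem isMetricOn_coordWarped (hG : IsMetricOn G U) (hK : IsMetricOn K W)
    (hf : ContDiffOn ℝ ∞ f U) : IsMetricOn (coordWarped G K f) (U ×ˢ W) where
  isOpen := hG.isOpen.prod hK.isOpen
  smooth := by
    have h1 : ContDiffOn ℝ ∞ (fun z : E × F ↦ G z.1) (U ×ˢ W) :=
      hG.smooth.comp contDiffOn_fst fun z hz ↦ hz.1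
    have h2 : ContDiffOn ℝ ∞ (fun z : E × F ↦ K z.2) (U ×ˢ W) :=
      hK.smooth.comp contDiffOn_snd fun z hz ↦ hz.2
    have h3 : ContDiffOn ℝ ∞ (fun z : E × F ↦ f z.1) (U ×ˢ W) :=
      hf.comp contDiffOn_fst fun z hz ↦ hz.1
    exact (smooth_pullbackForm h1 contDiffOn_const).add
      ((contDiffOn_const.mul h3).exp.smul (smooth_pullbackForm h2 contDiffOn_const))
  form z hz := isMetricForm_prod (hG.form _ hz.1) (hK.form _ hz.2) (Real.exp_pos _)

theorem metricTrace_coordWarped (hG : IsMetricOn G U) (hK : IsMetricOn K W) (hz : z ∈ U ×ˢ W)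
    {F' : Type*} [NormedAddCommGroup F'] [NormedSpace ℝ F'] (B : E × F →L[ℝ] E × F →L[ℝ] F') :
    metricTrace (coordWarped G K f z) (fun v w ↦ B v w) =
      metricTrace (G z.1) (fun v w ↦ B (v, 0) (w, 0)) +
        (Real.exp (2 * f z.1))⁻¹ • metricTrace (K z.2) (fun v w ↦ B (0, v) (0, w)) :=
  metricTrace_prod (hG.form _ hz.1) (hK.form _ hz.2) (Real.exp_pos _) B

theorem metricTrace_coordWarped_fst (hG : IsMetricOn G U) (hK : IsMetricOn K W) (hz : z ∈ U ×ˢ W)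
    {F' : Type*} [NormedAddCommGroup F'] [NormedSpace ℝ F'] (B : E →L[ℝ] E →L[ℝ] F') :
    metricTrace (coordWarped G K f z) (fun v w ↦ B v.1 w.1) =
      metricTrace (G z.1) (fun v w ↦ B v w) := by
  have h := metricTrace_coordWarped (f := f) hG hK hz
    ((ContinuousLinearMap.precomp F' (ContinuousLinearMap.fst ℝ E F)) ∘L B ∘L
      ContinuousLinearMap.fst ℝ E F)
  simp only [ContinuousLinearMap.comp_apply, ContinuousLinearMap.precomp_apply,
    ContinuousLinearMap.coe_fst'] at h
  rw [h]
  simp [metricTrace]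

theorem fderiv_coordWarped (hG : IsMetricOn G U) (hK : IsMetricOn K W) (hf : ContDiffOn ℝ ∞ f U)
    (hz : z ∈ U ×ˢ W) (a v w : E × F) :
    fderiv ℝ (coordWarped G K f) z a v w = fderiv ℝ G z.1 a.1 v.1 w.1 +
      Real.exp (2 * f z.1) *
        (2 * fderiv ℝ f z.1 a.1 * K z.2 v.2 w.2 + fderiv ℝ K z.2 a.2 v.2 w.2) := by
  rw [← fderiv_bilin_apply ((isMetricOn_coordWarped hG hK hf).differentiableAt hz)]
  have h1 : HasFDerivAt (fun z : E × F ↦ G z.1 v.1 w.1) _ z :=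
    (((hG.differentiableAt hz.1).clm_apply (differentiableAt_const v.1)).clm_apply
      (differentiableAt_const w.1)).hasFDerivAt.comp z hasFDerivAt_fst
  have h2 : HasFDerivAt (fun z : E × F ↦ K z.2 v.2 w.2) _ z :=
    (((hK.differentiableAt hz.2).clm_apply (differentiableAt_const v.2)).clm_apply
      (differentiableAt_const w.2)).hasFDerivAt.comp z hasFDerivAt_snd
  have h3 : HasFDerivAt (fun z : E × F ↦ f z.1) _ z :=
    (smoothOn_differentiableAt hf hG.isOpen hz.1).hasFDerivAt.comp z hasFDerivAt_fst
  have h4 := (h1.add ((h3.const_mul 2).exp.mul h2)).fderiv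
  have h5 : fderiv ℝ (fun z ↦ coordWarped G K f z v w) z a = _ :=
    congrArg (fun L : E × F →L[ℝ] ℝ ↦ L a) h4
  rw [h5]
  simp [fderiv_bilin_apply (hG.differentiableAt hz.1), fderiv_bilin_apply (hK.differentiableAt hz.2)]
  ring

/-- Pair with horizontal vectors `(c, 0)` in the Koszul formula: the vertical metric enters only
through the derivative of its factor `e^{2f}` in the direction `c`. -/
theorem christoffel_coordWarped_fst (hG : IsMetricOn G U) (hK : IsMetricOn K W)
    (hf : ContDiffOn ℝ ∞ f U) (hz : z ∈ U ×ˢ W) (v w : E × F) :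
    (christoffel (coordWarped G K f) z v w).1 = christoffel G z.1 v.1 w.1 -
      (Real.exp (2 * f z.1) * K z.2 v.2 w.2) • coordGrad G f z.1 := by
  refine (hG.form _ hz.1).ext fun c ↦ ?_
  have h1 := (isMetricOn_coordWarped hG hK hf).apply_christoffel hz v w (c, 0)
  simp only [fderiv_coordWarped hG hK hf hz] at h1
  simp only [coordWarped_apply, map_zero, mul_zero, add_zero, zero_apply] at h1
  rw [h1, map_sub, map_smul, sub_apply, smul_apply, hG.apply_coordGrad hz.1,
    hG.apply_christoffel hz.1, smul_eq_mul]
  ring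

/-- Tracing over the fibre brings a factor `e^{-2f}` which cancels the `e^{2f}` in the warping term,
and the trace of the fibre metric against itself is its dimension. -/
theorem metricTrace_christoffel_coordWarped_fst (hG : IsMetricOn G U) (hK : IsMetricOn K W)
    (hf : ContDiffOn ℝ ∞ f U) (hz : z ∈ U ×ˢ W) :
    (metricTrace (coordWarped G K f z) (christoffel (coordWarped G K f) z)).1 =
      metricTrace (G z.1) (christoffel G z.1) -
        (Module.finrank ℝ F : ℝ) • coordGrad G f z.1 := by
  have h0 := map_metricTrace (ContinuousLinearMap.fst ℝ E F) (coordWarped G K f z)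
    (christoffel (coordWarped G K f) z)
  simp only [ContinuousLinearMap.coe_fst', christoffel_coordWarped_fst hG hK hf hz] at h0
  rw [h0, metricTrace_sub]
  have h1 := metricTrace_coordWarped_fst (f := f) hG hK hz (christoffelMap G z.1)
  simp only [christoffelMap_apply] at h1
  rw [h1]
  congr 1
  have h2 := metricTrace_coordWarped (f := f) hG hK hz
    ((ContinuousLinearMap.compL ℝ (E × F) ℝ E
      ((ContinuousLinearMap.id ℝ ℝ).smulRight (Real.exp (2 * f z.1) • coordGrad G f z.1))) ∘L
      pullbackForm (K z.2) (ContinuousLinearMap.snd ℝ E F))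
  simp only [ContinuousLinearMap.comp_apply, ContinuousLinearMap.compL_apply, pullbackForm_apply,
    ContinuousLinearMap.coe_snd', ContinuousLinearMap.smulRight_apply,
    ContinuousLinearMap.id_apply] at h2
  simp only [smul_smul, mul_comm (K z.2 _ _)] at h2
  rw [h2]
  have h3 := map_metricTrace ((ContinuousLinearMap.id ℝ ℝ).smulRight
    (Real.exp (2 * f z.1) • coordGrad G f z.1)) (K z.2) (fun v w ↦ K z.2 v w)
  simp only [ContinuousLinearMap.smulRight_apply, ContinuousLinearMap.id_apply, smul_smul,
    mul_comm (K z.2 _ _)] at h3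
  rw [← h3, (hK.form _ hz.2).metricTrace_self, smul_smul]
  have : Real.exp (2 * f z.1) ≠ 0 := (Real.exp_pos _).ne'
  simp only [metricTrace, map_zero, mul_zero, zero_smul, Finset.sum_const_zero]
  rw [zero_add]
  congr 1
  field_simp

/-- The tension field of the projection of a warped product. -/
theorem coordTension_fst (hG : IsMetricOn G U) (hK : IsMetricOn K W) (hf : ContDiffOn ℝ ∞ f U)
    (hz : z ∈ U ×ˢ W) :
    coordTension (coordWarped G K f) G Prod.fst z =
      (Module.finrank ℝ F : ℝ) • coordGrad G f z.1 := by
  have hfst (z : E × F) : fderiv ℝ (Prod.fst : E × F → E) z = ContinuousLinearMap.fst ℝ E F :=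
    hasFDerivAt_fst.fderiv
  have h1 : coordSecondFundamentalForm (coordWarped G K f) G Prod.fst z = fun v w ↦
      -(ContinuousLinearMap.fst ℝ E F (christoffel (coordWarped G K f) z v w)) +
        christoffel G z.1 v.1 w.1 := by
    have h2 : fderiv ℝ (Prod.fst : E × F → E) = fun _ ↦ ContinuousLinearMap.fst ℝ E F := by
      ext1 z
      exact hfst z
    ext v w
    simp [coordSecondFundamentalForm, h2]
  have h3 := metricTrace_coordWarped_fst (f := f) hG hK hz (christoffelMap G z.1)
  simp only [christoffelMap_apply] at h3
  rw [coordTension, h1, metricTrace_add, h3]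
  have h4 := map_metricTrace (-ContinuousLinearMap.fst ℝ E F) (coordWarped G K f z)
    (christoffel (coordWarped G K f) z)
  simp only [neg_apply] at h4
  rw [← h4, ContinuousLinearMap.coe_fst', metricTrace_christoffel_coordWarped_fst hG hK hf hz]
  abel

/-- The derivative of the bienergy density of the projection of a warped product in the direction
of a variation field `V`. -/
def bienergyVariation (G : E → E →L[ℝ] E →L[ℝ] ℝ) (K : F → F →L[ℝ] F →L[ℝ] ℝ) (f : E → ℝ)
    (V : E × F → E) (z : E × F) : ℝ :=
  (Module.finrank ℝ F : ℝ) * (coordLaplacian (coordWarped G K f) (fun x ↦ fderiv ℝ f x.1 (V x)) z -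
    (metricTrace (G z.1) (fun a b ↦ fderiv ℝ (hessianMap G f) z.1 (V z) a b) +
      2 * metricTrace (coordWarped G K f z)
        (fun a b ↦ hessianMap G f z.1 a.1 (fderiv ℝ V z b)))) -
    (Module.finrank ℝ F : ℝ) ^ 2 / 2 * fderiv ℝ (coordGradSq G f) z.1 (V z)

/-- The bitension field of the projection of a warped product `G + e^{2f} K` onto the first factor,
as a covector and up to a constant factor. -/
def bitension (n : ℕ) (G : E → E →L[ℝ] E →L[ℝ] ℝ) (f : E → ℝ) (y w : E) : ℝ :=
  fderiv ℝ (coordLaplacian G f) y w + 2 * G y (coordRicci G y (coordGrad G f y)) w +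
    n / 2 * fderiv ℝ (coordGradSq G f) y w

/-- The vector field whose divergence is the difference between the variation of the bienergy density
and the bitension. -/
def bienergyFlux (G : E → E →L[ℝ] E →L[ℝ] ℝ) (K : F → F →L[ℝ] F →L[ℝ] ℝ) (f : E → ℝ)
    (V : E × F → E) (i : Fin (Module.finrank ℝ (E × F))) (z : E × F) : ℝ :=
  (Module.finrank ℝ F : ℝ) *
    (fderiv ℝ (fun x ↦ fderiv ℝ f x.1 (V x)) z
        (volumeDensity (coordWarped G K f z) • dualVec (coordWarped G K f z) i) -
      2 * hessianMap G f z.1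
        (volumeDensity (coordWarped G K f z) • dualVec (coordWarped G K f z) i).1 (V z))

variable {V : E × F → E}

theorem smoothOn_comp_fst {H : Type*} [NormedAddCommGroup H] [NormedSpace ℝ H] {g : E → H}
    (hg : ContDiffOn ℝ ∞ g U) : ContDiffOn ℝ ∞ (fun x : E × F ↦ g x.1) (U ×ˢ W) :=
  hg.comp contDiffOn_fst fun _ hz ↦ hz.1

theorem smooth_bienergyFlux (hG : IsMetricOn G U) (hK : IsMetricOn K W) (hf : ContDiffOn ℝ ∞ f U)
    (hV : ContDiffOn ℝ ∞ V (U ×ˢ W)) (i) :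
    ContDiffOn ℝ ∞ (bienergyFlux G K f V i) (U ×ˢ W) := by
  have hGt := isMetricOn_coordWarped hG hK hf
  have h1 := hGt.smooth_volumeDensity.smul (hGt.smooth_dualVec i)
  have h2 : ContDiffOn ℝ ∞ (fun x ↦ fderiv ℝ f x.1 (V x)) (U ×ˢ W) :=
    (smoothOn_comp_fst (smoothOn_fderiv hf hG.isOpen)).clm_apply hV
  have h3 : ContDiffOn ℝ ∞ (fun x : E × F ↦ hessianMap G f x.1) (U ×ˢ W) :=
    smoothOn_comp_fst (hG.smooth_hessianMap hf)
  exact contDiffOn_const.mul (((smoothOn_fderiv h2 hGt.isOpen).clm_apply h1).sub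
    (contDiffOn_const.mul ((h3.clm_apply (contDiff_fst.comp_contDiffOn h1)).clm_apply hV)))

/-- The variation of the bienergy density is the sum of a divergence and the bitension. -/
theorem sum_fderiv_bienergyFlux (hG : IsMetricOn G U) (hK : IsMetricOn K W)
    (hf : ContDiffOn ℝ ∞ f U) (hV : ContDiffOn ℝ ∞ V (U ×ˢ W)) (hz : z ∈ U ×ˢ W) :
    ∑ i, fderiv ℝ (bienergyFlux G K f V i) z (Module.finBasis ℝ (E × F) i) =
      volumeDensity (coordWarped G K f z) * bienergyVariation G K f V z -
        volumeDensity (coordWarped G K f z) * Module.finrank ℝ F *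
          bitension (Module.finrank ℝ F) G f z.1 (V z) := by
  have hGt := isMetricOn_coordWarped hG hK hf
  set β : Fin (Module.finrank ℝ (E × F)) → E × F → E × F := fun i z ↦
    volumeDensity (coordWarped G K f z) • dualVec (coordWarped G K f z) i with hβ
  set ρ := volumeDensity (coordWarped G K f z) with hρ
  set B := hessianMap G f with hB
  set h : E × F → ℝ := fun x ↦ fderiv ℝ f x.1 (V x) with hh
  have hβs (i) : DifferentiableAt ℝ (β i) z := smoothOn_differentiableAt
    (hGt.smooth_volumeDensity.smul (hGt.smooth_dualVec i)) hGt.isOpen hz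
  have hhs : ContDiffOn ℝ ∞ h (U ×ˢ W) :=
    (smoothOn_comp_fst (smoothOn_fderiv hf hG.isOpen)).clm_apply hV
  have hh1 := smoothOn_differentiableAt (smoothOn_fderiv hhs hGt.isOpen) hGt.isOpen hz
  have hB1 := smoothOn_differentiableAt (hG.smooth_hessianMap hf) hG.isOpen hz.1
  have hBc : HasFDerivAt (fun x : E × F ↦ B x.1)
      (fderiv ℝ B z.1 ∘L ContinuousLinearMap.fst ℝ E F) z := hB1.hasFDerivAt.comp z hasFDerivAt_fst
  have hV1 := smoothOn_differentiableAt hV hGt.isOpen hz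
  have hβ1 (i) : HasFDerivAt (fun x ↦ (β i x).1)
      (ContinuousLinearMap.fst ℝ E F ∘L fderiv ℝ (β i) z) z := (hβs i).hasFDerivAt.fst
  have hd (i) (a : E × F) : fderiv ℝ (bienergyFlux G K f V i) z a =
      (Module.finrank ℝ F : ℝ) * ((fderiv ℝ (fderiv ℝ h) z a (β i z) +
        fderiv ℝ h z (fderiv ℝ (β i) z a)) - 2 * (fderiv ℝ B z.1 a.1 (β i z).1 (V z) +
        B z.1 (fderiv ℝ (β i) z a).1 (V z) + B z.1 (β i z).1 (fderiv ℝ V z a))) := by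
    have h1 := (((hh1.hasFDerivAt.clm_apply (hβs i).hasFDerivAt).sub
      (((hBc.clm_apply (hβ1 i)).clm_apply hV1.hasFDerivAt).const_mul 2)).const_mul
        (Module.finrank ℝ F : ℝ)).fderiv
    have h2 : fderiv ℝ (bienergyFlux G K f V i) z a = _ :=
      congrArg (fun L : E × F →L[ℝ] ℝ ↦ L a) h1
    rw [h2]
    simp only [smul_apply, sub_apply, add_apply, ContinuousLinearMap.comp_apply,
      ContinuousLinearMap.flip_apply, ContinuousLinearMap.coe_fst', smul_eq_mul]
    ring
  have hdiv : ∑ i, fderiv ℝ (β i) z (Module.finBasis ℝ (E × F) i) =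
      -(ρ • metricTrace (coordWarped G K f z) (christoffel (coordWarped G K f) z)) :=
    hGt.sum_fderiv_volumeDensity_dualVec hz
  have e1 : ∑ i, fderiv ℝ (fderiv ℝ h) z (Module.finBasis ℝ (E × F) i) (β i z) +
      fderiv ℝ h z (∑ i, fderiv ℝ (β i) z (Module.finBasis ℝ (E × F) i)) =
      ρ * coordLaplacian (coordWarped G K f) h z := by
    have h1 : coordLaplacian (coordWarped G K f) h z =
        metricTrace (coordWarped G K f z) (fun v w ↦ fderiv ℝ (fderiv ℝ h) z v w) -
        fderiv ℝ h z (metricTrace (coordWarped G K f z) (christoffel (coordWarped G K f) z)) := by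
      rw [map_metricTrace, ← metricTrace_sub]
      rfl
    rw [hdiv, h1, metricTrace_eq_sum _ (fun v w ↦ fderiv ℝ (fderiv ℝ h) z v w), mul_sub, Finset.mul_sum, map_neg, map_smul, smul_eq_mul,
      ← sub_eq_add_neg]
    simp [hβ, hρ]
  have e2 : ∑ i, fderiv ℝ B z.1 (Module.finBasis ℝ (E × F) i).1 (β i z).1 (V z) =
      ρ * metricTrace (G z.1) (fun a b ↦ fderiv ℝ B z.1 a b (V z)) := by
    have h1 := metricTrace_coordWarped_fst (f := f) hG hK hz
      ((ContinuousLinearMap.compL ℝ E (E →L[ℝ] ℝ) ℝ (ContinuousLinearMap.apply ℝ ℝ (V z))) ∘L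
        fderiv ℝ B z.1)
    simp only [ContinuousLinearMap.comp_apply, ContinuousLinearMap.compL_apply,
      ContinuousLinearMap.apply_apply] at h1
    rw [← h1, metricTrace_eq_sum, Finset.mul_sum]
    simp [hβ, hρ]
  -- The warping term in the trace gives `-2n²ρ Hess(grad f, V) = -n²ρ d|grad f|²(V)` in the
  -- divergence; one half of it belongs to `bienergyVariation`, the other to `bitension`.
  have e3 : B z.1 (∑ i, fderiv ℝ (β i) z (Module.finBasis ℝ (E × F) i)).1 (V z) =
      -(ρ * (B z.1 (metricTrace (G z.1) (christoffel G z.1)) (V z) -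
        Module.finrank ℝ F * B z.1 (coordGrad G f z.1) (V z))) := by
    rw [hdiv, Prod.fst_neg, Prod.smul_fst, metricTrace_christoffel_coordWarped_fst hG hK hf hz]
    simp
  have e4 : ∑ i, B z.1 (β i z).1 (fderiv ℝ V z (Module.finBasis ℝ (E × F) i)) =
      ρ * metricTrace (coordWarped G K f z) (fun a b ↦ B z.1 a.1 (fderiv ℝ V z b)) := by
    have h1 := (hGt.form z hz).metricTrace_flip
      ((ContinuousLinearMap.precomp ℝ (fderiv ℝ V z)) ∘L B z.1 ∘L ContinuousLinearMap.fst ℝ E F)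
    simp only [ContinuousLinearMap.comp_apply, ContinuousLinearMap.precomp_apply,
      ContinuousLinearMap.coe_fst'] at h1
    rw [← h1, metricTrace_eq_sum, Finset.mul_sum]
    simp [hβ, hρ]
  have e5 := hG.bochner hf hz.1 (V z)
  have e6 := hG.fderiv_coordGradSq hf hz.1 (V z)
  rw [hG.coordHessian_symm hf hz.1] at e6
  simp only [hd, ← Finset.mul_sum, Finset.sum_sub_distrib, Finset.sum_add_distrib]
  rw [← map_sum, e1, e2, e4]
  have e7 : ∑ i, B z.1 (fderiv ℝ (β i) z (Module.finBasis ℝ (E × F) i)).1 (V z) =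
      B z.1 (∑ i, fderiv ℝ (β i) z (Module.finBasis ℝ (E × F) i)).1 (V z) := by
    rw [Prod.fst_sum, map_sum, sum_apply]
  rw [e7, e3, bienergyVariation, bitension]
  simp only [hB, hessianMap_apply] at e5 ⊢
  rw [e6]
  -- What remains is the Bochner identity, scaled by `nρ`.
  linear_combination (Module.finrank ℝ F : ℝ) * ρ * (-e5)

end WarpedCoordinates

/-! ### First variation of the bienergy density -/

section FirstVariation

variable {E : Type*} [NormedAddCommGroup E] [NormedSpace ℝ E] [FiniteDimensional ℝ E]
  {F : Type*} [NormedAddCommGroup F] [NormedSpace ℝ F] [FiniteDimensional ℝ F]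
  {G : E → E →L[ℝ] E →L[ℝ] ℝ} {U : Set E} {K : F → F →L[ℝ] F →L[ℝ] ℝ} {W : Set F}
  {f : E → ℝ} {z : E × F} {u : ℝ → E × F → E} {O : Set (ℝ × (E × F))}

/-- By the product rule every term of the derivative contains `k t = 0`. This removes the square of
the difference between the tension field and `n grad f` from the first variation. -/
theorem hasDerivAt_bilin_self_of_eq_zero {X : Type*} [NormedAddCommGroup X] [NormedSpace ℝ X]
    {B : ℝ → X →L[ℝ] X →L[ℝ] ℝ} {k : ℝ → X} {t : ℝ} (hB : DifferentiableAt ℝ B t)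
    (hk : DifferentiableAt ℝ k t) (h0 : k t = 0) : HasDerivAt (fun s ↦ B s (k s) (k s)) 0 t := by
  refine ((hB.hasDerivAt.clm_apply hk.hasDerivAt).clm_apply hk.hasDerivAt).congr_deriv ?_
  simp [h0]

theorem hasDerivAt_comp_smoothOn {H : Type*} [NormedAddCommGroup H] [NormedSpace ℝ H]
    (hU : IsOpen U) {c : ℝ → E} {c' x : E} {t : ℝ} (hc : HasDerivAt c c' t) (hx : c t = x)
    (hxU : x ∈ U) {g : E → H} (hg : ContDiffOn ℝ ∞ g U) :
    HasDerivAt (fun s ↦ g (c s)) (fderiv ℝ g x c') t := by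
  subst hx
  exact (smoothOn_differentiableAt hg hU hxU).hasFDerivAt.comp_hasDerivAt t hc

/-- The first variation of the bienergy density at the projection of a warped product. -/
theorem hasDerivAt_normSq_coordTension (hG : IsMetricOn G U) (hK : IsMetricOn K W)
    (hf : ContDiffOn ℝ ∞ f U) (hu : SmoothFamilyOn u O) (hO : IsOpen O)
    (h1 : ∀ q ∈ O, q.2 ∈ U ×ˢ W) (h2 : ∀ q ∈ O, u q.1 q.2 ∈ U) (h0 : (0, z) ∈ O)
    (hu0 : u 0 =ᶠ[𝓝 z] Prod.fst) :
    HasDerivAt (fun t ↦ 1 / 2 * G (u t z) (coordTension (coordWarped G K f) G (u t) z)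
        (coordTension (coordWarped G K f) G (u t) z))
      (bienergyVariation G K f (fun x ↦ deriv (fun t ↦ u t x) 0) z) 0 := by
  set n : ℝ := (Module.finrank ℝ F : ℝ) with hn
  set Gt := coordWarped G K f with hGt'
  have hGt : IsMetricOn Gt (U ×ˢ W) := isMetricOn_coordWarped hG hK hf
  have hz := h1 _ h0
  have hO' : ∀ᶠ t in 𝓝 (0 : ℝ), (t, z) ∈ O :=
    (hO.preimage (by fun_prop : Continuous fun s : ℝ ↦ (s, z))).mem_nhds h0
  have hu0z : u 0 z = z.1 := hu0.self_of_nhds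
  set V : E × F → E := fun x ↦ deriv (fun t ↦ u t x) 0 with hV
  have hud : HasDerivAt (fun t ↦ u t z) (V z) 0 := (hu.differentiableAt hO h0).hasDerivAt
  have hDu : HasDerivAt (fun t ↦ fderiv ℝ (u t) z) (fderiv ℝ V z) 0 := hu.hasDerivAt_fderiv hO h0
  have hDu0 : fderiv ℝ (u 0) z = ContinuousLinearMap.fst ℝ E F := by
    rw [hu0.fderiv_eq]
    exact hasFDerivAt_fst.fderiv
  have hτ : DifferentiableAt ℝ (fun t ↦ coordTension Gt G (u t) z) 0 :=
    (hu.coordTension hO hGt hG h1 h2).differentiableAt hO h0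
  have hτ0 : coordTension Gt G (u 0) z = n • coordGrad G f z.1 := by
    have h3 : coordSecondFundamentalForm Gt G (u 0) z =
        coordSecondFundamentalForm Gt G Prod.fst z := by
      ext v w
      simp only [coordSecondFundamentalForm]
      rw [hu0.fderiv_eq, hu0.fderiv.fderiv_eq, hu0z]
    rw [coordTension, h3]
    exact coordTension_fst hG hK hf hz
  have hξ := hasDerivAt_comp_smoothOn hG.isOpen hud hu0z hz.1 (hG.smooth_coordGrad hf)
  -- the square of the difference between the tension field and the extended vector field
  have d1 : HasDerivAt (fun t ↦ G (u t z)
      (coordTension Gt G (u t) z - n • coordGrad G f (u t z))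
      (coordTension Gt G (u t) z - n • coordGrad G f (u t z))) 0 0 := by
    refine hasDerivAt_bilin_self_of_eq_zero (hasDerivAt_comp_smoothOn hG.isOpen hud hu0z hz.1 hG.smooth).differentiableAt
      (hτ.sub (hξ.differentiableAt.const_smul n)) ?_
    rw [hτ0, hu0z, sub_self]
  have d2 := hasDerivAt_comp_smoothOn hG.isOpen hud hu0z hz.1 (hG.smooth_coordGradSq hf)
  -- the trace of the pull-back of the Hessian
  have d3 : HasDerivAt (fun t ↦ metricTrace (Gt z)
      (fun a b ↦ hessianMap G f (u t z) (fderiv ℝ (u t) z a) (fderiv ℝ (u t) z b)))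
      (metricTrace (G z.1) (fun a b ↦ fderiv ℝ (hessianMap G f) z.1 (V z) a b) +
      2 * metricTrace (Gt z) (fun a b ↦ hessianMap G f z.1 a.1 (fderiv ℝ V z b))) 0 := by
    have h3 := hasDerivAt_comp_smoothOn hG.isOpen hud hu0z hz.1 (hG.smooth_hessianMap hf)
    have h4 : HasDerivAt (fun t ↦ metricTrace (Gt z)
        (fun a b ↦ hessianMap G f (u t z) (fderiv ℝ (u t) z a) (fderiv ℝ (u t) z b)))
        (metricTrace (Gt z) (fun a b ↦ fderiv ℝ (hessianMap G f) z.1 (V z) a.1 b.1 +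
          hessianMap G f z.1 (fderiv ℝ V z a) b.1 +
          hessianMap G f z.1 a.1 (fderiv ℝ V z b))) 0 := by
      simp only [metricTrace_eq_sum]
      refine HasDerivAt.fun_sum fun i _ ↦ ?_
      have ha (a : E × F) : HasDerivAt (fun t ↦ fderiv ℝ (u t) z a) (fderiv ℝ V z a) 0 := by
        simpa using hDu.clm_apply (hasDerivAt_const 0 a)
      refine ((h3.clm_apply (ha _)).clm_apply (ha _)).congr_deriv ?_
      simp only [hu0z, hDu0, ContinuousLinearMap.coe_fst', add_apply]
    refine h4.congr_deriv ?_
    rw [metricTrace_add, metricTrace_add, metricTrace_coordWarped_fst hG hK hz]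
    have h5 := (hGt.form z hz).metricTrace_flip
      ((ContinuousLinearMap.precomp ℝ (fderiv ℝ V z)) ∘L hessianMap G f z.1 ∘L
        ContinuousLinearMap.fst ℝ E F)
    simp only [ContinuousLinearMap.comp_apply, ContinuousLinearMap.precomp_apply,
      ContinuousLinearMap.coe_fst'] at h5
    have h6 : metricTrace (Gt z) (fun a b ↦ hessianMap G f z.1 (fderiv ℝ V z a) b.1) =
        metricTrace (Gt z) (fun a b ↦ hessianMap G f z.1 b.1 (fderiv ℝ V z a)) := by
      congr 1
      ext a b
      exact hG.coordHessian_symm hf hz.1 _ _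
    rw [h6, h5]
    ring
  -- the Laplacian of the composition with `f`
  have d4 : HasDerivAt (fun t ↦ coordLaplacian Gt (f ∘ u t) z)
      (coordLaplacian Gt (fun x ↦ fderiv ℝ f x.1 (V x)) z) 0 := by
    have hfu : SmoothFamilyOn (fun t ↦ f ∘ u t) O := hu.comp hf h2
    have h3 := hfu.hasDerivAt_fderiv hO h0
    have h4 := hfu.hasDerivAt_fderiv_fderiv hO h0
    have h5 : (fun z' ↦ deriv (fun s ↦ (f ∘ u s) z') 0) =ᶠ[𝓝 z]
        fun x ↦ fderiv ℝ f x.1 (V x) := by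
      filter_upwards [hu0, (hO.preimage (by fun_prop :
        Continuous fun z' : E × F ↦ ((0 : ℝ), z'))).mem_nhds h0] with x hx hx'
      have h6 : HasFDerivAt f (fderiv ℝ f x.1) (u 0 x) := by
        rw [hx]
        exact (smoothOn_differentiableAt hf hG.isOpen (h1 _ hx').1).hasFDerivAt
      exact (h6.comp_hasDerivAt 0 (hu.differentiableAt hO hx').hasDerivAt).deriv
    rw [h5.fderiv_eq] at h3
    rw [h5.fderiv.fderiv_eq] at h4
    simp only [coordLaplacian, coordHessian, metricTrace_eq_sum]
    refine HasDerivAt.fun_sum fun i _ ↦ ?_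
    refine (((h4.clm_apply (hasDerivAt_const 0 _)).clm_apply (hasDerivAt_const 0 _)).sub
      (h3.clm_apply (hasDerivAt_const 0 _))).congr_deriv ?_
    simp
  -- Complete the square around `ξ = n grad f`, then replace `⟨τ(u), grad f⟩ = df(τ(u))` using the
  -- composition law for Hessians.
  have key : (fun t ↦ 1 / 2 * G (u t z) (coordTension Gt G (u t) z)
      (coordTension Gt G (u t) z)) =ᶠ[𝓝 0] fun t ↦
      1 / 2 * G (u t z) (coordTension Gt G (u t) z - n • coordGrad G f (u t z))
        (coordTension Gt G (u t) z - n • coordGrad G f (u t z)) +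
      n * (coordLaplacian Gt (f ∘ u t) z - metricTrace (Gt z)
        (fun a b ↦ hessianMap G f (u t z) (fderiv ℝ (u t) z a) (fderiv ℝ (u t) z b))) -
      n ^ 2 / 2 * coordGradSq G f (u t z) := by
    filter_upwards [hO'] with t ht
    have hU := h2 _ ht
    have h3 : coordLaplacian Gt (f ∘ u t) z = fderiv ℝ f (u t z) (coordTension Gt G (u t) z) +
        metricTrace (Gt z)
          (fun a b ↦ hessianMap G f (u t z) (fderiv ℝ (u t) z a) (fderiv ℝ (u t) z b)) := by
      rw [coordTension, map_metricTrace, ← metricTrace_add]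
      unfold coordLaplacian
      congr 1
      ext a b
      exact coordHessian_comp Gt G (contDiffAt_two_of_smoothOn hf hG.isOpen hU)
        ((hu.contDiffAt_slice hO ht).of_le
          (by simpa using WithTop.coe_le_coe.2 (le_top : (2 : ℕ∞) ≤ ⊤))) a b
    have h4 : G (u t z) (coordGrad G f (u t z)) (coordGrad G f (u t z)) =
        coordGradSq G f (u t z) := hG.apply_coordGrad hU _
    have h5 := (hG.form _ hU).symm (coordTension Gt G (u t) z) (coordGrad G f (u t z))
    rw [hG.apply_coordGrad hU] at h5
    rw [h3]
    simp only [map_sub, map_smul, sub_apply, smul_apply, smul_eq_mul, h4, h5,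
      hG.apply_coordGrad hU]
    ring
  refine HasDerivAt.congr_of_eventuallyEq ?_ key
  refine (((d1.const_mul (1 / 2)).add ((d4.sub d3).const_mul n)).sub
    (d2.const_mul (n ^ 2 / 2))).congr_deriv ?_
  rw [bienergyVariation]
  ring

/-- Linearity of the first variation in the variation field. -/
theorem bienergyVariation_sum (hG : IsMetricOn G U) (hK : IsMetricOn K W)
    (hf : ContDiffOn ℝ ∞ f U) (hz : z ∈ U ×ˢ W) {ι : Type*} (s : Finset ι) {V : ι → E × F → E}
    (hV : ∀ i ∈ s, ContDiffOn ℝ ∞ (V i) (U ×ˢ W)) :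
    bienergyVariation G K f (fun x ↦ ∑ i ∈ s, V i x) z =
      ∑ i ∈ s, bienergyVariation G K f (V i) z := by
  have hGt := isMetricOn_coordWarped hG hK hf
  have h1 (x) (hx : x ∈ U ×ˢ W) : fderiv ℝ (fun x ↦ ∑ i ∈ s, V i x) x =
      ∑ i ∈ s, fderiv ℝ (V i) x :=
    fderiv_fun_sum fun i hi ↦ smoothOn_differentiableAt (hV i hi) hGt.isOpen hx
  have hh (i) (hi : i ∈ s) : ContDiffOn ℝ ∞ (fun x ↦ fderiv ℝ f x.1 (V i x)) (U ×ˢ W) :=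
    (smoothOn_comp_fst (smoothOn_fderiv hf hG.isOpen)).clm_apply (hV i hi)
  have h2 (x) (hx : x ∈ U ×ˢ W) : fderiv ℝ (fun x ↦ ∑ i ∈ s, fderiv ℝ f x.1 (V i x)) x =
      ∑ i ∈ s, fderiv ℝ (fun x ↦ fderiv ℝ f x.1 (V i x)) x :=
    fderiv_fun_sum fun i hi ↦ smoothOn_differentiableAt (hh i hi) hGt.isOpen hx
  have h3 : fderiv ℝ (fderiv ℝ (fun x ↦ ∑ i ∈ s, fderiv ℝ f x.1 (V i x))) z =
      ∑ i ∈ s, fderiv ℝ (fderiv ℝ (fun x ↦ fderiv ℝ f x.1 (V i x))) z := by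
    have h4 : fderiv ℝ (fun x ↦ ∑ i ∈ s, fderiv ℝ f x.1 (V i x)) =ᶠ[𝓝 z]
        fun x ↦ ∑ i ∈ s, fderiv ℝ (fun x ↦ fderiv ℝ f x.1 (V i x)) x := by
      filter_upwards [hGt.isOpen.mem_nhds hz] with x hx
      exact h2 x hx
    rw [h4.fderiv_eq]
    exact fderiv_fun_sum fun i hi ↦ smoothOn_differentiableAt
      (smoothOn_fderiv (hh i hi) hGt.isOpen) hGt.isOpen hz
  simp only [bienergyVariation, coordLaplacian, coordHessian, metricTrace_eq_sum, map_sum, h1 z hz,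
    h2 z hz, h3, sum_apply, Finset.mul_sum, Finset.sum_add_distrib, Finset.sum_sub_distrib, mul_sub,
    mul_add, Finset.sum_comm (s := (Finset.univ : Finset (Fin _))) (t := s)]

end FirstVariation

/-! ### Integration by parts -/

section Integration

variable {X : Type*} [NormedAddCommGroup X] [NormedSpace ℝ X]
  {Y : Type*} [NormedAddCommGroup Y] [NormedSpace ℝ Y]

/-- A point outside `S` has a neighbourhood missing the closed set `K`, on which the extension by
zero vanishes. -/
theorem contDiff_indicator {g : X → Y} {S K : Set X} (hS : IsOpen S) (hK : IsCompact K)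
    (hKS : K ⊆ S) (hg : ContDiffOn ℝ ∞ g S) (h0 : ∀ z ∈ S, z ∉ K → g z = 0) :
    ContDiff ℝ ∞ (S.indicator g) := by
  rw [contDiff_iff_contDiffAt]
  intro z
  by_cases hz : z ∈ S
  · refine (hg.contDiffAt (hS.mem_nhds hz)).congr_of_eventuallyEq ?_
    filter_upwards [hS.mem_nhds hz] with x hx
    exact indicator_of_mem hx g
  · refine (contDiffAt_const (c := (0 : Y))).congr_of_eventuallyEq ?_
    filter_upwards [hK.isClosed.isOpen_compl.mem_nhds fun h ↦ hz (hKS h)] with x hx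
    by_cases hxS : x ∈ S
    · rw [indicator_of_mem hxS, h0 x hxS hx]
    · exact indicator_of_notMem hxS g

theorem hasCompactSupport_indicator {g : X → Y} {S K : Set X} (hK : IsCompact K)
    (h0 : ∀ z ∈ S, z ∉ K → g z = 0) : HasCompactSupport (S.indicator g) := by
  refine HasCompactSupport.intro hK fun z hz ↦ ?_
  by_cases hzS : z ∈ S
  · rw [indicator_of_mem hzS, h0 z hzS hz]
  · exact indicator_of_notMem hzS g

variable [FiniteDimensional ℝ X] [MeasurableSpace X] [BorelSpace X] {μ : Measure X}
  [μ.IsAddHaarMeasure]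

theorem integrable_fderiv_apply {g : X → ℝ} (hg : ContDiff ℝ ∞ g) (hc : HasCompactSupport g)
    (v : X) : Integrable (fun z ↦ fderiv ℝ g z v) μ :=
  ((hg.continuous_fderiv (by simp)).clm_apply continuous_const).integrable_of_hasCompactSupport
    (hc.fderiv_apply ℝ v)

/-- Integration by parts against the constant function `1`. -/
theorem integral_fderiv_apply_eq_zero {g : X → ℝ} (hg : ContDiff ℝ ∞ g)
    (hc : HasCompactSupport g) (v : X) : ∫ z, fderiv ℝ g z v ∂μ = 0 := by
  have h := integral_bilinear_hasFDerivAt_right_eq_neg_left_of_integrable (μ := μ)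
    (f := fun _ : X ↦ (1 : ℝ)) (f' := fun _ ↦ 0) (g := g) (g' := fderiv ℝ g) (v := v)
    (B := ContinuousLinearMap.mul ℝ ℝ) (by simp)
    (by simpa using integrable_fderiv_apply hg hc v)
    (by simpa using hg.continuous.integrable_of_hasCompactSupport hc)
    (fun x _ ↦ hasFDerivAt_const _ _) (fun x _ ↦ (hg.differentiable (by simp) x).hasFDerivAt)
  simpa using h

end Integration

/-! ### The first variation integrated over a coordinate domain -/

section WarpedIntegration

variable {E : Type*} [NormedAddCommGroup E] [NormedSpace ℝ E] [FiniteDimensional ℝ E]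
  {F : Type*} [NormedAddCommGroup F] [NormedSpace ℝ F] [FiniteDimensional ℝ F]
  {G : E → E →L[ℝ] E →L[ℝ] ℝ} {U : Set E} {K : F → F →L[ℝ] F →L[ℝ] ℝ} {W : Set F}
  {f : E → ℝ}

theorem IsMetricOn.smooth_coordRicci (hG : IsMetricOn G U) {X : E → E}
    (hX : ContDiffOn ℝ ∞ X U) : ContDiffOn ℝ ∞ (fun y ↦ coordRicci G y (X y)) U := by
  have hΓ := hG.smooth_christoffelMap
  have hdΓ := smoothOn_fderiv hΓ hG.isOpen
  have hdΓ' : ContDiffOn ℝ ∞ (fun y ↦ (fderiv ℝ (christoffelMap G) y).flip) U :=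
    (ContinuousLinearMap.flipₗᵢ ℝ E E (E →L[ℝ] E)).toContinuousLinearEquiv.contDiff.comp_contDiffOn
      hdΓ
  have hΓX := hΓ.clm_apply hX
  have h1 : ContDiffOn ℝ ∞ (fun y ↦ curvatureMap G y (X y)) U := by
    refine ((((hdΓ.clm_apply hX).sub (hdΓ'.clm_apply hX)).add (ContDiffOn.clm_comp ?_ hΓ))).sub
      (ContDiffOn.clm_comp ?_ hΓ)
    · exact (ContinuousLinearMap.compL ℝ E E E).contDiff.comp_contDiffOn hΓX
    · exact ((ContinuousLinearMap.compL ℝ E E E).flip.contDiff).comp_contDiffOn hΓX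
  exact (hG.smooth_metricTrace h1).congr fun y hy ↦ hG.coordRicci_eq hy _

theorem IsMetricOn.smooth_bitension (hG : IsMetricOn G U) (hf : ContDiffOn ℝ ∞ f U) (n : ℕ)
    {X : Type*} [NormedAddCommGroup X] [NormedSpace ℝ X] {S : Set X} {p V : X → E}
    (hp : ContDiffOn ℝ ∞ p S) (hpU : MapsTo p S U) (hV : ContDiffOn ℝ ∞ V S) :
    ContDiffOn ℝ ∞ (fun x ↦ bitension n G f (p x) (V x)) S := by
  have h1 := (smoothOn_fderiv (hG.smooth_coordLaplacian hf) hG.isOpen).comp hp hpU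
  have h2 := (hG.smooth.clm_apply (hG.smooth_coordRicci (hG.smooth_coordGrad hf))).comp hp hpU
  have h3 := (smoothOn_fderiv (hG.smooth_coordGradSq hf) hG.isOpen).comp hp hpU
  exact ((h1.clm_apply hV).add (contDiffOn_const.mul (h2.clm_apply hV))).add
    (contDiffOn_const.mul (h3.clm_apply hV))

theorem bitension_zero_right (n : ℕ) (G : E → E →L[ℝ] E →L[ℝ] ℝ) (f : E → ℝ) (y : E) :
    bitension n G f y 0 = 0 := by
  simp [bitension]

theorem bienergyFlux_eq_zero {V : E × F → E} {z : E × F} (hV : V =ᶠ[𝓝 z] 0) (i) :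
    bienergyFlux G K f V i z = 0 := by
  have h1 : (fun x ↦ fderiv ℝ f x.1 (V x)) =ᶠ[𝓝 z] fun _ ↦ 0 := by
    filter_upwards [hV] with x hx
    simp [hx]
  simp [bienergyFlux, h1.fderiv_eq, hV.self_of_nhds]

variable [MeasurableSpace E] [BorelSpace E] [MeasurableSpace F] [BorelSpace F]
  {μ : Measure (E × F)} [μ.IsAddHaarMeasure]

/-- The first variation formula in coordinates. -/
theorem setIntegral_bienergyVariation (hG : IsMetricOn G U) (hK : IsMetricOn K W)
    (hf : ContDiffOn ℝ ∞ f U) {V : E × F → E} (hV : ContDiffOn ℝ ∞ V (U ×ˢ W)) {C : Set (E × F)}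
    (hC : IsCompact C) (hCU : C ⊆ U ×ˢ W) (h0 : ∀ z ∈ U ×ˢ W, z ∉ C → V z = 0) :
    ∫ z in U ×ˢ W, volumeDensity (coordWarped G K f z) * bienergyVariation G K f V z ∂μ =
      ∫ z in U ×ˢ W, volumeDensity (coordWarped G K f z) * Module.finrank ℝ F *
          bitension (Module.finrank ℝ F) G f z.1 (V z) ∂μ := by
  have hGt := isMetricOn_coordWarped hG hK hf
  have hev (z) (hz : z ∈ U ×ˢ W) (hzC : z ∉ C) : V =ᶠ[𝓝 z] 0 := by
    filter_upwards [hGt.isOpen.mem_nhds hz, hC.isClosed.isOpen_compl.mem_nhds hzC] with x hx hx'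
    exact h0 x hx hx'
  set φ : Fin (Module.finrank ℝ (E × F)) → E × F → ℝ := fun i ↦
    (U ×ˢ W).indicator (bienergyFlux G K f V i) with hφ
  have hφ0 (i) : ∀ z ∈ U ×ˢ W, z ∉ C → bienergyFlux G K f V i z = 0 := fun z hz hzC ↦
    bienergyFlux_eq_zero (hev z hz hzC) i
  have hφ1 (i) : ContDiff ℝ ∞ (φ i) := contDiff_indicator hGt.isOpen hC hCU
    (smooth_bienergyFlux hG hK hf hV i) (hφ0 i)
  have hφ2 (i) : HasCompactSupport (φ i) := hasCompactSupport_indicator hC (hφ0 i)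
  set b : E × F → ℝ := (U ×ˢ W).indicator fun z ↦ volumeDensity (coordWarped G K f z) *
    Module.finrank ℝ F * bitension (Module.finrank ℝ F) G f z.1 (V z) with hb
  have hb0 : ∀ z ∈ U ×ˢ W, z ∉ C → volumeDensity (coordWarped G K f z) *
      Module.finrank ℝ F * bitension (Module.finrank ℝ F) G f z.1 (V z) = 0 := fun z hz hzC ↦ by
    rw [h0 z hz hzC, bitension_zero_right, mul_zero]
  have hb1 : ContDiff ℝ ∞ b := contDiff_indicator hGt.isOpen hC hCU
    ((hGt.smooth_volumeDensity.mul contDiffOn_const).mul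
      (hG.smooth_bitension hf _ contDiffOn_fst (fun z hz ↦ hz.1) hV)) hb0
  have hb2 : Integrable b μ := hb1.continuous.integrable_of_hasCompactSupport
    (hasCompactSupport_indicator hC hb0)
  have hms := hGt.isOpen.measurableSet
  rw [← integral_indicator hms, ← integral_indicator hms]
  -- On the coordinate domain this is the divergence formula; outside it all terms vanish near the
  -- point, since it lies off the compact set `C`. The identity can thus be integrated over the
  -- whole vector space.
  have key : (U ×ˢ W).indicator (fun z ↦ volumeDensity (coordWarped G K f z) *
      bienergyVariation G K f V z) =
      fun z ↦ ∑ i, fderiv ℝ (φ i) z (Module.finBasis ℝ (E × F) i) + b z := by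
    ext z
    by_cases hz : z ∈ U ×ˢ W
    · have h1 (i) : φ i =ᶠ[𝓝 z] bienergyFlux G K f V i := by
        filter_upwards [hGt.isOpen.mem_nhds hz] with x hx
        exact indicator_of_mem hx _
      simp only [(h1 _).fderiv_eq]
      rw [sum_fderiv_bienergyFlux hG hK hf hV hz, hb, indicator_of_mem hz, indicator_of_mem hz]
      ring
    · have h1 (i) : φ i =ᶠ[𝓝 z] fun _ ↦ 0 := by
        filter_upwards [hC.isClosed.isOpen_compl.mem_nhds fun h ↦ hz (hCU h)] with x hx
        by_cases hxU : x ∈ U ×ˢ W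
        · rw [hφ]
          exact (indicator_of_mem hxU _).trans (hφ0 i x hxU hx)
        · exact indicator_of_notMem hxU _
      simp only [(h1 _).fderiv_eq]
      rw [hb, indicator_of_notMem hz, indicator_of_notMem hz]
      simp
  rw [key, integral_add (integrable_finsetSum _ fun i _ ↦ integrable_fderiv_apply (hφ1 i) (hφ2 i) _)
    hb2, integral_finsetSum _ fun i _ ↦ integrable_fderiv_apply (hφ1 i) (hφ2 i) _]
  simp [integral_fderiv_apply_eq_zero (hφ1 _) (hφ2 _), hb]

end WarpedIntegration

/-! ### Charts -/

section Charts

variable {E : Type*} [NormedAddCommGroup E] [NormedSpace ℝ E] [FiniteDimensional ℝ E]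
  {H : Type*} [TopologicalSpace H] {I : ModelWithCorners ℝ E H} [I.Boundaryless]
  {M : Type*} [TopologicalSpace M] [ChartedSpace H M] [IsManifold I ∞ M]

theorem contMDiffAt_extChartAt_symm {x : M} {y : E} (hy : y ∈ (extChartAt I x).target) :
    ContMDiffAt 𝓘(ℝ, E) I ∞ (extChartAt I x).symm y :=
  (contMDiffOn_extChartAt_symm x).contMDiffAt ((isOpen_extChartAt_target x).mem_nhds hy)

theorem mdifferentiableAt_extChartAt_symm {x : M} {y : E} (hy : y ∈ (extChartAt I x).target) :
    MDifferentiableAt 𝓘(ℝ, E) I (extChartAt I x).symm y :=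
  (contMDiffAt_extChartAt_symm hy).mdifferentiableAt (by simp)

/-- The derivative of the inverse of a chart, as an endomorphism of the model space. -/
def chartFrame (I : ModelWithCorners ℝ E H) (x : M) (y : E) : E →L[ℝ] E :=
  mfderiv 𝓘(ℝ, E) I (extChartAt I x).symm y

theorem bijective_chartFrame {x : M} {y : E} (hy : y ∈ (extChartAt I x).target) :
    Function.Bijective (chartFrame I x y) := by
  have h := isInvertible_mfderivWithin_extChartAt_symm (I := I) hy
  rw [I.range_eq_univ, mfderivWithin_univ] at h
  exact h.bijective

/-- The tangent space at `x` is the model space read in the chart preferred at `x`, so the frame of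
that chart is the identity at its base point. At other points it need not be. -/
theorem chartFrame_self (x : M) :
    chartFrame I x (extChartAt I x x) = ContinuousLinearMap.id ℝ E := by
  have h := mfderivWithin_range_extChartAt_symm (I := I) (x := x)
  rw [I.range_eq_univ, mfderivWithin_univ] at h
  exact h

/-- The inner product on a tangent space, as a form on the model space. -/
def innerForm (g : SmoothMetric I M) (p : M) : E →L[ℝ] E →L[ℝ] ℝ := g.inner p

theorem isMetricForm_innerForm (g : SmoothMetric I M) (p : M) : IsMetricForm (innerForm g p) where
  symm v w := g.symm p v w
  pos v hv := g.pos p v hv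

theorem metricInChart_eq (g : SmoothMetric I M) (x : M) (y : E) :
    metricInChart g x y = pullbackForm (innerForm g ((extChartAt I x).symm y)) (chartFrame I x y) :=
  rfl

theorem metricInChart_self (g : SmoothMetric I M) (x : M) :
    metricInChart g x (extChartAt I x x) = innerForm g x := by
  rw [metricInChart_eq, chartFrame_self, extChartAt_to_inv]
  rfl

theorem contMDiffOn_chartFrame_apply (x : M) (v : E) :
    ContMDiffOn 𝓘(ℝ, E) I.tangent ∞
      (fun y ↦ TotalSpace.mk' E (E := TangentSpace I (M := M)) ((extChartAt I x).symm y)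
        (chartFrame I x y v)) (extChartAt I x).target := by
  have ht := isOpen_extChartAt_target (I := I) x
  have h1 := (contMDiffOn_extChartAt_symm (n := ∞) (I := I) x).contMDiffOn_tangentMapWithin (m := ∞)
    (by simp) ht.uniqueMDiffOn
  have h2 : ContMDiffOn 𝓘(ℝ, E) 𝓘(ℝ, E).tangent ∞
      (fun y : E ↦ (⟨y, v⟩ : TangentBundle 𝓘(ℝ, E) E)) (extChartAt I x).target := fun y _ ↦
    contMDiffWithinAt_vectorSpace_iff_contDiffWithinAt.2 contDiffWithinAt_const
  refine (h1.comp h2 fun y hy ↦ hy).congr fun y hy ↦ ?_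
  simp only [Function.comp_apply, tangentMapWithin]
  rw [mfderivWithin_of_isOpen ht hy]
  rfl

/-- For smoothness it suffices to treat matrix entries, which are contractions of the smooth metric
section with two coordinate vector fields. -/
theorem isMetricOn_metricInChart (g : SmoothMetric I M) (x : M) :
    IsMetricOn (metricInChart g x) (extChartAt I x).target where
  isOpen := isOpen_extChartAt_target x
  smooth := by
    rw [contDiffOn_clm_apply]
    intro v
    rw [contDiffOn_clm_apply]
    intro w
    rw [← contMDiffOn_iff_contDiffOn]
    intro y hy
    have h1 : ContMDiffWithinAt 𝓘(ℝ, E) (I.prod 𝓘(ℝ)) ∞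
        (fun y ↦ TotalSpace.mk' ℝ (E := Bundle.Trivial M ℝ) ((extChartAt I x).symm y)
          (g.inner ((extChartAt I x).symm y) (chartFrame I x y v) (chartFrame I x y w)))
        (extChartAt I x).target y := by
      apply ContMDiffWithinAt.clm_bundle_apply₂ (F₁ := E) (F₂ := E)
      · exact ContMDiffAt.comp_contMDiffWithinAt y g.contMDiff.contMDiffAt
          (contMDiffOn_extChartAt_symm x y hy)
      · exact contMDiffOn_chartFrame_apply x v y hy
      · exact contMDiffOn_chartFrame_apply x w y hy
    simp only [contMDiffWithinAt_totalSpace] at h1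
    exact h1.2
  form y hy := (isMetricForm_innerForm g _).pullback (bijective_chartFrame hy).1

/-- The domain of the transition from the chart at `x` to the chart at `x'`. -/
def transitionDomain (I : ModelWithCorners ℝ E H) (x x' : M) : Set E :=
  (extChartAt I x).target ∩ (extChartAt I x).symm ⁻¹' (extChartAt I x').source

theorem isOpen_transitionDomain (x x' : M) : IsOpen (transitionDomain I x x') :=
  (continuousOn_extChartAt_symm x).isOpen_inter_preimage (isOpen_extChartAt_target x)
    (isOpen_extChartAt_source x')

/-- The transition map between two charts. -/
def transition (I : ModelWithCorners ℝ E H) (x x' : M) : E → E :=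
  extChartAt I x' ∘ (extChartAt I x).symm

theorem contDiffOn_transition (x x' : M) :
    ContDiffOn ℝ ∞ (transition I x x') (transitionDomain I x x') := by
  rw [← contMDiffOn_iff_contDiffOn]
  refine (contMDiffOn_extChartAt (x := x')).comp
    ((contMDiffOn_extChartAt_symm x).mono inter_subset_left) fun y hy ↦ ?_
  simpa using hy.2

theorem symm_transition {x x' : M} {y : E} (hy : y ∈ transitionDomain I x x') :
    (extChartAt I x').symm (transition I x x' y) = (extChartAt I x).symm y :=
  (extChartAt I x').left_inv hy.2

theorem chartFrame_eq_comp {x x' : M} {y : E} (hy : y ∈ transitionDomain I x x') :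
    chartFrame I x y =
      chartFrame I x' (transition I x x' y) ∘L fderiv ℝ (transition I x x') y := by
  have h1 : (extChartAt I x).symm =ᶠ[𝓝 y] (extChartAt I x').symm ∘ transition I x x' := by
    filter_upwards [(isOpen_transitionDomain x x').mem_nhds hy] with z hz
    exact (symm_transition hz).symm
  have h2 : transition I x x' y ∈ (extChartAt I x').target := (extChartAt I x').map_source hy.2
  have h3 := smoothOn_differentiableAt (contDiffOn_transition x x') (isOpen_transitionDomain x x') hy
  have h4 := mfderiv_comp y (mdifferentiableAt_extChartAt_symm h2) h3.mdifferentiableAt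
  rw [mfderiv_eq_fderiv] at h4
  exact h1.mfderiv_eq.trans h4

/-- Both coordinate metrics are pulled back from the same metric on the manifold, and the chain rule
relates the two chart frames. This feeds all the invariance lemmas for isometries. -/
theorem isIsometryOn_transition (g : SmoothMetric I M) (x x' : M) :
    IsIsometryOn (metricInChart g x) (transitionDomain I x x') (metricInChart g x')
      (extChartAt I x').target (transition I x x') where
  metric :=
    { isOpen := isOpen_transitionDomain x x'
      smooth := (isMetricOn_metricInChart g x).smooth.mono inter_subset_left
      form := fun y hy ↦ (isMetricOn_metricInChart g x).form y hy.1 }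
  metric₂ := isMetricOn_metricInChart g x'
  mapsTo y hy := (extChartAt I x').map_source hy.2
  smooth := contDiffOn_transition x x'
  bijective y hy := by
    have h1 := bijective_chartFrame (I := I) hy.1
    rw [chartFrame_eq_comp hy] at h1
    exact (Function.Bijective.of_comp_iff' (bijective_chartFrame
      ((extChartAt I x').map_source hy.2)) _).1 h1
  eq_pullback y hy := by
    rw [metricInChart_eq, metricInChart_eq, symm_transition hy, chartFrame_eq_comp hy]
    rfl

end Charts

/-! ### Invariance of the differential operators -/

section Invariance

variable {E : Type*} [NormedAddCommGroup E] [NormedSpace ℝ E] [FiniteDimensional ℝ E]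
  {E₂ : Type*} [NormedAddCommGroup E₂] [NormedSpace ℝ E₂] [FiniteDimensional ℝ E₂]
  {F : Type*} [NormedAddCommGroup F] [NormedSpace ℝ F] [FiniteDimensional ℝ F]
  {G : E → E →L[ℝ] E →L[ℝ] ℝ} {U : Set E} {G₂ : E₂ → E₂ →L[ℝ] E₂ →L[ℝ] ℝ}
  {U₂ : Set E₂} {s : E → E₂} {y : E}

theorem coordTension_congr {Gd : E → E →L[ℝ] E →L[ℝ] ℝ} {G' : F → F →L[ℝ] F →L[ℝ] ℝ} {u u' : E → F}
    (h : u =ᶠ[𝓝 y] u') : coordTension Gd G' u y = coordTension Gd G' u' y := by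
  have h1 : coordSecondFundamentalForm Gd G' u y = coordSecondFundamentalForm Gd G' u' y := by
    ext v w
    simp only [coordSecondFundamentalForm]
    rw [h.fderiv_eq, h.fderiv.fderiv_eq, h.self_of_nhds]
  rw [coordTension, coordTension, h1]

/-- Lets the locality and the isometry invariance of the Laplacian be inherited from those of the
tension field. -/
theorem coordLaplacian_eq_tension (G : E → E →L[ℝ] E →L[ℝ] ℝ) (f : E → ℝ) (y : E) :
    coordLaplacian G f y = coordTension G (fun _ ↦ (0 : ℝ →L[ℝ] ℝ →L[ℝ] ℝ)) f y := by
  have h : coordHessian G f y = coordSecondFundamentalForm G (fun _ ↦ 0) f y := by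
    ext v w
    exact coordHessian_eq_secondFundamentalForm G f y v w 0
  rw [coordLaplacian, h, coordTension]

theorem coordLaplacian_congr {f f' : E → ℝ} (h : f =ᶠ[𝓝 y] f') :
    coordLaplacian G f y = coordLaplacian G f' y := by
  rw [coordLaplacian_eq_tension, coordLaplacian_eq_tension, coordTension_congr h]

theorem coordGrad_congr {f f' : E → ℝ} (h : f =ᶠ[𝓝 y] f') :
    coordGrad G f y = coordGrad G f' y := by
  rw [coordGrad, coordGrad, h.fderiv_eq]

theorem coordGradSq_congr {f f' : E → ℝ} (h : f =ᶠ[𝓝 y] f') :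
    coordGradSq G f y = coordGradSq G f' y := by
  rw [coordGradSq, coordGradSq, coordGrad_congr h, h.fderiv_eq]

theorem bitension_congr {f f' : E → ℝ} (h : f =ᶠ[𝓝 y] f') (n : ℕ) (w : E) :
    bitension n G f y w = bitension n G f' y w := by
  have h1 : coordLaplacian G f =ᶠ[𝓝 y] coordLaplacian G f' :=
    h.eventuallyEq_nhds.mono fun z hz ↦ coordLaplacian_congr hz
  have h2 : coordGradSq G f =ᶠ[𝓝 y] coordGradSq G f' :=
    h.eventuallyEq_nhds.mono fun z hz ↦ coordGradSq_congr hz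
  rw [bitension, bitension, h1.fderiv_eq, h2.fderiv_eq, coordGrad_congr h]

theorem IsIsometryOn.coordTension_comp (h : IsIsometryOn G U G₂ U₂ s) (hy : y ∈ U)
    {G' : F → F →L[ℝ] F →L[ℝ] ℝ} {u : E₂ → F} (hu : ContDiffAt ℝ 2 u (s y)) :
    coordTension G G' (u ∘ s) y = coordTension G₂ G' u (s y) :=
  h.metricTrace_comp hy hu

variable {f : E₂ → ℝ}

theorem IsIsometryOn.coordLaplacian_comp (h : IsIsometryOn G U G₂ U₂ s) (hf : ContDiffOn ℝ ∞ f U₂)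
    (hy : y ∈ U) : coordLaplacian G (f ∘ s) y = coordLaplacian G₂ f (s y) := by
  rw [coordLaplacian_eq_tension, coordLaplacian_eq_tension, h.coordTension_comp hy
    (contDiffAt_two_of_smoothOn hf h.metric₂.isOpen (h.mapsTo hy))]

theorem IsIsometryOn.fderiv_comp (h : IsIsometryOn G U G₂ U₂ s) {g : E₂ → F}
    (hg : ContDiffOn ℝ ∞ g U₂) (hy : y ∈ U) :
    fderiv ℝ (g ∘ s) y = fderiv ℝ g (s y) ∘L fderiv ℝ s y :=
  _root_.fderiv_comp y (smoothOn_differentiableAt hg h.metric₂.isOpen (h.mapsTo hy))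
    (smoothOn_differentiableAt h.smooth h.metric.isOpen hy)

theorem IsIsometryOn.fderiv_coordGrad (h : IsIsometryOn G U G₂ U₂ s) (hf : ContDiffOn ℝ ∞ f U₂)
    (hy : y ∈ U) : fderiv ℝ s y (coordGrad G (f ∘ s) y) = coordGrad G₂ f (s y) := by
  refine (h.metric₂.form _ (h.mapsTo hy)).ext fun z₂ ↦ ?_
  obtain ⟨z, rfl⟩ := (h.bijective y hy).2 z₂
  rw [h.metric₂.apply_coordGrad (h.mapsTo hy), ← pullbackForm_apply, ← h.eq_pullback y hy,
    h.metric.apply_coordGrad hy, h.fderiv_comp hf hy]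
  rfl

theorem IsIsometryOn.coordGradSq_comp (h : IsIsometryOn G U G₂ U₂ s) (hf : ContDiffOn ℝ ∞ f U₂)
    (hy : y ∈ U) : coordGradSq G (f ∘ s) y = coordGradSq G₂ f (s y) := by
  rw [coordGradSq, h.fderiv_comp hf hy, ContinuousLinearMap.comp_apply, h.fderiv_coordGrad hf hy]
  rfl

theorem IsIsometryOn.fderiv_coordRicci (h : IsIsometryOn G U G₂ U₂ s) (hy : y ∈ U) (v : E) :
    fderiv ℝ s y (coordRicci G y v) = coordRicci G₂ (s y) (fderiv ℝ s y v) := by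
  have h1 := (h.metric₂.form _ (h.mapsTo hy)).metricTrace_pullback (h.bijective y hy)
    (curvatureMap G₂ (s y) (fderiv ℝ s y v))
  rw [h.metric₂.coordRicci_eq (h.mapsTo hy), ← h1, coordRicci, map_metricTrace, h.eq_pullback y hy]
  congr 1
  ext a b
  rw [h.fderiv_curvature hy, h.metric₂.curvatureMap_apply (h.mapsTo hy)]

/-- Invariance of the bitension under isometries. -/
theorem IsIsometryOn.bitension_comp (h : IsIsometryOn G U G₂ U₂ s) (hf : ContDiffOn ℝ ∞ f U₂)
    (hy : y ∈ U) (n : ℕ) (w : E) :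
    bitension n G (f ∘ s) y w = bitension n G₂ f (s y) (fderiv ℝ s y w) := by
  have h1 : coordLaplacian G (f ∘ s) =ᶠ[𝓝 y] coordLaplacian G₂ f ∘ s := by
    filter_upwards [h.metric.isOpen.mem_nhds hy] with z hz
    exact h.coordLaplacian_comp hf hz
  have h2 : coordGradSq G (f ∘ s) =ᶠ[𝓝 y] coordGradSq G₂ f ∘ s := by
    filter_upwards [h.metric.isOpen.mem_nhds hy] with z hz
    exact h.coordGradSq_comp hf hz
  rw [bitension, bitension, h1.fderiv_eq, h2.fderiv_eq,
    h.fderiv_comp (h.metric₂.smooth_coordLaplacian hf) hy,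
    h.fderiv_comp (h.metric₂.smooth_coordGradSq hf) hy, h.eq_pullback y hy, pullbackForm_apply,
    h.fderiv_coordRicci hy, h.fderiv_coordGrad hf hy]
  rfl

end Invariance

/-! ### Independence of the chart for the operators on manifolds -/

section ManifoldInvariance

variable {E : Type*} [NormedAddCommGroup E] [NormedSpace ℝ E] [FiniteDimensional ℝ E]
  {H : Type*} [TopologicalSpace H] {I : ModelWithCorners ℝ E H} [I.Boundaryless]
  {M : Type*} [TopologicalSpace M] [ChartedSpace H M] [IsManifold I ∞ M]
  {E' : Type*} [NormedAddCommGroup E'] [NormedSpace ℝ E'] [FiniteDimensional ℝ E']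
  {H' : Type*} [TopologicalSpace H'] {I' : ModelWithCorners ℝ E' H'} [I'.Boundaryless]
  {P : Type*} [TopologicalSpace P] [ChartedSpace H' P] [IsManifold I' ∞ P]

theorem mem_transitionDomain_self {x x' : M} (hx : x ∈ (extChartAt I x').source) :
    extChartAt I x x ∈ transitionDomain I x x' :=
  ⟨mem_extChartAt_target x, by rwa [mem_preimage, extChartAt_to_inv]⟩

theorem transition_self {x x' : M} :
    transition I x x' (extChartAt I x x) = extChartAt I x' x := by
  rw [transition, Function.comp_apply, extChartAt_to_inv]

/-- The coordinate representation of a map between manifolds. -/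
def chartRep (I' : ModelWithCorners ℝ E' H') (I : ModelWithCorners ℝ E H) (p₀ : P) (q₀ : M)
    (φ : P → M) : E' → E :=
  extChartAt I q₀ ∘ φ ∘ (extChartAt I' p₀).symm

theorem contDiffAt_chartRep {p₀ : P} {q₀ : M} {φ : P → M} {z : E'}
    (hz : z ∈ (extChartAt I' p₀).target)
    (hq : φ ((extChartAt I' p₀).symm z) ∈ (extChartAt I q₀).source)
    (hφ : ContMDiffAt I' I ∞ φ ((extChartAt I' p₀).symm z)) :
    ContDiffAt ℝ ∞ (chartRep I' I p₀ q₀ φ) z := by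
  rw [← contMDiffAt_iff_contDiffAt]
  have h1 := contMDiffAt_extChartAt' (I := I) (n := ∞) (x := q₀) (by simpa using hq)
  exact ContMDiffAt.comp z h1 (ContMDiffAt.comp z hφ (contMDiffAt_extChartAt_symm hz))

theorem normSq_eq (h : SmoothMetric I M) {q : M} (v : TangentSpace I q) :
    normSq h v = metricInChart h q (extChartAt I q q) v v := by
  rw [metricInChart_self]
  rfl

/-- The length of the tension field can be computed in any pair of charts. -/
theorem normSq_tension (g : SmoothMetric I' P) (h : SmoothMetric I M) {φ : P → M} {p₀ p : P} {q₀ : M}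
    (hp : p ∈ (extChartAt I' p₀).source) (hq : φ p ∈ (extChartAt I q₀).source)
    (hφ : ContMDiffAt I' I ∞ φ p) :
    normSq h (tension g h φ p) = metricInChart h q₀ (extChartAt I q₀ (φ p))
      (coordTension (metricInChart g p₀) (metricInChart h q₀) (chartRep I' I p₀ q₀ φ)
        (extChartAt I' p₀ p))
      (coordTension (metricInChart g p₀) (metricInChart h q₀) (chartRep I' I p₀ q₀ φ)
        (extChartAt I' p₀ p)) := by
  have h2 : (2 : ℕ∞ω) ≤ ∞ := by simpa using WithTop.coe_le_coe.2 (le_top : (2 : ℕ∞) ≤ ⊤)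
  have hs := isIsometryOn_transition g p p₀
  have hk := isIsometryOn_transition h (φ p) q₀
  have hpd := mem_transitionDomain_self hp
  have hqd := mem_transitionDomain_self hq
  set y := extChartAt I' p p with hy
  have hr : chartRep I' I p (φ p) φ y = extChartAt I (φ p) (φ p) := by
    simp [chartRep, hy]
  have c1 : ContDiffAt ℝ 2 (chartRep I' I p (φ p) φ) y :=
    (contDiffAt_chartRep (mem_extChartAt_target p) (by simp) (by simpa using hφ)).of_le h2
  have c2 : ContDiffAt ℝ 2 (chartRep I' I p₀ q₀ φ) (transition I' p p₀ y) := by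
    refine (contDiffAt_chartRep ((hs.mapsTo hpd)) ?_ ?_).of_le h2
    · rw [symm_transition hpd, hy, extChartAt_to_inv]
      exact hq
    · rw [symm_transition hpd, hy, extChartAt_to_inv]
      exact hφ
  -- The representations of `φ` in the preferred and in the given charts differ by transition maps
  -- on both sides: domain invariance handles one, target equivariance the other.
  have e1 : transition I (φ p) q₀ ∘ chartRep I' I p (φ p) φ =ᶠ[𝓝 y]
      chartRep I' I p₀ q₀ φ ∘ transition I' p p₀ := by
    have hc : ContinuousAt (φ ∘ (extChartAt I' p).symm) y :=
      ContinuousAt.comp (by rw [hy, extChartAt_to_inv]; exact hφ.continuousAt)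
        (contMDiffAt_extChartAt_symm (mem_extChartAt_target p)).continuousAt
    have hn : (extChartAt I (φ p)).source ∈ 𝓝 ((φ ∘ (extChartAt I' p).symm) y) := by
      rw [Function.comp_apply, hy, extChartAt_to_inv]
      exact extChartAt_source_mem_nhds _
    filter_upwards [(isOpen_transitionDomain p p₀).mem_nhds hpd, hc hn] with z hz hz'
    have h3 := symm_transition hz
    simp only [Function.comp_apply, chartRep, h3]
    exact congrArg _ ((extChartAt I (φ p)).left_inv hz')
  have e2 : coordTension (metricInChart g p₀) (metricInChart h q₀) (chartRep I' I p₀ q₀ φ)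
      (extChartAt I' p₀ p) = fderiv ℝ (transition I (φ p) q₀) (extChartAt I (φ p) (φ p))
        (tension g h φ p) := by
    rw [← transition_self (x := p) (x' := p₀), ← hs.coordTension_comp hpd c2,
      ← coordTension_congr e1]
    have h3 := hk.metricTrace_comp_left (Gd := metricInChart g p) (u := chartRep I' I p (φ p) φ)
      (x := y) (by rw [hr]; exact hqd) c1
    rw [hr] at h3
    exact h3
  rw [normSq_eq, hk.eq_pullback _ hqd, e2, transition_self]
  rfl

/-- The differential of a function, as a linear form on the model space. -/
def diffForm (I : ModelWithCorners ℝ E H) (f : M → ℝ) (x : M) : E →L[ℝ] ℝ := mvfderiv I f x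

/-- The derivative of the preferred chart at its base point is the identity, so the manifold
differential is the ordinary one. Requiring `h` only near `x` lets it apply to functions such as the
Laplacian, defined in a different chart at each point. -/
theorem diffForm_eq {f : M → ℝ} {x : M} {k : E → ℝ} (hk : DifferentiableAt ℝ k (extChartAt I x x))
    (h : f =ᶠ[𝓝 x] k ∘ extChartAt I x) : diffForm I f x = fderiv ℝ k (extChartAt I x x) := by
  have h1 : mfderiv I 𝓘(ℝ, ℝ) (k ∘ extChartAt I x) x =
      (mfderiv 𝓘(ℝ, E) 𝓘(ℝ, ℝ) k (extChartAt I x x)).comp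
        (mfderiv I 𝓘(ℝ, E) (extChartAt I x) x) :=
    mfderiv_comp x hk.mdifferentiableAt (mdifferentiableAt_extChartAt (mem_chart_source H x))
  rw [mfderiv_extChartAt_self, mfderiv_eq_fderiv] at h1
  have h2 : (mfderiv I 𝓘(ℝ, ℝ) f x : E →L[ℝ] ℝ) = fderiv ℝ k (extChartAt I x x) :=
    h.mfderiv_eq.trans h1
  exact h2

variable {f : M → ℝ}

theorem contDiffOn_comp_extChartAt_symm (hf : ContMDiff I 𝓘(ℝ, ℝ) ∞ f) (x : M) :
    ContDiffOn ℝ ∞ (f ∘ (extChartAt I x).symm) (extChartAt I x).target := by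
  rw [← contMDiffOn_iff_contDiffOn]
  exact hf.comp_contMDiffOn (contMDiffOn_extChartAt_symm x)

theorem comp_symm_eq_comp_transition (f : M → ℝ) {x x' : M} {y : E}
    (hy : y ∈ transitionDomain I x x') :
    f ∘ (extChartAt I x).symm =ᶠ[𝓝 y] (f ∘ (extChartAt I x').symm) ∘ transition I x x' := by
  filter_upwards [(isOpen_transitionDomain x x').mem_nhds hy] with z hz
  simp only [Function.comp_apply, symm_transition hz]

theorem laplacian_eq (g : SmoothMetric I M) (hf : ContMDiff I 𝓘(ℝ, ℝ) ∞ f) {x x' : M}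
    (hx : x ∈ (extChartAt I x').source) :
    laplacian g f x = coordLaplacian (metricInChart g x') (f ∘ (extChartAt I x').symm)
      (extChartAt I x' x) := by
  have hxd := mem_transitionDomain_self hx
  rw [← transition_self (x := x), ← (isIsometryOn_transition g x x').coordLaplacian_comp
    (contDiffOn_comp_extChartAt_symm hf x') hxd,
    ← coordLaplacian_congr (comp_symm_eq_comp_transition f hxd)]
  rfl

theorem grad_eq (g : SmoothMetric I M) (hf : ContMDiff I 𝓘(ℝ, ℝ) ∞ f) (x : M) :
    grad g f x = coordGrad (metricInChart g x) (f ∘ (extChartAt I x).symm) (extChartAt I x x) := by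
  have h1 : diffForm I f x = fderiv ℝ (f ∘ (extChartAt I x).symm) (extChartAt I x x) := by
    refine diffForm_eq (smoothOn_differentiableAt (contDiffOn_comp_extChartAt_symm hf x)
      (isOpen_extChartAt_target x) (mem_extChartAt_target x)) ?_
    filter_upwards [extChartAt_source_mem_nhds (I := I) x] with z hz
    simp only [Function.comp_apply, (extChartAt I x).left_inv hz]
  rw [coordGrad, metricInChart_self, ← h1]
  rfl

theorem normSq_grad_eq (g : SmoothMetric I M) (hf : ContMDiff I 𝓘(ℝ, ℝ) ∞ f) {x x' : M}
    (hx : x ∈ (extChartAt I x').source) :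
    normSq g (grad g f x) = coordGradSq (metricInChart g x') (f ∘ (extChartAt I x').symm)
      (extChartAt I x' x) := by
  have hxd := mem_transitionDomain_self hx
  rw [← transition_self (x := x), ← (isIsometryOn_transition g x x').coordGradSq_comp
    (contDiffOn_comp_extChartAt_symm hf x') hxd,
    ← coordGradSq_congr (comp_symm_eq_comp_transition f hxd), normSq_eq, grad_eq g hf,
    (isMetricOn_metricInChart g x).apply_coordGrad (mem_extChartAt_target x)]
  rfl

/-- The vector field `grad Δf + 2 Ric(grad f) + (n/2) grad |grad f|²` vanishes at `x` if and only if the bitension does, in the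
preferred chart at `x`. -/
theorem bitensionField_eq_zero_iff (g : SmoothMetric I M) (hf : ContMDiff I 𝓘(ℝ, ℝ) ∞ f) (n : ℕ)
    (x : M) :
    grad g (laplacian g f) x + (2 : ℝ) • ricci g (grad g f x) +
        ((n : ℝ) / 2) • grad g (fun z ↦ normSq g (grad g f z)) x = 0 ↔
      ∀ w, bitension n (metricInChart g x) (f ∘ (extChartAt I x).symm) (extChartAt I x x) w = 0 := by
  have hG := isMetricOn_metricInChart g x
  have hx := mem_extChartAt_target (I := I) x
  have hfs := contDiffOn_comp_extChartAt_symm hf x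
  have hF := isMetricForm_innerForm g x
  have hgrad (k : M → ℝ) (w : E) : innerForm g x (grad g k x) w = diffForm I k x w :=
    congrArg (fun l : E →L[ℝ] ℝ ↦ l w) (hF.apply_inverse (diffForm I k x))
  have h1 : diffForm I (laplacian g f) x = fderiv ℝ (coordLaplacian (metricInChart g x)
      (f ∘ (extChartAt I x).symm)) (extChartAt I x x) := by
    refine diffForm_eq (smoothOn_differentiableAt (hG.smooth_coordLaplacian hfs) hG.isOpen hx) ?_
    filter_upwards [extChartAt_source_mem_nhds (I := I) x] with z hz
    exact laplacian_eq g hf hz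
  have h2 : diffForm I (fun z ↦ normSq g (grad g f z)) x = fderiv ℝ (coordGradSq (metricInChart g x)
      (f ∘ (extChartAt I x).symm)) (extChartAt I x x) := by
    refine diffForm_eq (smoothOn_differentiableAt (hG.smooth_coordGradSq hfs) hG.isOpen hx) ?_
    filter_upwards [extChartAt_source_mem_nhds (I := I) x] with z hz
    exact normSq_grad_eq g hf hz
  have key (w : E) : innerForm g x (grad g (laplacian g f) x + (2 : ℝ) • ricci g (grad g f x) +
        ((n : ℝ) / 2) • grad g (fun z ↦ normSq g (grad g f z)) x : E) w =
      bitension n (metricInChart g x) (f ∘ (extChartAt I x).symm) (extChartAt I x x) w := by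
    have h3 : ricci g (grad g f x) = coordRicci (metricInChart g x) (extChartAt I x x)
        (coordGrad (metricInChart g x) (f ∘ (extChartAt I x).symm) (extChartAt I x x)) := by
      rw [← grad_eq g hf]
      rfl
    have h4 := hgrad (laplacian g f) w
    have h5 := hgrad (fun z ↦ normSq g (grad g f z)) w
    rw [h1] at h4
    rw [h2] at h5
    rw [bitension, ← h4, ← h5, metricInChart_self, ← h3]
    have h6 (a b c : E) (r : ℝ) : innerForm g x (a + (2 : ℝ) • b + r • c) w =
        innerForm g x a w + 2 * innerForm g x b w + r * innerForm g x c w := by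
      simp
    exact h6 _ _ _ _
  have hz (w : E) : innerForm g x (0 : E) w = 0 := by simp
  constructor
  · intro h0 w
    rw [← key]
    exact (congrArg (fun v : E ↦ innerForm g x v w) h0).trans (hz w)
  · intro h0
    exact hF.ext (v := (_ : E)) (w := (0 : E)) fun w ↦ (key w).trans ((h0 w).trans (hz w).symm)

/-- If `grad Δf + 2 Ric(grad f) + (n/2) grad |grad f|²` vanishes, the bitension vanishes in every chart. -/
theorem bitension_eq_zero_of_forall (g : SmoothMetric I M) (hf : ContMDiff I 𝓘(ℝ, ℝ) ∞ f) (n : ℕ)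
    (h : ∀ x : M, grad g (laplacian g f) x + (2 : ℝ) • ricci g (grad g f x) +
        ((n : ℝ) / 2) • grad g (fun z ↦ normSq g (grad g f z)) x = 0)
    (x₀ : M) {y : E} (hy : y ∈ (extChartAt I x₀).target) (w : E) :
    bitension n (metricInChart g x₀) (f ∘ (extChartAt I x₀).symm) y w = 0 := by
  set x := (extChartAt I x₀).symm y with hx
  have hyd : y ∈ transitionDomain I x₀ x := ⟨hy, mem_extChartAt_source x⟩
  have hyx : transition I x₀ x y = extChartAt I x x := rfl
  rw [bitension_congr (comp_symm_eq_comp_transition f hyd),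
    (isIsometryOn_transition g x₀ x).bitension_comp (contDiffOn_comp_extChartAt_symm hf x) hyd, hyx]
  exact (bitensionField_eq_zero_iff g hf n x).1 (h x) _

end ManifoldInvariance

/-! ### The Riemannian volume measure -/

section VolumeMeasure

variable {E : Type*} [NormedAddCommGroup E] [NormedSpace ℝ E] [FiniteDimensional ℝ E]
  {H : Type*} [TopologicalSpace H] {I : ModelWithCorners ℝ E H} [I.Boundaryless]
  {M : Type*} [TopologicalSpace M] [ChartedSpace H M] [IsManifold I ∞ M]
  [MeasurableSpace E] [BorelSpace E] [MeasurableSpace M] [BorelSpace M]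

theorem measurableSet_inter_preimage_of_continuousOn {X Y : Type*} [TopologicalSpace X]
    [MeasurableSpace X] [BorelSpace X] [TopologicalSpace Y] [MeasurableSpace Y] [BorelSpace Y]
    {f : X → Y} {t : Set X} (hf : ContinuousOn f t) (ht : MeasurableSet t) {s : Set Y}
    (hs : MeasurableSet s) : MeasurableSet (t ∩ f ⁻¹' s) := by
  have h1 := ht.subtype_image ((continuousOn_iff_continuous_domRestrict.1 hf).measurable hs)
  have h2 : t ∩ f ⁻¹' s = Subtype.val '' (t.domRestrict f ⁻¹' s) := by
    ext y
    simp [and_comm]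
  rwa [h2]

/-- The inverse chart is controlled only on its target, but the restricted measure does not see the
complement. -/
theorem aemeasurable_extChartAt_symm (x : M) (ρ : E → ENNReal) :
    AEMeasurable (extChartAt I x).symm
      (((Module.finBasis ℝ E).addHaar.restrict (extChartAt I x).target).withDensity ρ) :=
  AEMeasurable.mono_ac ((continuousOn_extChartAt_symm x).aemeasurable
    (isOpen_extChartAt_target x).measurableSet) (withDensity_absolutelyContinuous _ _)

theorem chartVolume_apply (g : SmoothMetric I M) (x : M) {s : Set M} (hs : MeasurableSet s) :
    chartVolume g x s = ∫⁻ y in (extChartAt I x).target ∩ (extChartAt I x).symm ⁻¹' s,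
      ENNReal.ofReal (volumeDensity (metricInChart g x y)) ∂(Module.finBasis ℝ E).addHaar := by
  rw [chartVolume, Measure.map_apply_of_aemeasurable (aemeasurable_extChartAt_symm x _) hs,
    withDensity_apply', Measure.restrict_restrict' (isOpen_extChartAt_target x).measurableSet,
    inter_comm]

theorem chartVolume_inter_source (g : SmoothMetric I M) (x : M) {s : Set M} (hs : MeasurableSet s) :
    chartVolume g x (s ∩ (extChartAt I x).source) = chartVolume g x s := by
  rw [chartVolume_apply g x hs,
    chartVolume_apply g x (hs.inter (isOpen_extChartAt_source x).measurableSet)]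
  congr 2
  ext y
  exact ⟨fun h ↦ ⟨h.1, h.2.1⟩, fun h ↦ ⟨h.1, h.2, (extChartAt I x).map_target h.1⟩⟩

/-- Change of variables along the transition map: its Jacobian is exactly the factor by which the
density changes under pull-back. -/
theorem chartVolume_eq (g : SmoothMetric I M) {x x' : M} {s : Set M} (hs : MeasurableSet s)
    (h : s ⊆ (extChartAt I x).source) (h' : s ⊆ (extChartAt I x').source) :
    chartVolume g x s = chartVolume g x' s := by
  have ht := isIsometryOn_transition g x x'
  have hsub : (extChartAt I x).target ∩ (extChartAt I x).symm ⁻¹' s ⊆ transitionDomain I x x' :=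
    fun y hy ↦ ⟨hy.1, h' hy.2⟩
  have him : (extChartAt I x').target ∩ (extChartAt I x').symm ⁻¹' s =
      transition I x x' '' ((extChartAt I x).target ∩ (extChartAt I x).symm ⁻¹' s) := by
    ext z
    constructor
    · intro hz
      refine ⟨extChartAt I x ((extChartAt I x').symm z), ⟨(extChartAt I x).map_source (h hz.2), ?_⟩,
        ?_⟩
      · rw [mem_preimage, (extChartAt I x).left_inv (h hz.2)]
        exact hz.2
      · rw [transition, Function.comp_apply, (extChartAt I x).left_inv (h hz.2),
          (extChartAt I x').right_inv hz.1]
    · rintro ⟨y, hy, rfl⟩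
      refine ⟨ht.mapsTo (hsub hy), ?_⟩
      rw [mem_preimage, symm_transition (hsub hy)]
      exact hy.2
  have hmeas : MeasurableSet ((extChartAt I x).target ∩ (extChartAt I x).symm ⁻¹' s) :=
    measurableSet_inter_preimage_of_continuousOn (continuousOn_extChartAt_symm x)
      (isOpen_extChartAt_target x).measurableSet hs
  have hinj : InjOn (transition I x x')
      ((extChartAt I x).target ∩ (extChartAt I x).symm ⁻¹' s) := by
    intro y hy z hz hyz
    have h1 := congrArg (extChartAt I x').symm hyz
    rw [symm_transition (hsub hy), symm_transition (hsub hz)] at h1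
    exact (extChartAt I x).symm.injOn hy.1 hz.1 h1
  rw [chartVolume_apply g x hs, chartVolume_apply g x' hs, him,
    lintegral_image_eq_lintegral_abs_det_fderiv_mul _ hmeas (fun y hy ↦
      (smoothOn_differentiableAt ht.smooth ht.metric.isOpen
        (hsub hy)).hasFDerivAt.hasFDerivWithinAt) hinj]
  refine setLIntegral_congr_fun hmeas fun y hy ↦ ?_
  rw [ht.eq_pullback y (hsub hy), volumeDensity_pullback, ENNReal.ofReal_mul (abs_nonneg _)]

/-- One inequality is immediate from the supremum. For the other, `chartVolume g x` plus the part of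
the volume off the chart domain dominates every `chartVolume g x'`, as seen by splitting a set along
that domain, and hence dominates their supremum. -/
theorem riemannianVolume_restrict (g : SmoothMetric I M) (x : M) :
    (riemannianVolume g).restrict (extChartAt I x).source = chartVolume g x := by
  have hS := (isOpen_extChartAt_source (I := I) x).measurableSet
  have h1 : riemannianVolume g ≤
      chartVolume g x + (riemannianVolume g).restrict (extChartAt I x).sourceᶜ := by
    refine iSup_le fun x' ↦ Measure.le_iff.2 fun s hs ↦ ?_
    have hS' := (isOpen_extChartAt_source (I := I) x').measurableSet
    rw [← measure_inter_add_sdiff s hS, Measure.add_apply, Measure.restrict_apply hs,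
      ← chartVolume_inter_source g x' (hs.inter hS), chartVolume_eq g (x' := x)
        ((hs.inter hS).inter hS') inter_subset_right (inter_subset_left.trans inter_subset_right)]
    exact add_le_add (measure_mono (inter_subset_left.trans inter_subset_left))
      (le_iSup (chartVolume g) x' _)
  refine Measure.ext fun s hs ↦ ?_
  rw [Measure.restrict_apply hs, ← chartVolume_inter_source g x hs]
  refine le_antisymm ((h1 _).trans ?_) (le_iSup (chartVolume g) x _)
  rw [Measure.add_apply, Measure.restrict_apply (hs.inter hS)]
  have : s ∩ (extChartAt I x).source ∩ (extChartAt I x).sourceᶜ = ∅ := by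
    rw [inter_assoc, inter_compl_self, inter_empty]
  rw [this, measure_empty, add_zero]

theorem setIntegral_riemannianVolume_source (g : SmoothMetric I M) (x : M) {f : M → ℝ}
    (hf : Measurable f) :
    ∫ p in (extChartAt I x).source, f p ∂(riemannianVolume g) =
      ∫ y in (extChartAt I x).target, volumeDensity (metricInChart g x y) *
        f ((extChartAt I x).symm y) ∂(Module.finBasis ℝ E).addHaar := by
  have hρ : AEMeasurable (fun y ↦ volumeDensity (metricInChart g x y))
      ((Module.finBasis ℝ E).addHaar.restrict (extChartAt I x).target) :=
    (isMetricOn_metricInChart g x).smooth_volumeDensity.continuousOn.aemeasurable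
      (isOpen_extChartAt_target x).measurableSet
  rw [riemannianVolume_restrict, chartVolume, integral_map (aemeasurable_extChartAt_symm x _)
    hf.aestronglyMeasurable, integral_withDensity_eq_integral_toReal_smul₀ hρ.ennreal_ofReal
    (Filter.Eventually.of_forall fun _ ↦ ENNReal.ofReal_lt_top)]
  refine setIntegral_congr_fun (isOpen_extChartAt_target x).measurableSet fun y hy ↦ ?_
  simp only [smul_eq_mul]
  rw [ENNReal.toReal_ofReal ((isMetricOn_metricInChart g x).form y hy).volumeDensity_pos.le]

/-- Gives compact sets finite volume, so that constants are integrable bounds and continuous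
functions are integrable on them. -/
theorem isLocallyFiniteMeasure_riemannianVolume (g : SmoothMetric I M) :
    IsLocallyFiniteMeasure (riemannianVolume g) := by
  refine ⟨fun x ↦ ?_⟩
  have hx := mem_extChartAt_target (I := I) x
  have ht := isOpen_extChartAt_target (I := I) x
  obtain ⟨C, hCx, hCt, hC⟩ := local_compact_nhds (ht.mem_nhds hx)
  have hO : IsOpen ((extChartAt I x).source ∩ extChartAt I x ⁻¹' interior C) :=
    (continuousOn_extChartAt x).isOpen_inter_preimage (isOpen_extChartAt_source x) isOpen_interior
  refine ⟨_, hO.mem_nhds ⟨mem_extChartAt_source x, mem_interior_iff_mem_nhds.2 hCx⟩, ?_⟩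
  rw [← inter_eq_left.2 (inter_subset_left (s := (extChartAt I x).source)
      (t := extChartAt I x ⁻¹' interior C)),
    ← Measure.restrict_apply' (isOpen_extChartAt_source x).measurableSet,
    riemannianVolume_restrict, chartVolume_apply g x hO.measurableSet]
  have hsub : (extChartAt I x).target ∩ (extChartAt I x).symm ⁻¹'
      ((extChartAt I x).source ∩ extChartAt I x ⁻¹' interior C) ⊆ C := fun y hy ↦ by
    have := interior_subset hy.2.2
    rwa [(extChartAt I x).right_inv hy.1] at this
  have hint : IntegrableOn (fun y ↦ volumeDensity (metricInChart g x y)) C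
      (Module.finBasis ℝ E).addHaar :=
    ((isMetricOn_metricInChart g x).smooth_volumeDensity.continuousOn.mono hCt).integrableOn_compact
      hC
  exact (lintegral_mono_set hsub).trans_lt hint.lintegral_lt_top

end VolumeMeasure

/-! ### Charts of a warped product -/

section WarpedCharts

variable {E : Type*} [NormedAddCommGroup E] [NormedSpace ℝ E] [FiniteDimensional ℝ E]
  {H : Type*} [TopologicalSpace H] {I : ModelWithCorners ℝ E H} [I.Boundaryless]
  {M : Type*} [TopologicalSpace M] [ChartedSpace H M] [IsManifold I ∞ M]
  {F : Type*} [NormedAddCommGroup F] [NormedSpace ℝ F] [FiniteDimensional ℝ F]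
  {K : Type*} [TopologicalSpace K] {J : ModelWithCorners ℝ F K} [J.Boundaryless]
  {N : Type*} [TopologicalSpace N] [ChartedSpace K N] [IsManifold J ∞ N]

theorem extChartAt_prod_target (p : M × N) : (extChartAt (I.prod J) p).target =
    (extChartAt I p.1).target ×ˢ (extChartAt J p.2).target := by
  rw [extChartAt_prod, PartialEquiv.prod_target]

theorem extChartAt_prod_symm_apply (p : M × N) (z : E × F) : (extChartAt (I.prod J) p).symm z =
    ((extChartAt I p.1).symm z.1, (extChartAt J p.2).symm z.2) := by
  rw [extChartAt_prod]
  rfl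

theorem innerForm_warpedProduct (gM : SmoothMetric I M) (gN : SmoothMetric J N) {lam : M → ℝ}
    (hlam : ContMDiff I 𝓘(ℝ, ℝ) ∞ lam) (p : M × N) (v w : E × F) :
    innerForm (warpedProduct gM gN lam hlam) p v w =
      innerForm gM p.1 v.1 w.1 + Real.exp (2 * lam p.1) * innerForm gN p.2 v.2 w.2 := by
  change gM.inner p.1 (mfderiv (I.prod J) I Prod.fst p v) (mfderiv (I.prod J) I Prod.fst p w) +
    Real.exp (2 * lam p.1) * gN.inner p.2 (mfderiv (I.prod J) J Prod.snd p v)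
      (mfderiv (I.prod J) J Prod.snd p w) = _
  rw [mfderiv_fst, mfderiv_snd]
  rfl

theorem chartFrame_prod (p : M × N) {z : E × F} (hz : z ∈ (extChartAt (I.prod J) p).target)
    (v : E × F) : chartFrame (I.prod J) p z v =
      (chartFrame I p.1 z.1 v.1, chartFrame J p.2 z.2 v.2) := by
  have hz' := hz
  rw [extChartAt_prod_target] at hz'
  have h1 : (extChartAt (I.prod J) p).symm =
      fun z : E × F ↦ ((extChartAt I p.1).symm z.1, (extChartAt J p.2).symm z.2) :=
    funext (extChartAt_prod_symm_apply p)
  have h2 : HasMFDerivAt 𝓘(ℝ, E × F) I (fun z : E × F ↦ (extChartAt I p.1).symm z.1) z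
      ((mfderiv 𝓘(ℝ, E) I (extChartAt I p.1).symm z.1).comp (ContinuousLinearMap.fst ℝ E F)) :=
    HasMFDerivAt.comp z (mdifferentiableAt_extChartAt_symm hz'.1).hasMFDerivAt
      (hasFDerivAt_fst.hasMFDerivAt)
  have h3 : HasMFDerivAt 𝓘(ℝ, E × F) J (fun z : E × F ↦ (extChartAt J p.2).symm z.2) z
      ((mfderiv 𝓘(ℝ, F) J (extChartAt J p.2).symm z.2).comp (ContinuousLinearMap.snd ℝ E F)) :=
    HasMFDerivAt.comp z (mdifferentiableAt_extChartAt_symm hz'.2).hasMFDerivAt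
      (hasFDerivAt_snd.hasMFDerivAt)
  have h4 := (h2.prodMk h3).mfderiv
  rw [chartFrame, h1, h4]
  rfl

theorem metricInChart_warpedProduct (gM : SmoothMetric I M) (gN : SmoothMetric J N) {lam : M → ℝ}
    (hlam : ContMDiff I 𝓘(ℝ, ℝ) ∞ lam) (p : M × N) {z : E × F}
    (hz : z ∈ (extChartAt (I.prod J) p).target) :
    metricInChart (warpedProduct gM gN lam hlam) p z =
      coordWarped (metricInChart gM p.1) (metricInChart gN p.2) (lam ∘ (extChartAt I p.1).symm)
        z := by
  refine ContinuousLinearMap.ext fun v ↦ ContinuousLinearMap.ext fun w ↦ ?_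
  rw [metricInChart_eq, pullbackForm_apply, innerForm_warpedProduct, chartFrame_prod p hz,
    chartFrame_prod p hz, extChartAt_prod_symm_apply, coordWarped_apply, metricInChart_eq,
    metricInChart_eq, pullbackForm_apply, pullbackForm_apply]
  rfl

end WarpedCharts

/-! ### Differentiation of the bienergy along a variation -/

section ParametricIntegral

open Filter

theorem hasDerivAt_setIntegral_of_continuousOn {P : Type*} [TopologicalSpace P] [T2Space P]
    [MeasurableSpace P] [BorelSpace P] {μ : Measure P} [IsFiniteMeasureOnCompacts μ]
    {S S' : ℝ → P → ℝ} {ε : ℝ} (hε : 0 < ε) {Ω : Set P} (hΩ : IsCompact Ω)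
    (hS : ∀ t ∈ Ioo (-ε) ε, ∀ p, HasDerivAt (fun t ↦ S t p) (S' t p) t)
    (hc : ∀ t ∈ Ioo (-ε) ε, Continuous (S t))
    (hc' : ContinuousOn (fun q : ℝ × P ↦ S' q.1 q.2) (Ioo (-ε) ε ×ˢ univ)) :
    HasDerivAt (fun t ↦ ∫ p in Ω, S t p ∂μ) (∫ p in Ω, S' 0 p ∂μ) 0 := by
  have h0 : (0 : ℝ) ∈ Ioo (-ε) ε := by constructor <;> linarith
  have hsub : Icc (-(ε / 2)) (ε / 2) ⊆ Ioo (-ε) ε := fun t ht ↦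
    ⟨by linarith [ht.1], by linarith [ht.2]⟩
  -- Halving the parameter interval makes `Icc × Ω` compact, so the continuous derivative has a
  -- constant bound there, as dominated convergence requires.
  obtain ⟨B, hB⟩ := ((isCompact_Icc (a := -(ε / 2)) (b := ε / 2)).prod hΩ).exists_bound_of_continuousOn
    (hc'.mono (prod_mono hsub (subset_univ _)))
  have hfin : IsFiniteMeasure (μ.restrict Ω) := ⟨by simpa using hΩ.measure_lt_top⟩
  have hs : Ioo (-(ε / 2)) (ε / 2) ∈ 𝓝 (0 : ℝ) := Ioo_mem_nhds (by linarith) (by linarith)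
  have hcS' : Continuous (S' 0) := by
    have := hc'.comp_continuous (f := fun p : P ↦ ((0 : ℝ), p)) (by fun_prop) fun p ↦ ⟨h0, mem_univ _⟩
    exact this
  refine (hasDerivAt_integral_of_dominated_loc_of_deriv_le (μ := μ.restrict Ω) (bound := fun _ ↦ B)
    (F' := S') hs ?_ ?_ hcS'.aestronglyMeasurable ?_ (integrable_const _) ?_).2
  · filter_upwards [Ioo_mem_nhds h0.1 h0.2] with t ht
    exact (hc t ht).aestronglyMeasurable
  · exact (hc 0 h0).continuousOn.integrableOn_compact hΩ
  · filter_upwards [ae_restrict_mem hΩ.measurableSet] with p hp t ht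
    exact hB (t, p) ⟨Ioo_subset_Icc_self ht, hp⟩
  · exact Eventually.of_forall fun p t ht ↦ hS t (hsub (Ioo_subset_Icc_self ht)) p

end ParametricIntegral

/-! ### Bienergy density of a smooth variation, globally and in charts -/

section Variations

variable {E : Type*} [NormedAddCommGroup E] [NormedSpace ℝ E] [FiniteDimensional ℝ E]
  {H : Type*} [TopologicalSpace H] {I : ModelWithCorners ℝ E H} [I.Boundaryless]
  {M : Type*} [TopologicalSpace M] [ChartedSpace H M] [IsManifold I ∞ M]
  {E' : Type*} [NormedAddCommGroup E'] [NormedSpace ℝ E'] [FiniteDimensional ℝ E']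
  {H' : Type*} [TopologicalSpace H'] {I' : ModelWithCorners ℝ E' H'} [I'.Boundaryless]
  {P : Type*} [TopologicalSpace P] [ChartedSpace H' P] [IsManifold I' ∞ P]
  {Φ : ℝ → P → M} {ε : ℝ}

/-- The domain of the coordinate representation of a family of maps. -/
def chartRepDomain (I' : ModelWithCorners ℝ E' H') (I : ModelWithCorners ℝ E H) (Φ : ℝ → P → M)
    (ε : ℝ) (p₀ : P) (q₀ : M) : Set (ℝ × E') :=
  Ioo (-ε) ε ×ˢ (extChartAt I' p₀).target ∩
    (fun q : ℝ × E' ↦ Φ q.1 ((extChartAt I' p₀).symm q.2)) ⁻¹' (extChartAt I q₀).source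

theorem contMDiffOn_comp_symm (hΦ : ContMDiffOn (𝓘(ℝ, ℝ).prod I') I ∞ (fun q : ℝ × P ↦ Φ q.1 q.2)
    (Ioo (-ε) ε ×ˢ univ)) (p₀ : P) :
    ContMDiffOn 𝓘(ℝ, ℝ × E') I ∞ (fun q : ℝ × E' ↦ Φ q.1 ((extChartAt I' p₀).symm q.2))
      (Ioo (-ε) ε ×ˢ (extChartAt I' p₀).target) := by
  have h1 : ContMDiffOn 𝓘(ℝ, ℝ × E') I' ∞ (fun q : ℝ × E' ↦ (extChartAt I' p₀).symm q.2)
      (Ioo (-ε) ε ×ˢ (extChartAt I' p₀).target) :=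
    (contMDiffOn_extChartAt_symm p₀).comp contDiff_snd.contMDiff.contMDiffOn fun q hq ↦ hq.2
  have h2 : ContMDiffOn 𝓘(ℝ, ℝ × E') 𝓘(ℝ, ℝ) ∞ (fun q : ℝ × E' ↦ q.1)
      (Ioo (-ε) ε ×ˢ (extChartAt I' p₀).target) := contDiff_fst.contMDiff.contMDiffOn
  exact hΦ.comp (h2.prodMk h1) fun q hq ↦ ⟨hq.1, mem_univ _⟩

theorem isOpen_chartRepDomain (hΦ : ContMDiffOn (𝓘(ℝ, ℝ).prod I') I ∞
    (fun q : ℝ × P ↦ Φ q.1 q.2) (Ioo (-ε) ε ×ˢ univ)) (p₀ : P) (q₀ : M) :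
    IsOpen (chartRepDomain I' I Φ ε p₀ q₀) :=
  (contMDiffOn_comp_symm hΦ p₀).continuousOn.isOpen_inter_preimage
    (isOpen_Ioo.prod (isOpen_extChartAt_target p₀)) (isOpen_extChartAt_source q₀)

theorem smoothFamilyOn_chartRep (hΦ : ContMDiffOn (𝓘(ℝ, ℝ).prod I') I ∞
    (fun q : ℝ × P ↦ Φ q.1 q.2) (Ioo (-ε) ε ×ˢ univ)) (p₀ : P) (q₀ : M) :
    SmoothFamilyOn (fun t ↦ chartRep I' I p₀ q₀ (Φ t)) (chartRepDomain I' I Φ ε p₀ q₀) := by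
  rw [SmoothFamilyOn, ← contMDiffOn_iff_contDiffOn]
  refine (contMDiffOn_extChartAt (x := q₀)).comp
    ((contMDiffOn_comp_symm hΦ p₀).mono inter_subset_left) fun q hq ↦ ?_
  simpa using hq.2

theorem contMDiffAt_slice (hΦ : ContMDiffOn (𝓘(ℝ, ℝ).prod I') I ∞ (fun q : ℝ × P ↦ Φ q.1 q.2)
    (Ioo (-ε) ε ×ˢ univ)) {t : ℝ} (ht : t ∈ Ioo (-ε) ε) (p : P) : ContMDiffAt I' I ∞ (Φ t) p := by
  have h1 : ContMDiffAt (𝓘(ℝ, ℝ).prod I') I ∞ (fun q : ℝ × P ↦ Φ q.1 q.2) (t, p) :=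
    hΦ.contMDiffAt ((isOpen_Ioo.prod isOpen_univ).mem_nhds ⟨ht, mem_univ _⟩)
  exact ContMDiffAt.comp (g := fun q : ℝ × P ↦ Φ q.1 q.2) (f := fun p ↦ (t, p)) p h1
    (contMDiffAt_const.prodMk contMDiffAt_id)

/-- The bienergy density of a family of maps. -/
def bienergyDensity (g : SmoothMetric I' P) (h : SmoothMetric I M) (Φ : ℝ → P → M) (t : ℝ) (p : P) :
    ℝ :=
  1 / 2 * normSq h (tension g h (Φ t) p)

/-- The bienergy density of a family of maps in charts. -/
def coordBienergyDensity (g : SmoothMetric I' P) (h : SmoothMetric I M) (p₀ : P) (q₀ : M)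
    (Φ : ℝ → P → M) (t : ℝ) (z : E') : ℝ :=
  1 / 2 * metricInChart h q₀ (chartRep I' I p₀ q₀ (Φ t) z)
    (coordTension (metricInChart g p₀) (metricInChart h q₀) (chartRep I' I p₀ q₀ (Φ t)) z)
    (coordTension (metricInChart g p₀) (metricInChart h q₀) (chartRep I' I p₀ q₀ (Φ t)) z)

variable (g : SmoothMetric I' P) (h : SmoothMetric I M)

theorem smoothFamilyOn_coordBienergyDensity (hΦ : ContMDiffOn (𝓘(ℝ, ℝ).prod I') I ∞
    (fun q : ℝ × P ↦ Φ q.1 q.2) (Ioo (-ε) ε ×ˢ univ)) (p₀ : P) (q₀ : M) :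
    SmoothFamilyOn (coordBienergyDensity g h p₀ q₀ Φ) (chartRepDomain I' I Φ ε p₀ q₀) :=
  ContDiffOn.mul contDiffOn_const ((smoothFamilyOn_chartRep hΦ p₀ q₀).normSq_coordTension
    (isOpen_chartRepDomain hΦ p₀ q₀) (isMetricOn_metricInChart g p₀) (isMetricOn_metricInChart h q₀)
    (fun _ hq ↦ hq.1.2) fun _ hq ↦ (extChartAt I q₀).map_source hq.2)

theorem bienergyDensity_eq (hΦ : ContMDiffOn (𝓘(ℝ, ℝ).prod I') I ∞ (fun q : ℝ × P ↦ Φ q.1 q.2)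
    (Ioo (-ε) ε ×ˢ univ)) {t : ℝ} (ht : t ∈ Ioo (-ε) ε) {p₀ p : P} {q₀ : M}
    (hp : p ∈ (extChartAt I' p₀).source) (hq : Φ t p ∈ (extChartAt I q₀).source) :
    bienergyDensity g h Φ t p = coordBienergyDensity g h p₀ q₀ Φ t (extChartAt I' p₀ p) := by
  rw [bienergyDensity, normSq_tension g h hp hq (contMDiffAt_slice hΦ ht p), coordBienergyDensity,
    chartRep, Function.comp_apply, Function.comp_apply, (extChartAt I' p₀).left_inv hp]

theorem chart_mem_chartRepDomain {t : ℝ} (ht : t ∈ Ioo (-ε) ε) {p₀ p : P} {q₀ : M}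
    (hp : p ∈ (extChartAt I' p₀).source) (hq : Φ t p ∈ (extChartAt I q₀).source) :
    (t, extChartAt I' p₀ p) ∈ chartRepDomain I' I Φ ε p₀ q₀ :=
  ⟨⟨ht, (extChartAt I' p₀).map_source hp⟩, by
    rwa [mem_preimage, (extChartAt I' p₀).left_inv hp]⟩

open Filter in
theorem eventually_mem_source (hΦ : ContMDiffOn (𝓘(ℝ, ℝ).prod I') I ∞ (fun q : ℝ × P ↦ Φ q.1 q.2)
    (Ioo (-ε) ε ×ˢ univ)) {t : ℝ} (ht : t ∈ Ioo (-ε) ε) {p₀ p : P} {q₀ : M}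
    (hp : p ∈ (extChartAt I' p₀).source) (hq : Φ t p ∈ (extChartAt I q₀).source) :
    ∀ᶠ q : ℝ × P in 𝓝 (t, p), q.1 ∈ Ioo (-ε) ε ∧ q.2 ∈ (extChartAt I' p₀).source ∧
      Φ q.1 q.2 ∈ (extChartAt I q₀).source := by
  have h1 : ContinuousAt (fun q : ℝ × P ↦ Φ q.1 q.2) (t, p) :=
    hΦ.continuousOn.continuousAt ((isOpen_Ioo.prod isOpen_univ).mem_nhds ⟨ht, mem_univ _⟩)
  have h2 : ∀ᶠ q : ℝ × P in 𝓝 (t, p), q.1 ∈ Ioo (-ε) ε :=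
    continuousAt_fst.eventually_mem (isOpen_Ioo.mem_nhds ht)
  have h3 : ∀ᶠ q : ℝ × P in 𝓝 (t, p), q.2 ∈ (extChartAt I' p₀).source :=
    continuousAt_snd.eventually_mem ((isOpen_extChartAt_source p₀).mem_nhds hp)
  filter_upwards [h1.eventually_mem ((isOpen_extChartAt_source q₀).mem_nhds hq), h2, h3]
    with q a b c
  exact ⟨b, c, a⟩

theorem hasDerivAt_bienergyDensity (hΦ : ContMDiffOn (𝓘(ℝ, ℝ).prod I') I ∞
    (fun q : ℝ × P ↦ Φ q.1 q.2) (Ioo (-ε) ε ×ˢ univ)) {t : ℝ} (ht : t ∈ Ioo (-ε) ε) {p₀ p : P}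
    {q₀ : M} (hp : p ∈ (extChartAt I' p₀).source) (hq : Φ t p ∈ (extChartAt I q₀).source) :
    HasDerivAt (fun s ↦ bienergyDensity g h Φ s p)
      (deriv (fun s ↦ coordBienergyDensity g h p₀ q₀ Φ s (extChartAt I' p₀ p)) t) t := by
  have h1 := ((smoothFamilyOn_coordBienergyDensity g h hΦ p₀ q₀).differentiableAt
    (isOpen_chartRepDomain hΦ p₀ q₀) (chart_mem_chartRepDomain ht hp hq)).hasDerivAt
  refine h1.congr_of_eventuallyEq ?_
  have h2 : ContinuousAt (fun s : ℝ ↦ (s, p)) t := by fun_prop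
  filter_upwards [h2.eventually (eventually_mem_source hΦ ht hp hq)] with s hs
  exact bienergyDensity_eq g h hΦ hs.1 hs.2.1 hs.2.2

/-- The definition of the density changes charts with the point, so continuity is not visible from
it. Near `(t, p)` the density agrees with its expression in one fixed pair of charts, which is
smooth. -/
theorem continuousAt_bienergyDensity (hΦ : ContMDiffOn (𝓘(ℝ, ℝ).prod I') I ∞
    (fun q : ℝ × P ↦ Φ q.1 q.2) (Ioo (-ε) ε ×ˢ univ)) {t : ℝ} (ht : t ∈ Ioo (-ε) ε) (p : P) :
    ContinuousAt (fun q : ℝ × P ↦ bienergyDensity g h Φ q.1 q.2) (t, p) ∧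
    ContinuousAt (fun q : ℝ × P ↦ deriv (fun s ↦ bienergyDensity g h Φ s q.2) q.1) (t, p) := by
  have hp := mem_extChartAt_source (I := I') p
  have hq := mem_extChartAt_source (I := I) (Φ t p)
  have hO := isOpen_chartRepDomain hΦ p (Φ t p)
  have hm := chart_mem_chartRepDomain ht hp hq
  have h1 := smoothFamilyOn_coordBienergyDensity g h hΦ p (Φ t p)
  have h2 : ContinuousAt (fun q : ℝ × P ↦ (q.1, extChartAt I' p q.2)) (t, p) :=
    continuousAt_fst.prodMk (ContinuousAt.comp (continuousAt_extChartAt p) continuousAt_snd)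
  constructor
  · have h3 : ContinuousAt (fun q : ℝ × E' ↦ coordBienergyDensity g h p (Φ t p) Φ q.1 q.2)
        (t, extChartAt I' p p) := h1.continuousOn.continuousAt (hO.mem_nhds hm)
    refine (ContinuousAt.comp (f := fun q : ℝ × P ↦ (q.1, extChartAt I' p q.2)) h3 h2).congr ?_
    filter_upwards [eventually_mem_source hΦ ht hp hq] with q hq
    exact (bienergyDensity_eq g h hΦ hq.1 hq.2.1 hq.2.2).symm
  · have h3 : ContinuousAt (fun q : ℝ × E' ↦
        deriv (fun s ↦ coordBienergyDensity g h p (Φ t p) Φ s q.2) q.1) (t, extChartAt I' p p) :=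
      (h1.deriv hO).continuousOn.continuousAt (hO.mem_nhds hm)
    refine (ContinuousAt.comp (f := fun q : ℝ × P ↦ (q.1, extChartAt I' p q.2)) h3 h2).congr ?_
    filter_upwards [eventually_mem_source hΦ ht hp hq] with q hq
    exact (hasDerivAt_bienergyDensity g h hΦ hq.1 hq.2.1 hq.2.2).deriv.symm

variable [T2Space P] [MeasurableSpace E'] [BorelSpace E'] [MeasurableSpace P] [BorelSpace P]

/-- The first variation of the bienergy is the integral of the derivative of its density. -/
theorem hasDerivAt_bienergy (hε : 0 < ε) (hΦ : ContMDiffOn (𝓘(ℝ, ℝ).prod I') I ∞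
    (fun q : ℝ × P ↦ Φ q.1 q.2) (Ioo (-ε) ε ×ˢ univ)) {Ω : Set P} (hΩ : IsCompact Ω) :
    HasDerivAt (fun t ↦ bienergy g h (Φ t) Ω)
      (∫ p in Ω, deriv (fun t ↦ bienergyDensity g h Φ t p) 0 ∂(riemannianVolume g)) 0 := by
  have := isLocallyFiniteMeasure_riemannianVolume g
  have h1 := hasDerivAt_setIntegral_of_continuousOn (μ := riemannianVolume g)
    (S := bienergyDensity g h Φ) (S' := fun t p ↦ deriv (fun s ↦ bienergyDensity g h Φ s p) t)
    hε hΩ (fun t ht p ↦ (hasDerivAt_bienergyDensity g h hΦ ht (mem_extChartAt_source p)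
      (mem_extChartAt_source (Φ t p))).differentiableAt.hasDerivAt)
    (fun t ht ↦ continuous_iff_continuousAt.2 fun p ↦ ContinuousAt.comp
      (f := fun p : P ↦ (t, p)) (continuousAt_bienergyDensity g h hΦ ht p).1 (by fun_prop))
    (fun q hq ↦ (continuousAt_bienergyDensity g h hΦ hq.1 q.2).2.continuousWithinAt)
  refine h1.congr_of_eventuallyEq (Filter.Eventually.of_forall fun t ↦ ?_)
  simp only [bienergy, bienergyDensity]
  rw [integral_const_mul]

theorem continuous_deriv_bienergyDensity (hε : 0 < ε) (hΦ : ContMDiffOn (𝓘(ℝ, ℝ).prod I') I ∞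
    (fun q : ℝ × P ↦ Φ q.1 q.2) (Ioo (-ε) ε ×ˢ univ)) :
    Continuous fun p ↦ deriv (fun t ↦ bienergyDensity g h Φ t p) 0 :=
  continuous_iff_continuousAt.2 fun p ↦ ContinuousAt.comp (f := fun p : P ↦ ((0 : ℝ), p))
    (continuousAt_bienergyDensity g h hΦ (by constructor <;> linarith) p).2 (by fun_prop)

end Variations

/-! ### Variations of the projection of a warped product -/

section Coordinates

variable {E : Type*} [NormedAddCommGroup E] [NormedSpace ℝ E] [FiniteDimensional ℝ E]
  {F : Type*} [NormedAddCommGroup F] [NormedSpace ℝ F] [FiniteDimensional ℝ F]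

theorem coordTension_congr_left {Gd Gd' : E → E →L[ℝ] E →L[ℝ] ℝ} {G : F → F →L[ℝ] F →L[ℝ] ℝ}
    {u : E → F} {y : E} (h : Gd =ᶠ[𝓝 y] Gd') : coordTension Gd G u y = coordTension Gd' G u y := by
  have h1 : coordSecondFundamentalForm Gd G u y = coordSecondFundamentalForm Gd' G u y := by
    ext v w
    simp only [coordSecondFundamentalForm, christoffel]
    rw [h.fderiv_eq, h.self_of_nhds]
  rw [coordTension, coordTension, h1, h.self_of_nhds]

variable {G : E → E →L[ℝ] E →L[ℝ] ℝ} {U : Set E} {K : F → F →L[ℝ] F →L[ℝ] ℝ} {W : Set F}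
  {f : E → ℝ} {z : E × F}

theorem bienergyVariation_congr {V V' : E × F → E} (h : V =ᶠ[𝓝 z] V') :
    bienergyVariation G K f V z = bienergyVariation G K f V' z := by
  have h1 : (fun x ↦ fderiv ℝ f x.1 (V x)) =ᶠ[𝓝 z] fun x ↦ fderiv ℝ f x.1 (V' x) :=
    h.mono fun x hx ↦ by simp only [hx]
  rw [bienergyVariation, bienergyVariation, coordLaplacian_congr h1, h.fderiv_eq, h.self_of_nhds]

theorem bitension_smul_right (n : ℕ) (y w : E) (c : ℝ) :
    bitension n G f y (c • w) = c * bitension n G f y w := by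
  simp only [bitension, map_smul, smul_eq_mul]
  ring

end Coordinates

/-! ### Variation fields of the projection and its first variation -/

section ProjectionVariations

variable {E : Type*} [NormedAddCommGroup E] [NormedSpace ℝ E] [FiniteDimensional ℝ E]
  {H : Type*} [TopologicalSpace H] {I : ModelWithCorners ℝ E H} [I.Boundaryless]
  {M : Type*} [TopologicalSpace M] [ChartedSpace H M] [IsManifold I ∞ M]
  {F : Type*} [NormedAddCommGroup F] [NormedSpace ℝ F] [FiniteDimensional ℝ F]
  {B : Type*} [TopologicalSpace B] {J : ModelWithCorners ℝ F B} [J.Boundaryless]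
  {N : Type*} [TopologicalSpace N] [ChartedSpace B N] [IsManifold J ∞ N]
  {Φ : ℝ → M × N → M} {ε : ℝ} {Ω : Set (M × N)}

/-- The variation field of a family of maps in charts. -/
def variationField (I : ModelWithCorners ℝ E H) (J : ModelWithCorners ℝ F B) (Φ : ℝ → M × N → M)
    (p₀ : M × N) (z : E × F) : E :=
  deriv (fun t ↦ chartRep (I.prod J) I p₀ p₀.1 (Φ t) z) 0

theorem IsVariation.mem_chartRepDomain (hv : IsVariation (I.prod J) I Prod.fst Ω ε Φ) (hε : 0 < ε)
    {p₀ : M × N} {z : E × F} (hz : z ∈ (extChartAt (I.prod J) p₀).target) :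
    ((0 : ℝ), z) ∈ chartRepDomain (I.prod J) I Φ ε p₀ p₀.1 := by
  refine ⟨⟨by constructor <;> linarith, hz⟩, ?_⟩
  rw [extChartAt_prod_target] at hz
  rw [mem_preimage, hv.zero, extChartAt_prod_symm_apply]
  exact (extChartAt I p₀.1).map_target hz.1

theorem chartRep_fst {p₀ : M × N} {z : E × F} (hz : z ∈ (extChartAt (I.prod J) p₀).target) :
    chartRep (I.prod J) I p₀ p₀.1 Prod.fst z = z.1 := by
  rw [extChartAt_prod_target] at hz
  rw [chartRep, Function.comp_apply, Function.comp_apply, extChartAt_prod_symm_apply]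
  exact (extChartAt I p₀.1).right_inv hz.1

theorem IsVariation.smooth_variationField (hv : IsVariation (I.prod J) I Prod.fst Ω ε Φ)
    (hε : 0 < ε) (p₀ : M × N) :
    ContDiffOn ℝ ∞ (variationField I J Φ p₀) (extChartAt (I.prod J) p₀).target :=
  ((smoothFamilyOn_chartRep hv.contMDiffOn p₀ p₀.1).deriv
    (isOpen_chartRepDomain hv.contMDiffOn p₀ p₀.1)).smooth_slice
      fun _ hz ↦ hv.mem_chartRepDomain hε hz

theorem IsVariation.variationField_eq_zero (hv : IsVariation (I.prod J) I Prod.fst Ω ε Φ)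
    (hε : 0 < ε) {p₀ : M × N} {z : E × F} (hz : (extChartAt (I.prod J) p₀).symm z ∉ Ω) :
    variationField I J Φ p₀ z = 0 := by
  have h1 : (fun t ↦ chartRep (I.prod J) I p₀ p₀.1 (Φ t) z) =ᶠ[𝓝 0]
      fun _ ↦ chartRep (I.prod J) I p₀ p₀.1 Prod.fst z := by
    filter_upwards [Ioo_mem_nhds (neg_lt_zero.2 hε) hε] with t ht
    simp only [chartRep, Function.comp_apply, hv.eq_of_notMem t ht _ hz]
  rw [variationField, h1.deriv_eq, deriv_const]

variable (gM : SmoothMetric I M) (gN : SmoothMetric J N) {lam : M → ℝ}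
  (hlam : ContMDiff I 𝓘(ℝ, ℝ) ∞ lam)

/-- The derivative of the bienergy density along a variation of the projection, in charts. -/
theorem IsVariation.deriv_bienergyDensity (hv : IsVariation (I.prod J) I Prod.fst Ω ε Φ)
    (hε : 0 < ε) {p₀ : M × N} {z : E × F} (hz : z ∈ (extChartAt (I.prod J) p₀).target) :
    deriv (fun t ↦ bienergyDensity (warpedProduct gM gN lam hlam) gM Φ t
        ((extChartAt (I.prod J) p₀).symm z)) 0 =
      bienergyVariation (metricInChart gM p₀.1) (metricInChart gN p₀.2)
        (lam ∘ (extChartAt I p₀.1).symm) (variationField I J Φ p₀) z := by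
  have hd := hv.mem_chartRepDomain hε hz
  have hop := isOpen_extChartAt_target (I := I.prod J) p₀
  have h1 := hasDerivAt_bienergyDensity (warpedProduct gM gN lam hlam) gM hv.contMDiffOn hd.1.1
    ((extChartAt (I.prod J) p₀).map_target hz) hd.2
  rw [h1.deriv, (extChartAt (I.prod J) p₀).right_inv hz]
  have h2 : metricInChart (warpedProduct gM gN lam hlam) p₀ =ᶠ[𝓝 z]
      coordWarped (metricInChart gM p₀.1) (metricInChart gN p₀.2)
        (lam ∘ (extChartAt I p₀.1).symm) := by
    filter_upwards [hop.mem_nhds hz] with x hx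
    exact metricInChart_warpedProduct gM gN hlam p₀ hx
  have h3 : chartRep (I.prod J) I p₀ p₀.1 (Φ 0) =ᶠ[𝓝 z] Prod.fst := by
    filter_upwards [hop.mem_nhds hz] with x hx
    rw [hv.zero, chartRep_fst hx]
  simp only [coordBienergyDensity, coordTension_congr_left h2]
  refine (hasDerivAt_normSq_coordTension (isMetricOn_metricInChart gM p₀.1)
    (isMetricOn_metricInChart gN p₀.2) (contDiffOn_comp_extChartAt_symm hlam p₀.1)
    (smoothFamilyOn_chartRep hv.contMDiffOn p₀ p₀.1) (isOpen_chartRepDomain hv.contMDiffOn p₀ p₀.1)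
    (fun q hq ↦ ?_) (fun q hq ↦ (extChartAt I p₀.1).map_source hq.2) hd h3).deriv
  rw [← extChartAt_prod_target]
  exact hq.1.2

theorem IsVariation.deriv_bienergyDensity_eq_zero
    (hv : IsVariation (I.prod J) I Prod.fst Ω ε Φ) (hε : 0 < ε) (hΩ : IsClosed Ω) {p : M × N}
    (hp : p ∉ Ω) :
    deriv (fun t ↦ bienergyDensity (warpedProduct gM gN lam hlam) gM Φ t p) 0 = 0 := by
  have hz := mem_extChartAt_target (I := I.prod J) p
  have h1 := hv.deriv_bienergyDensity gM gN hlam hε hz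
  rw [extChartAt_to_inv] at h1
  -- Writing the zero field as an empty sum makes the vanishing an instance of
  -- `bienergyVariation_sum`.
  have h2 : variationField I J Φ p =ᶠ[𝓝 (extChartAt (I.prod J) p p)]
      fun x ↦ ∑ i ∈ (∅ : Finset ℕ), (fun _ _ ↦ 0 : ℕ → E × F → E) i x := by
    have h3 : ContinuousAt (extChartAt (I.prod J) p).symm (extChartAt (I.prod J) p p) :=
      continuousAt_extChartAt_symm p
    filter_upwards [h3.eventually_mem (hΩ.isOpen_compl.mem_nhds
      (by rwa [extChartAt_to_inv]))] with x hx
    rw [hv.variationField_eq_zero hε hx, Finset.sum_empty]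
  rw [extChartAt_prod_target] at hz
  rw [h1, bienergyVariation_congr h2, bienergyVariation_sum (isMetricOn_metricInChart gM p.1)
    (isMetricOn_metricInChart gN p.2) (contDiffOn_comp_extChartAt_symm hlam p.1) hz _ (by simp),
    Finset.sum_empty]

section Integral

variable [T2Space M] [T2Space N] [MeasurableSpace E] [BorelSpace E] [MeasurableSpace F]
  [BorelSpace F] [MeasurableSpace M] [MeasurableSpace N] [BorelSpace (M × N)]

/-- The first variation of the bienergy of the projection, for a variation that is supported in
a chart domain. -/
theorem IsVariation.setIntegral_deriv_bienergyDensity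
    (hv : IsVariation (I.prod J) I Prod.fst Ω ε Φ) (hε : 0 < ε) (hΩ : IsCompact Ω) {p₀ : M × N}
    (hp₀ : Ω ⊆ (extChartAt (I.prod J) p₀).source) :
    ∫ p in Ω, deriv (fun t ↦ bienergyDensity (warpedProduct gM gN lam hlam) gM Φ t p) 0
        ∂(riemannianVolume (warpedProduct gM gN lam hlam)) =
      ∫ z in (extChartAt I p₀.1).target ×ˢ (extChartAt J p₀.2).target,
        volumeDensity (coordWarped (metricInChart gM p₀.1) (metricInChart gN p₀.2)
          (lam ∘ (extChartAt I p₀.1).symm) z) * Module.finrank ℝ F *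
        bitension (Module.finrank ℝ F) (metricInChart gM p₀.1) (lam ∘ (extChartAt I p₀.1).symm) z.1
          (variationField I J Φ p₀ z) ∂(Module.finBasis ℝ (E × F)).addHaar := by
  have hS := (isOpen_extChartAt_source (I := I.prod J) p₀).measurableSet
  have hC : IsCompact (extChartAt (I.prod J) p₀ '' Ω) :=
    hΩ.image_of_continuousOn ((continuousOn_extChartAt p₀).mono hp₀)
  have hCt : extChartAt (I.prod J) p₀ '' Ω ⊆
      (extChartAt I p₀.1).target ×ˢ (extChartAt J p₀.2).target := by
    rw [← extChartAt_prod_target]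
    rintro _ ⟨p, hp, rfl⟩
    exact (extChartAt (I.prod J) p₀).map_source (hp₀ hp)
  have hsm := hv.smooth_variationField hε p₀
  rw [extChartAt_prod_target] at hsm
  -- The derivative of the density vanishes off `Ω`, so the integral may be extended to the whole
  -- chart domain, transported to coordinates and integrated by parts there.
  rw [← setIntegral_bienergyVariation (isMetricOn_metricInChart gM p₀.1)
    (isMetricOn_metricInChart gN p₀.2) (contDiffOn_comp_extChartAt_symm hlam p₀.1) hsm hC hCt
    (fun z hz hzC ↦ hv.variationField_eq_zero hε fun h ↦ hzC ⟨_, h, ?_⟩),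
    ← setIntegral_eq_of_subset_of_forall_sdiff_eq_zero hS hp₀ (fun p hp ↦
      hv.deriv_bienergyDensity_eq_zero gM gN hlam hε hΩ.isClosed hp.2),
    setIntegral_riemannianVolume_source _ _
      (continuous_deriv_bienergyDensity _ _ hε hv.contMDiffOn).measurable, ← extChartAt_prod_target]
  · refine setIntegral_congr_fun (isOpen_extChartAt_target p₀).measurableSet fun z hz ↦ ?_
    rw [hv.deriv_bienergyDensity gM gN hlam hε hz, metricInChart_warpedProduct gM gN hlam p₀ hz]
  · rw [← extChartAt_prod_target] at hz
    exact (extChartAt (I.prod J) p₀).right_inv hz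

end Integral

end ProjectionVariations

/-! ### Biharmonicity of the projection -/

section Biharmonic

variable {E : Type*} [NormedAddCommGroup E] [NormedSpace ℝ E] [FiniteDimensional ℝ E]
  {H : Type*} [TopologicalSpace H] {I : ModelWithCorners ℝ E H} [I.Boundaryless]
  {M : Type*} [TopologicalSpace M] [ChartedSpace H M] [IsManifold I ∞ M]
  {F : Type*} [NormedAddCommGroup F] [NormedSpace ℝ F] [FiniteDimensional ℝ F]
  {B : Type*} [TopologicalSpace B] {J : ModelWithCorners ℝ F B} [J.Boundaryless]
  {N : Type*} [TopologicalSpace N] [ChartedSpace B N] [IsManifold J ∞ N]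
  {Φ : ℝ → M × N → M} {ε : ℝ} {Ω : Set (M × N)}

/-- The rescaling of a variation by a cut-off function. -/
theorem IsVariation.scale (hv : IsVariation (I.prod J) I Prod.fst Ω ε Φ) {χ : M × N → ℝ}
    (hχ : ContMDiff (I.prod J) 𝓘(ℝ, ℝ) ∞ χ) (h0 : ∀ p, 0 ≤ χ p) (h1 : ∀ p, χ p ≤ 1) :
    IsVariation (I.prod J) I Prod.fst (Ω ∩ tsupport χ) ε (fun t p ↦ Φ (χ p * t) p) := by
  have hm {t : ℝ} (ht : t ∈ Ioo (-ε) ε) (p : M × N) : χ p * t ∈ Ioo (-ε) ε := by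
    rw [mem_Ioo, ← abs_lt] at ht ⊢
    rw [abs_mul, abs_of_nonneg (h0 p)]
    exact (mul_le_of_le_one_left (abs_nonneg t) (h1 p)).trans_lt ht
  refine ⟨?_, ?_, fun t ht p hp ↦ ?_⟩
  · have h2 : ContMDiff (𝓘(ℝ, ℝ).prod (I.prod J)) (𝓘(ℝ, ℝ).prod (I.prod J)) ∞
        (fun q : ℝ × (M × N) ↦ (χ q.2 * q.1, q.2)) :=
      ((hχ.comp contMDiff_snd).mul contMDiff_fst).prodMk contMDiff_snd
    exact hv.contMDiffOn.comp h2.contMDiffOn fun q hq ↦ ⟨hm hq.1 _, mem_univ _⟩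
  · funext p
    simp only [mul_zero, hv.zero]
  · by_cases hpΩ : p ∈ Ω
    · have h2 : χ p = 0 := image_eq_zero_of_notMem_tsupport fun h ↦ hp ⟨hpΩ, h⟩
      simp only [h2, zero_mul, hv.zero]
    · exact hv.eq_of_notMem _ (hm ht p) p hpΩ

/-- Chain rule in the parameter: slowing time by `χ` multiplies the variation field by `χ`, without
any linear structure on the target. -/
theorem variationField_scale (χ : M × N → ℝ) (p₀ : M × N) (z : E × F) :
    variationField I J (fun t p ↦ Φ (χ p * t) p) p₀ z =
      χ ((extChartAt (I.prod J) p₀).symm z) • variationField I J Φ p₀ z := by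
  have h := deriv_comp_mul_left (χ ((extChartAt (I.prod J) p₀).symm z))
    (fun t ↦ chartRep (I.prod J) I p₀ p₀.1 (Φ t) z) 0
  rw [mul_zero] at h
  exact h

variable (gM : SmoothMetric I M) (gN : SmoothMetric J N) {lam : M → ℝ}
  (hlam : ContMDiff I 𝓘(ℝ, ℝ) ∞ lam)
  [T2Space M] [T2Space N] [SigmaCompactSpace (M × N)]
  [MeasurableSpace E] [BorelSpace E] [MeasurableSpace F]
  [BorelSpace F] [MeasurableSpace M] [MeasurableSpace N] [BorelSpace (M × N)]

/-- The first variation is linear in the variation field. A partition of unity therefore reduces to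
variations supported in a single chart, where the integrand is a multiple of the bitension. -/
theorem isBiharmonic_fst_of_bitension_eq_zero
    (hb : ∀ x₀ : M, ∀ y ∈ (extChartAt I x₀).target, ∀ w : E,
      bitension (Module.finrank ℝ F) (metricInChart gM x₀) (lam ∘ (extChartAt I x₀).symm) y w = 0) :
    IsBiharmonic (warpedProduct gM gN lam hlam) gM (Prod.fst : M × N → M) := by
  refine ⟨contMDiff_fst, fun Ω hΩ ε hε Φ hv ↦ ?_⟩
  have hlf := isLocallyFiniteMeasure_riemannianVolume (warpedProduct gM gN lam hlam)
  have h1 := hasDerivAt_bienergy (warpedProduct gM gN lam hlam) gM hε hv.contMDiffOn hΩ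
  refine h1.congr_deriv ?_
  obtain ⟨χ, hχ⟩ := SmoothPartitionOfUnity.exists_isSubordinate_chartAt_source (I.prod J) (M × N)
  have hfin := χ.locallyFinite.finite_nonempty_inter_compact hΩ
  have hvi (i) := hv.scale (χ i).contMDiff (χ.nonneg i) (χ.le_one i)
  have hΩi (i) : IsCompact (Ω ∩ tsupport (χ i)) := hΩ.inter_right (isClosed_tsupport _)
  -- Only finitely many cut-offs meet the compact set `Ω`. They sum to one on `Ω`, and off `Ω` the
  -- variation field is zero.
  have hV (p₀ : M × N) (z : E × F) : variationField I J Φ p₀ z =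
      ∑ i ∈ hfin.toFinset, variationField I J (fun t p ↦ Φ (χ i p * t) p) p₀ z := by
    simp only [variationField_scale, ← Finset.sum_smul]
    by_cases hz : (extChartAt (I.prod J) p₀).symm z ∈ Ω
    · rw [χ.sum_finsupport' _ (mem_univ _), one_smul]
      intro i hi
      rw [Finite.mem_toFinset]
      exact ⟨_, (χ.mem_finsupport _).1 hi, hz⟩
    · rw [hv.variationField_eq_zero hε hz, smul_zero]
  have hsum (p : M × N) :
      deriv (fun t ↦ bienergyDensity (warpedProduct gM gN lam hlam) gM Φ t p) 0 =
        ∑ i ∈ hfin.toFinset, deriv (fun t ↦ bienergyDensity (warpedProduct gM gN lam hlam) gM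
          (fun t p ↦ Φ (χ i p * t) p) t p) 0 := by
    have hz := mem_extChartAt_target (I := I.prod J) p
    have h2 := hv.deriv_bienergyDensity gM gN hlam hε hz
    have h3 (i) := (hvi i).deriv_bienergyDensity gM gN hlam hε hz
    have h4 (i) := (hvi i).smooth_variationField hε p
    simp only [extChartAt_to_inv] at h2 h3
    rw [extChartAt_prod_target] at hz h4
    simp only [h2, h3]
    rw [← bienergyVariation_sum (isMetricOn_metricInChart gM p.1) (isMetricOn_metricInChart gN p.2)
      (contDiffOn_comp_extChartAt_symm hlam p.1) hz _ fun i _ ↦ h4 i]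
    exact congrArg (fun V ↦ bienergyVariation _ _ _ V _) (funext (hV p))
  simp only [hsum]
  rw [integral_finsetSum _ fun i _ ↦ (continuous_deriv_bienergyDensity _ _ hε
    (hvi i).contMDiffOn).continuousOn.integrableOn_compact hΩ]
  refine Finset.sum_eq_zero fun i _ ↦ ?_
  rw [setIntegral_eq_of_subset_of_forall_sdiff_eq_zero hΩ.measurableSet inter_subset_left
    (fun p hp ↦ (hvi i).deriv_bienergyDensity_eq_zero gM gN hlam hε (hΩi i).isClosed hp.2),
    (hvi i).setIntegral_deriv_bienergyDensity gM gN hlam hε (hΩi i) (p₀ := i) ?_]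
  · refine (setIntegral_congr_fun ((isOpen_extChartAt_target i.1).prod
      (isOpen_extChartAt_target i.2)).measurableSet fun z hz ↦ ?_).trans (integral_zero' _ _)
    simp only [hb i.1 z.1 hz.1, mul_zero, Pi.zero_apply]
  · rw [extChartAt_source]
    exact inter_subset_right.trans (hχ i)

/-- In a chart there is a compactly supported variation of the projection in the direction `w`. -/
theorem exists_isVariation (p₀ : M × N) (w : E) {r : ℝ} (hr : 0 < r)
    (hT : Metric.closedBall (extChartAt (I.prod J) p₀ p₀) (2 * r) ⊆
      (extChartAt (I.prod J) p₀).target) :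
    ∃ (Φ : ℝ → M × N → M) (ε : ℝ) (η : ContDiffBump (extChartAt (I.prod J) p₀ p₀)), 0 < ε ∧
      η.rOut = r ∧ IsVariation (I.prod J) I Prod.fst ((extChartAt (I.prod J) p₀).symm ''
        Metric.closedBall (extChartAt (I.prod J) p₀ p₀) r) ε Φ ∧
      ∀ z ∈ (extChartAt (I.prod J) p₀).target, variationField I J Φ p₀ z = η z • w := by
  classical
  set z₀ := extChartAt (I.prod J) p₀ p₀ with hz₀
  set C := Metric.closedBall z₀ r with hC
  have hCT : C ⊆ (extChartAt (I.prod J) p₀).target :=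
    (Metric.closedBall_subset_closedBall (by linarith)).trans hT
  let η : ContDiffBump z₀ := ⟨r / 2, r, by linarith, by linarith⟩
  have hη0 (z : E × F) (hz : z ∉ C) : η z = 0 :=
    η.zero_of_le_dist (le_of_lt (by simpa [hC] using hz))
  let Φ : ℝ → M × N → M := fun t p ↦ if p ∈ (extChartAt (I.prod J) p₀).source then
    (extChartAt I p₀.1).symm (extChartAt I p₀.1 p.1 + (t * η (extChartAt (I.prod J) p₀ p)) • w)
    else p.1
  have hΩ : IsCompact ((extChartAt (I.prod J) p₀).symm '' C) :=
    (isCompact_closedBall z₀ r).image_of_continuousOn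
      ((continuousOn_extChartAt_symm p₀).mono hCT)
  -- For `|t| < r / (‖w‖ + 1)` the displacement `t η w` has norm at most `r`, so a point of the ball
  -- of radius `r` stays in the ball of radius `2 r`, inside the chart. The `+ 1` covers `w = 0`.
  have hε : 0 < r / (‖w‖ + 1) := by positivity
  have hsrc {p : M × N} (hp : p ∈ (extChartAt (I.prod J) p₀).source) :
      p.1 ∈ (extChartAt I p₀.1).source := by
    rw [extChartAt_prod, PartialEquiv.prod_source] at hp
    exact hp.1
  have hchart (p : M × N) : (extChartAt (I.prod J) p₀ p).1 = extChartAt I p₀.1 p.1 := by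
    rw [extChartAt_prod]
    rfl
  have hshift {t : ℝ} (ht : t ∈ Ioo (-(r / (‖w‖ + 1))) (r / (‖w‖ + 1))) {z : E × F}
      (hz : z ∈ (extChartAt (I.prod J) p₀).target) :
      z.1 + (t * η z) • w ∈ (extChartAt I p₀.1).target := by
    by_cases hzC : z ∈ C
    · have h1 : ‖(t * η z) • w‖ ≤ r := by
        rw [norm_smul, Real.norm_eq_abs, abs_mul, abs_of_nonneg η.nonneg]
        have h2 : |t| ≤ r / (‖w‖ + 1) := (abs_lt.2 ht).le
        calc |t| * η z * ‖w‖ ≤ r / (‖w‖ + 1) * 1 * (‖w‖ + 1) := by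
              gcongr
              · exact η.nonneg
              · exact η.le_one
              · linarith
          _ = r := by field_simp
      have h3 : z + ((t * η z) • w, (0 : F)) ∈ Metric.closedBall z₀ (2 * r) := by
        rw [mem_closedBall_iff_norm]
        have h4 : ‖(((t * η z) • w, 0) : E × F)‖ ≤ r := by
          rw [Prod.norm_mk, norm_zero]
          exact max_le h1 hr.le
        have h5 : ‖z - z₀‖ ≤ r := mem_closedBall_iff_norm.1 hzC
        calc ‖z + ((t * η z) • w, (0 : F)) - z₀‖
            = ‖(z - z₀) + ((t * η z) • w, (0 : F))‖ := by rw [add_sub_right_comm]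
          _ ≤ 2 * r := (norm_add_le _ _).trans (by linarith)
      have h6 := hT h3
      rw [extChartAt_prod_target] at h6
      exact h6.1
    · rw [hη0 z hzC, mul_zero, zero_smul, add_zero]
      rw [extChartAt_prod_target] at hz
      exact hz.1
  have hoff (t : ℝ) (p : M × N) (hp : p ∉ (extChartAt (I.prod J) p₀).symm '' C) :
      Φ t p = p.1 := by
    by_cases hps : p ∈ (extChartAt (I.prod J) p₀).source
    · have h1 : extChartAt (I.prod J) p₀ p ∉ C := fun h ↦
        hp ⟨_, h, (extChartAt (I.prod J) p₀).left_inv hps⟩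
      simp only [Φ, if_pos hps, hη0 _ h1, mul_zero, zero_smul, add_zero]
      exact (extChartAt I p₀.1).left_inv (hsrc hps)
    · exact if_neg hps
  refine ⟨Φ, r / (‖w‖ + 1), η, hε, rfl, ⟨?_, ?_, fun t _ p hp ↦ hoff t p hp⟩, fun z hz ↦ ?_⟩
  · intro q hq
    by_cases hqs : q.2 ∈ (extChartAt (I.prod J) p₀).source
    · have hopen : IsOpen (Ioo (-(r / (‖w‖ + 1))) (r / (‖w‖ + 1)) ×ˢ
          (extChartAt (I.prod J) p₀).source) :=
        isOpen_Ioo.prod (isOpen_extChartAt_source p₀)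
      have hc : ContMDiffOn (𝓘(ℝ, ℝ).prod (I.prod J)) 𝓘(ℝ, E × F) ∞
          (fun q : ℝ × (M × N) ↦ extChartAt (I.prod J) p₀ q.2)
          (Ioo (-(r / (‖w‖ + 1))) (r / (‖w‖ + 1)) ×ˢ (extChartAt (I.prod J) p₀).source) :=
        (contMDiffOn_extChartAt (x := p₀)).comp contMDiff_snd.contMDiffOn fun q hq ↦ by
          simpa using hq.2
      have hs : ContDiff ℝ ∞ (fun s : ℝ × (E × F) ↦ s.2.1 + (s.1 * η s.2) • w) := by
        have hs₁ : ContDiff ℝ ∞ (fun s : ℝ × (E × F) ↦ s.1 * η s.2) :=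
          contDiff_fst.mul (η.contDiff.comp contDiff_snd)
        exact (contDiff_fst.comp contDiff_snd).add (hs₁.smul contDiff_const)
      have hall : ContMDiffOn (𝓘(ℝ, ℝ).prod (I.prod J)) I ∞ (fun q : ℝ × (M × N) ↦ Φ q.1 q.2)
          (Ioo (-(r / (‖w‖ + 1))) (r / (‖w‖ + 1)) ×ˢ (extChartAt (I.prod J) p₀).source) := by
        refine ((contMDiffOn_extChartAt_symm p₀.1).comp (hs.contMDiff.comp_contMDiffOn
          (contMDiff_fst.contMDiffOn.prodMk_space hc)) fun q hq ↦ ?_).congr fun q hq ↦ ?_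
        · exact hshift hq.1 ((extChartAt (I.prod J) p₀).map_source hq.2)
        · simp only [Φ, if_pos hq.2, Function.comp_apply, hchart]
      exact (hall.contMDiffAt (hopen.mem_nhds ⟨hq.1, hqs⟩)).contMDiffWithinAt
    · have hqΩ : q.2 ∉ (extChartAt (I.prod J) p₀).symm '' C := by
        rintro ⟨z, hz, hzq⟩
        exact hqs (hzq ▸ (extChartAt (I.prod J) p₀).map_target (hCT hz))
      have h1 : ContMDiffAt (𝓘(ℝ, ℝ).prod (I.prod J)) I ∞
          (fun q : ℝ × (M × N) ↦ q.2.1) q := (contMDiff_fst.comp contMDiff_snd).contMDiffAt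
      refine (h1.congr_of_eventuallyEq ?_).contMDiffWithinAt
      filter_upwards [continuousAt_snd.eventually_mem (hΩ.isClosed.isOpen_compl.mem_nhds hqΩ)]
        with q' hq'
      exact hoff _ _ hq'
  · funext p
    by_cases hps : p ∈ (extChartAt (I.prod J) p₀).source
    · simp only [Φ, if_pos hps, zero_mul, zero_smul, add_zero]
      exact (extChartAt I p₀.1).left_inv (hsrc hps)
    · exact if_neg hps
  · have h1 : (fun t ↦ chartRep (I.prod J) I p₀ p₀.1 (Φ t) z) =ᶠ[𝓝 0]
        fun t ↦ z.1 + (t * η z) • w := by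
      filter_upwards [Ioo_mem_nhds (neg_lt_zero.2 hε) hε] with t ht
      have h2 := (extChartAt (I.prod J) p₀).map_target hz
      have h3 := hchart ((extChartAt (I.prod J) p₀).symm z)
      rw [(extChartAt (I.prod J) p₀).right_inv hz] at h3
      simp only [chartRep, Function.comp_apply, Φ, if_pos h2, ← h3,
        (extChartAt (I.prod J) p₀).right_inv hz]
      exact (extChartAt I p₀.1).right_inv (hshift ht hz)
    have h4 : HasDerivAt (fun t : ℝ ↦ z.1 + (t * η z) • w) (η z • w) 0 := by
      simpa using! (((hasDerivAt_id (0 : ℝ)).mul_const (η z)).smul_const w).const_add z.1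
    rw [variationField, h1.deriv_eq, h4.deriv]

/-- The fundamental lemma of the calculus of variations: a bump variation in a direction where the
bitension is positive would have strictly positive first variation. -/
theorem bitension_eq_zero_of_isBiharmonic_fst (hF : 0 < Module.finrank ℝ F)
    (h : IsBiharmonic (warpedProduct gM gN lam hlam) gM (Prod.fst : M × N → M)) (p₀ : M × N)
    (w : E) :
    bitension (Module.finrank ℝ F) (metricInChart gM p₀.1) (lam ∘ (extChartAt I p₀.1).symm)
      (extChartAt I p₀.1 p₀.1) w = 0 := by
  set n := Module.finrank ℝ F with hn
  set G := metricInChart gM p₀.1 with hG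
  set f := lam ∘ (extChartAt I p₀.1).symm with hf
  set T := (extChartAt I p₀.1).target ×ˢ (extChartAt J p₀.2).target with hT
  set z₀ := extChartAt (I.prod J) p₀ p₀ with hz₀
  have hT' : (extChartAt (I.prod J) p₀).target = T := extChartAt_prod_target p₀
  have hGm := isMetricOn_metricInChart gM p₀.1
  have hKm := isMetricOn_metricInChart gN p₀.2
  have hfs := contDiffOn_comp_extChartAt_symm hlam p₀.1
  have hGt := isMetricOn_coordWarped hGm hKm hfs
  have hz₀T : z₀ ∈ T := hT' ▸ mem_extChartAt_target p₀
  have hz₀1 : z₀.1 = extChartAt I p₀.1 p₀.1 := by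
    rw [hz₀, extChartAt_prod]
    rfl
  by_contra hw
  rw [← hz₀1] at hw
  -- Replacing `w` by `c • w` turns the value at the centre into `c² > 0`, whatever the sign of `c`.
  set c := bitension n G f z₀.1 w with hc
  have hb : ContDiffOn ℝ ∞ (fun z : E × F ↦ bitension n G f z.1 (c • w)) T :=
    hGm.smooth_bitension hfs n contDiffOn_fst (fun z hz ↦ hz.1) contDiffOn_const
  have hb0 : 0 < bitension n G f z₀.1 (c • w) := by
    rw [bitension_smul_right, ← hc]
    exact mul_self_pos.2 hw
  have hnear : ∀ᶠ z in 𝓝 z₀, z ∈ T ∧ 0 < bitension n G f z.1 (c • w) :=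
    (hGt.isOpen.eventually_mem hz₀T).and
      ((hb.continuousOn.continuousAt (hGt.isOpen.mem_nhds hz₀T)).eventually (lt_mem_nhds hb0))
  obtain ⟨δ, hδ, hδT⟩ := Metric.eventually_nhds_iff_ball.1 hnear
  -- The bump variation needs the closed ball of twice its radius inside the chart, and `2δ/3 < δ`.
  have hr : 0 < δ / 3 := by positivity
  obtain ⟨Φ, ε, η, hε, hη, hv, hV⟩ := exists_isVariation (I := I) (J := J) p₀ (c • w) hr (by
    rw [hT']
    exact fun z hz ↦ (hδT z (Metric.closedBall_subset_ball (by linarith) hz)).1)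
  have hCδ (z : E × F) (hz : z ∈ Metric.closedBall z₀ (δ / 3)) := hδT z
    (Metric.closedBall_subset_ball (by linarith) hz)
  have hΩ : IsCompact ((extChartAt (I.prod J) p₀).symm '' Metric.closedBall z₀ (δ / 3)) :=
    (isCompact_closedBall z₀ _).image_of_continuousOn
      ((continuousOn_extChartAt_symm p₀).mono fun z hz ↦ hT' ▸ (hCδ z hz).1)
  -- Two derivatives of one function at `0`: zero by biharmonicity, and the integral of the first
  -- variation.
  have hzero := (h.2 _ hΩ ε hε Φ hv).unique
    (hasDerivAt_bienergy (warpedProduct gM gN lam hlam) gM hε hv.contMDiffOn hΩ)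
  rw [hv.setIntegral_deriv_bienergyDensity gM gN hlam hε hΩ (by
    rintro _ ⟨z, hz, rfl⟩
    exact (extChartAt (I.prod J) p₀).map_target (hT' ▸ (hCδ z hz).1))] at hzero
  set k : E × F → ℝ := fun z ↦ volumeDensity (coordWarped G (metricInChart gN p₀.2) f z) * n *
    bitension n G f z.1 (variationField I J Φ p₀ z) with hk
  have hsm := hv.smooth_variationField hε p₀
  rw [hT'] at hsm hV
  have hkV (z : E × F) (hz : z ∈ T) : k z = volumeDensity
      (coordWarped G (metricInChart gN p₀.2) f z) * n * (η z * bitension n G f z.1 (c • w)) := by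
    simp only [hk, hV z hz, bitension_smul_right n z.1 (c • w)]
  have hks : ContDiffOn ℝ ∞ k T :=
    (hGt.smooth_volumeDensity.mul contDiffOn_const).mul
      (hGm.smooth_bitension hfs n contDiffOn_fst (fun z hz ↦ hz.1) hsm)
  have hk0 (z : E × F) (hz : z ∈ T) (hzC : z ∉ Metric.closedBall z₀ (δ / 3)) : k z = 0 := by
    rw [hkV z hz, η.zero_of_le_dist (hη.trans_le (not_le.1 hzC).le), zero_mul,
      mul_zero]
  have hρ (z : E × F) (hz : z ∈ T) :
      0 < volumeDensity (coordWarped G (metricInChart gN p₀.2) f z) * n :=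
    mul_pos (hGt.form z hz).volumeDensity_pos (Nat.cast_pos.2 hF)
  have hnonneg : 0 ≤ T.indicator k := by
    intro z
    refine indicator_nonneg (fun z hz ↦ ?_) z
    by_cases hzC : z ∈ Metric.closedBall z₀ (δ / 3)
    · rw [hkV z hz]
      exact mul_nonneg (hρ z hz).le (mul_nonneg η.nonneg (hCδ z hzC).2.le)
    · rw [hk0 z hz hzC]
  have hcont := contDiff_indicator hGt.isOpen (isCompact_closedBall z₀ (δ / 3))
    (fun z hz ↦ (hCδ z hz).1) hks hk0
  have hpos := hcont.continuous.integral_pos_of_hasCompactSupport_nonneg_nonzero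
    (μ := (Module.finBasis ℝ (E × F)).addHaar) (x := z₀)
    (hasCompactSupport_indicator (isCompact_closedBall z₀ (δ / 3)) hk0) hnonneg (by
      rw [indicator_of_mem hz₀T, hkV z₀ hz₀T, η.one_of_mem_closedBall
        (Metric.mem_closedBall_self η.rIn_pos.le), one_mul]
      exact (mul_pos (hρ z₀ hz₀T) hb0).ne')
  rw [integral_indicator hGt.isOpen.measurableSet] at hpos
  exact hpos.ne hzero

end Biharmonic

end RiemannianGeometry

end

/-! ### The characterization of biharmonicity -/

theorem mainTheorem3 {m n : ℕ} (hn : 1 ≤ n)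
    {M : Type*} [TopologicalSpace M] [T2Space M] [SecondCountableTopology M]
    [MeasurableSpace M] [BorelSpace M]
    [ChartedSpace (EuclideanSpace ℝ (Fin m)) M] [IsManifold (𝓡 m) ∞ M]
    {N : Type*} [TopologicalSpace N] [T2Space N] [SecondCountableTopology N]
    [MeasurableSpace N] [BorelSpace N]
    [ChartedSpace (EuclideanSpace ℝ (Fin n)) N] [IsManifold (𝓡 n) ∞ N] [Nonempty N]
    (gM : RiemannianGeometry.SmoothMetric (𝓡 m) M) (gN : RiemannianGeometry.SmoothMetric (𝓡 n) N)
    (lam : M → ℝ) (hlam : ContMDiff (𝓡 m) 𝓘(ℝ, ℝ) ∞ lam) :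
    RiemannianGeometry.IsBiharmonic (RiemannianGeometry.warpedProduct gM gN lam hlam) gM
        (Prod.fst : M × N → M) ↔
      ∀ x : M,
        RiemannianGeometry.grad gM (RiemannianGeometry.laplacian gM lam) x +
            (2 : ℝ) • RiemannianGeometry.ricci gM (RiemannianGeometry.grad gM lam x) +
            ((n : ℝ) / 2) • RiemannianGeometry.grad gM
              (fun z ↦ RiemannianGeometry.normSq gM (RiemannianGeometry.grad gM lam z)) x = 0 := by
  -- Local compactness and second countability make `M × N` σ-compact, as the partition of unity
  -- requires.
  have := ChartedSpace.locallyCompactSpace (EuclideanSpace ℝ (Fin m)) M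
  have := ChartedSpace.locallyCompactSpace (EuclideanSpace ℝ (Fin n)) N
  have hfin : Module.finrank ℝ (EuclideanSpace ℝ (Fin n)) = n := by simp
  constructor
  · intro h x
    obtain ⟨y⟩ := ‹Nonempty N›
    refine (RiemannianGeometry.bitensionField_eq_zero_iff gM hlam n x).2 fun w ↦ ?_
    have h1 := RiemannianGeometry.bitension_eq_zero_of_isBiharmonic_fst gM gN hlam
      (by rwa [hfin]) h (x, y) w
    rwa [hfin] at h1
  · intro h
    refine RiemannianGeometry.isBiharmonic_fst_of_bitension_eq_zero gM gN hlam fun x₀ y hy w ↦ ?_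
    rw [hfin]
    exact RiemannianGeometry.bitension_eq_zero_of_forall gM hlam n h x₀ hy w
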